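/- Let $u\in C^\infty(\mathbb{R}^3)$ be a real-valued solution of $(-\Delta)^{3/2}u=2e^{3u}$ in $\mathbb{R}^3$ with finite volume $V:=\int_{\mathbb{R}^3}e^{3u}\,dx<\infty$. Here being a solution means that $\int_{\mathbb{R}^3}\frac{|\Delta u(x)|}{1+|x|^4}\,dx<\infty$ and $$\int_{\mathbb{R}^3}(-\Delta u)\,(-\Delta)^{1/2}\varphi\,dx=\int_{\mathbb{R}^3}2e^{3u}\varphi\,dx\qquad\text{for every Schwartz function }\varphi\in\mathcal{S}(\mathbb{R}^3),$$ where $(-\Delta)^{1/2}\varphi$ is defined by $\widehat{(-\Delta)^{1/2}\varphi}(\xi)=|\xi|\hat\varphi(\xi)$, with $\hat\varphi(\xi)=(2\pi)^{-3/2}\int_{\mathbb{R}^3}\varphi(x)e^{-ix\cdot\xi}\,dx$. Set $$\alpha:=\frac{V}{\pi^2},\qquad v(x):=\frac{1}{\pi^2}\int_{\mathbb{R}^3}\log\left(\frac{|y|}{|x-y|}\right)e^{3u(y)}\,dy.$$ Then the integral defining $v(x)$ converges absolutely for every $x\in\mathbb{R}^3$, the function $v$ is smooth, and $$u=v+p,$$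 where $p$ is a polynomial on $\mathbb{R}^3$ that is either constant (possibly zero) or of degree $2$, and $\sup_{\mathbb{R}^3}p<\infty$. Moreover, $$\lim_{|x|\to\infty}\nabla^\ell v(x)=0\quad\text{for }\ell=1,2,$$ and $$v(x)=-\alpha\log|x|+o(\log|x|)\quad\text{as }|x|\to\infty,$$ where $\alpha>0$. -/

import Mathlib

open MeasureTheory Filter Topology Asymptotics
open scoped ContDiff SchwartzMap FourierTransform Laplacian

/-- The operator `(-Δ)^{1/2}` on a Schwartz function `φ` on `ℝ³`. It is the Fourier multiplier with
symbol `|ω|` for the angular frequency `ω`. Mathlib's Fourier transform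
`𝓕 φ ξ = ∫ exp (-2πi ⟪x, ξ⟫) φ x dx` uses the frequency `ξ = ω / (2π)`, so the symbol is
`2π|ξ|`. -/
noncomputable def halfLaplacian (φ : 𝓢(EuclideanSpace ℝ (Fin 3), ℂ)) :
    EuclideanSpace ℝ (Fin 3) → ℂ :=
  𝓕⁻ (fun ξ : EuclideanSpace ℝ (Fin 3) =>
    ((2 * Real.pi * ‖ξ‖ : ℝ) : ℂ) * 𝓕 (φ : EuclideanSpace ℝ (Fin 3) → ℂ) ξ)

/-- The space `L_{1/2}(ℝ³)` of the locally integrable functions `w` with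
`∫ |w(x)| / (1 + |x|⁴) dx < ∞`. -/
def MemLHalf (w : EuclideanSpace ℝ (Fin 3) → ℝ) : Prop :=
  LocallyIntegrable w volume ∧ Integrable (fun x => |w x| / (1 + ‖x‖ ^ 4)) volume

/-- `u` is a smooth solution of `(-Δ)^{3/2} u = f` on `ℝ³`, where the function `f` is regarded as
the tempered distribution `φ ↦ ∫ f φ`: the Laplacian of `u` lies in `L_{1/2}(ℝ³)`, and
`∫ (-Δ u) (-Δ)^{1/2} φ = ∫ f φ` for every Schwartz function `φ`.
A smooth function lies in `W^{2,1}_loc`, and its weak Laplacian is the classical one. -/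
structure IsSmoothSolution (u f : EuclideanSpace ℝ (Fin 3) → ℝ) : Prop where
  smooth : ContDiff ℝ ∞ u
  laplacian_mem : MemLHalf (Δ u)
  /-- The integrals that define the distribution `f` converge (automatic for integrable `f`). -/
  rhs_integrable : ∀ φ : 𝓢(EuclideanSpace ℝ (Fin 3), ℂ),
    Integrable (fun x => ((f x : ℝ) : ℂ) * φ x) volume
  weak_eq : ∀ φ : 𝓢(EuclideanSpace ℝ (Fin 3), ℂ),
    ∫ x, ((-(Δ u x) : ℝ) : ℂ) * halfLaplacian φ x = ∫ x, ((f x : ℝ) : ℂ) * φ x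

/-- The volume `V = ∫ e^{3u} dx` of the metric `e^{2u}|dx|²`. -/
noncomputable def confVolume (u : EuclideanSpace ℝ (Fin 3) → ℝ) : ℝ :=
  ∫ x, Real.exp (3 * u x)

/-- The integrand `log (|y| / |x - y|) e^{3u(y)}` of the logarithmic potential. -/
noncomputable def logKernel (u : EuclideanSpace ℝ (Fin 3) → ℝ)
    (x y : EuclideanSpace ℝ (Fin 3)) : ℝ :=
  Real.log (‖y‖ / ‖x - y‖) * Real.exp (3 * u y)

/-- The logarithmic potential `v(x) = π⁻² ∫ log (|y| / |x - y|) e^{3u(y)} dy`. -/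
noncomputable def logPotential (u : EuclideanSpace ℝ (Fin 3) → ℝ)
    (x : EuclideanSpace ℝ (Fin 3)) : ℝ :=
  1 / Real.pi ^ 2 * ∫ y, logKernel u x y

/-! Write `f = e^{3u}`, `V = ∫ f` and `p = u - v`. In dimension three `Δ log|z| = |z|⁻²`, and
`|z|⁻²` is `2π²` times the fundamental solution of `(-Δ)^{1/2}`. Hence `v` solves the same equation
as `u`, and `g = Δp = Δu + π⁻² (f * |z|⁻²)` pairs to zero with every function whose Fourier
transform is smooth, compactly supported and zero near the origin (`exists_schwartzMap_riesz`,
`laplacian_sub_logPot_eq`). As `g` is integrable against `(1 + |x|⁴)⁻¹`, a Liouville theorem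
(`eq_of_integral_mul_fourierInv_eq_zero`) makes it constant: averages of `g` against band-limited
mollifiers do not depend on the scale, they return `g x` as the scale shrinks, and they forget `x`
as the scale grows.

So `Δp` is constant and `p` has a mean value property. Since `v ≥ -α log(1 + |x|) - const`, the
function `e^{3p} = f e^{-3v}` is `f` times a factor of polynomial growth; Jensen's inequality on
unit-scale averages then bounds `p` above by a logarithm (`exists_le_log_of_exp_le`). This upper
bound and the mean value property control the mass of `|p|` on balls of radius `r` by `r⁵`, so third
derivatives are `O(1/r)` and vanish (`fderiv_fderiv_fderiv_apply_eq_zero`). A quadratic polynomial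
with logarithmic growth from above is bounded above, and it cannot have degree one.

With `sup p < ∞` one has `f ≤ M e^{3v}`. Far out, the mass of `f` near a point is small, so a Jensen
argument in the style of Brezis and Merle gives local `L²` bounds on `f`; these bound the singular
part of `v`, hence `v` from above, hence `f` (`exists_le_of_le_exp_logPot`). Boundedness of `f`
gives `v = -α log|x| + o(log|x|)`; this forces `f → 0`, and `f → 0` forces the first two derivatives
of `v` to vanish at infinity. Finally `v = u - p` is smooth because `u` and `p` are. -/

set_option linter.unusedSectionVars false
set_option maxSynthPendingDepth 3

/-! ### Convolution with kernels bounded by `C (1 + |z|⁻²)` in dimension three -/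

section SingularKernels

variable {E : Type*} [NormedAddCommGroup E] [InnerProductSpace ℝ E] [FiniteDimensional ℝ E]
  [MeasurableSpace E] [BorelSpace E] [hE : Fact (Module.finrank ℝ E = 3)]
  {F : Type*} [NormedAddCommGroup F] [NormedSpace ℝ F] [FiniteDimensional ℝ F]

theorem integrableOn_ball_inv_norm_sq (r : ℝ) :
    IntegrableOn (fun z : E => (‖z‖ ^ 2)⁻¹) (Metric.ball 0 r) := by
  refine integrableOn_ball_of_norm_le_rpow (C := 1) (α := 2) (by rw [hE.out]; norm_num)
    (by rw [hE.out]; norm_num) ?_ ?_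
  · refine ae_of_all _ fun z => ?_
    rw [Real.rpow_neg (norm_nonneg _), one_mul, Real.norm_of_nonneg (by positivity)]
    norm_cast
  · exact (by fun_prop : Measurable fun z : E => (‖z‖ ^ 2)⁻¹).aestronglyMeasurable

theorem integrable_indicator_inv_norm_sq :
    Integrable ((Metric.ball (0 : E) 1).indicator fun z : E => (‖z‖ ^ 2)⁻¹) :=
  (integrableOn_ball_inv_norm_sq 1).integrable_indicator Metric.isOpen_ball.measurableSet

theorem one_add_inv_norm_sq_le (z : E) :
    1 + (‖z‖ ^ 2)⁻¹ ≤ 2 + (Metric.ball (0 : E) 1).indicator (fun z : E => (‖z‖ ^ 2)⁻¹) z := by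
  by_cases hz : z ∈ Metric.ball (0 : E) 1
  · rw [Set.indicator_of_mem hz]; linarith
  · rw [Set.indicator_of_notMem hz]
    have : 1 ≤ ‖z‖ := by simpa using hz
    have : (‖z‖ ^ 2)⁻¹ ≤ 1 := inv_le_one_of_one_le₀ (one_le_pow₀ this)
    linarith

/-- The density need not be globally bounded: it is bounded on the unit ball about `x`, where the
locally integrable singularity sits, and elsewhere the kernel is at most 2. -/
theorem integrable_mul_one_add_inv_norm_sq {f : E → ℝ} (hf : Continuous f) (hfi : Integrable f)
    (x : E) : Integrable fun y => f y * (1 + (‖x - y‖ ^ 2)⁻¹) := by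
  obtain ⟨M, hM⟩ := (isCompact_closedBall x 1).exists_bound_of_continuousOn hf.continuousOn
  have h1 : Integrable fun y => 2 * ‖f y‖ +
      M * (Metric.ball (0 : E) 1).indicator (fun z : E => (‖z‖ ^ 2)⁻¹) (x - y) :=
    (hfi.norm.const_mul 2).add ((integrable_indicator_inv_norm_sq.comp_sub_left x).const_mul M)
  refine h1.mono' ?_ (ae_of_all _ fun y => ?_)
  · exact (by fun_prop : Measurable fun y : E => f y * (1 + (‖x - y‖ ^ 2)⁻¹)).aestronglyMeasurable
  · rw [norm_mul, Real.norm_of_nonneg (by positivity : 0 ≤ 1 + (‖x - y‖ ^ 2)⁻¹)]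
    refine (mul_le_mul_of_nonneg_left (one_add_inv_norm_sq_le _) (norm_nonneg _)).trans ?_
    rw [mul_add, mul_comm]
    gcongr 2 * _ + ?_
    by_cases hz : x - y ∈ Metric.ball (0 : E) 1
    · have : y ∈ Metric.closedBall x 1 := by
        rw [mem_ball_zero_iff] at hz
        rw [mem_closedBall_iff_norm']; exact hz.le
      gcongr
      · exact Set.indicator_nonneg (fun _ _ => by positivity) _
      · exact hM y this
    · rw [Set.indicator_of_notMem hz]; simp

theorem stronglyMeasurable_of_continuousOn_compl_zero {k : E → F} (hk : ContinuousOn k {0}ᶜ) :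
    StronglyMeasurable k := by
  borelize F
  have := FiniteDimensional.proper_real F
  exact (measurable_of_continuousOn_compl_singleton 0 hk).stronglyMeasurable

theorem integrable_smul_singular {f : E → ℝ} (hf : Continuous f) (hfi : Integrable f)
    {k : E → F} (hk : ContinuousOn k {0}ᶜ) {C : ℝ} (hC : ∀ z, ‖k z‖ ≤ C * (1 + (‖z‖ ^ 2)⁻¹))
    (x : E) : Integrable fun y => f y • k (x - y) := by
  refine ((integrable_mul_one_add_inv_norm_sq hf hfi x).norm.const_mul C).mono' ?_
    (ae_of_all _ fun y => ?_)
  · exact hf.aestronglyMeasurable.smul ((stronglyMeasurable_of_continuousOn_compl_zero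
      hk).comp_measurable (by fun_prop : Measurable fun y => x - y)).aestronglyMeasurable
  · rw [norm_smul, norm_mul, Real.norm_of_nonneg (by positivity : 0 ≤ 1 + (‖x - y‖ ^ 2)⁻¹),
      mul_left_comm]
    exact mul_le_mul_of_nonneg_left (hC _) (norm_nonneg _)

theorem locallyIntegrable_singular
    {k : E → F} (hk : ContinuousOn k {0}ᶜ) {C : ℝ} (hC : ∀ z, ‖k z‖ ≤ C * (1 + (‖z‖ ^ 2)⁻¹)) :
    LocallyIntegrable k := by
  rw [locallyIntegrable_iff]
  intro K hK
  obtain ⟨R, -, hR⟩ := hK.isBounded.exists_pos_norm_lt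
  have h1 : IntegrableOn (fun z : E => C * (1 + (‖z‖ ^ 2)⁻¹)) (Metric.ball 0 R) :=
    ((integrableOn_const measure_ball_lt_top.ne).add (integrableOn_ball_inv_norm_sq R)).const_mul C
  refine IntegrableOn.mono_set (h1.mono'
    (stronglyMeasurable_of_continuousOn_compl_zero hk).aestronglyMeasurable
    (ae_of_all _ hC)) fun z hz => by simpa using hR z hz

theorem continuous_integral_smul_singular {f : E → ℝ} (hf : Continuous f) (hfi : Integrable f)
    {k : E → F} (hk : ContinuousOn k {0}ᶜ) {C : ℝ} (hC : ∀ z, ‖k z‖ ≤ C * (1 + (‖z‖ ^ 2)⁻¹)) :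
    Continuous fun x => ∫ y, f y • k (x - y) := by
  have hC0 : 0 ≤ C := by
    have := (norm_nonneg _).trans (hC 0); simpa using this
  rw [continuous_iff_continuousAt]
  intro x₀
  -- Near `x₀` the density is compactly supported and the convolution with a locally integrable
  -- kernel is continuous. The rest lives outside radius 2, so for `x` within 1 of `x₀` the kernel
  -- is bounded by `2C` and dominated convergence applies.
  let ζ : ContDiffBump x₀ := ⟨2, 4, by norm_num, by norm_num⟩
  have hζc : Continuous ζ := ζ.continuous
  have hζf : Continuous fun y => ζ y * f y := hζc.mul hf
  have hζs : HasCompactSupport fun y => ζ y * f y := ζ.hasCompactSupport.mul_right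
  have hζi : Integrable fun y => ζ y * f y := hζf.integrable_of_hasCompactSupport hζs
  have hrest : Integrable fun y => (1 - ζ y) * f y :=
    (hfi.sub hζi).congr (ae_of_all _ fun y => by simp [sub_mul])
  have hrestc : Continuous fun y => (1 - ζ y) * f y := (continuous_const.sub hζc).mul hf
  have hsplit : (fun x => ∫ y, f y • k (x - y)) = fun x =>
      (∫ y, (ζ y * f y) • k (x - y)) + ∫ y, ((1 - ζ y) * f y) • k (x - y) := by
    funext x
    rw [← integral_add (integrable_smul_singular hζf hζi hk hC x)
      (integrable_smul_singular hrestc hrest hk hC x)]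
    congr 1; funext y
    rw [← add_smul]; congr 1; ring
  rw [hsplit]
  refine ContinuousAt.add (Continuous.continuousAt ?_) ?_
  · exact hζs.continuous_convolution_left (μ := volume) (ContinuousLinearMap.lsmul ℝ ℝ) hζf
      (locallyIntegrable_singular hk hC)
  · refine continuousAt_of_dominated (bound := fun y => (C * 2) * ‖(1 - ζ y) * f y‖)
      (Eventually.of_forall fun x =>
        (integrable_smul_singular hrestc hrest hk hC x).aestronglyMeasurable) ?_
      (hrest.norm.const_mul _) (ae_of_all _ fun y => ?_)
    · filter_upwards [Metric.ball_mem_nhds x₀ one_pos] with x hx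
      refine ae_of_all _ fun y => ?_
      by_cases hy : y ∈ Metric.closedBall x₀ 2
      · simp [ζ.one_of_mem_closedBall hy]
      · rw [norm_smul, mul_comm]
        have h1 : 1 ≤ ‖x - y‖ := by
          rw [Metric.mem_closedBall, not_le] at hy
          rw [Metric.mem_ball] at hx
          rw [← dist_eq_norm]
          have := dist_triangle y x x₀
          rw [dist_comm x y]
          linarith
        gcongr
        refine (hC _).trans ?_
        have : (‖x - y‖ ^ 2)⁻¹ ≤ 1 := inv_le_one_of_one_le₀ (one_le_pow₀ h1)
        gcongr; linarith
    · by_cases hy : y ∈ Metric.closedBall x₀ 2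
      · simp [ζ.one_of_mem_closedBall hy, continuousAt_const]
      · have hne : x₀ - y ≠ 0 := by
          rintro h
          apply hy
          rw [← sub_eq_zero.mp h]; simp
        refine continuousAt_const.smul ?_
        exact ContinuousAt.comp (g := k) (hk.continuousAt (isOpen_compl_singleton.mem_nhds hne))
          (by fun_prop)

theorem continuous_integral_norm_mul_one_add {f : E → ℝ} (hf : Continuous f)
    (hfi : Integrable f) : Continuous fun x : E => ∫ y, ‖f y‖ * (1 + (‖x - y‖ ^ 2)⁻¹) := by
  have hk : ContinuousOn (fun z : E => 1 + (‖z‖ ^ 2)⁻¹) {0}ᶜ := by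
    refine continuousOn_const.add (ContinuousOn.inv₀ (by fun_prop) fun z hz => ?_)
    have : z ≠ 0 := hz
    positivity
  have hC : ∀ z : E, ‖1 + (‖z‖ ^ 2)⁻¹‖ ≤ 1 * (1 + (‖z‖ ^ 2)⁻¹) := fun z => by
    rw [Real.norm_of_nonneg (by positivity), one_mul]
  exact continuous_integral_smul_singular hf.norm hfi.norm hk hC

/-- A line is a null set in dimension three, so for almost every `y` the kernel centred at `y` is
regular along the whole line. -/
theorem ae_add_smul_ne (x h : E) : ∀ᵐ y : E, ∀ t : ℝ, x + t • h - y ≠ 0 := by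
  have h0 := Measure.addHaar_affineSubspace (volume : Measure E)
    (AffineSubspace.mk' x (Submodule.span ℝ {h})) (by
      intro htop
      have h1 : (AffineSubspace.mk' x (Submodule.span ℝ {h})).direction = ⊤ := by
        rw [htop, AffineSubspace.direction_top]
      rw [AffineSubspace.direction_mk'] at h1
      have h2 := finrank_span_le_card (R := ℝ) ({h} : Set E)
      rw [h1, finrank_top, hE.out] at h2
      simp at h2)
  have h0 := measure_eq_zero_iff_ae_notMem.mp h0
  filter_upwards [h0] with y hy t ht
  apply hy
  have : y = t • h +ᵥ x := by
    rw [vadd_eq_add, add_comm]; exact (sub_eq_zero.mp ht).symm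
  rw [this]
  exact AffineSubspace.vadd_mem_mk' x (Submodule.smul_mem _ _ (Submodule.mem_span_singleton_self h))

theorem integrable_prod_segment_singular {f : E → ℝ} (hf : Continuous f) (hfi : Integrable f)
    {k : E → F} (hk : ContinuousOn k {0}ᶜ) {C : ℝ} (hC : ∀ z, ‖k z‖ ≤ C * (1 + (‖z‖ ^ 2)⁻¹))
    (x h : E) : Integrable (fun q : ℝ × E => f q.2 • k (x + q.1 • h - q.2))
      ((volume.restrict (Set.Ioc (0 : ℝ) 1)).prod volume) := by
  have hfm := hf.measurable
  have hseg : Measurable fun q : ℝ × E => x + q.1 • h - q.2 := by fun_prop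
  have hdom : Integrable (fun q : ℝ × E => f q.2 * (1 + (‖x + q.1 • h - q.2‖ ^ 2)⁻¹))
      ((volume.restrict (Set.Ioc (0 : ℝ) 1)).prod volume) := by
    rw [integrable_prod_iff]
    · refine ⟨ae_of_all _ fun t => integrable_mul_one_add_inv_norm_sq hf hfi (x + t • h), ?_⟩
      have h1 := continuous_integral_norm_mul_one_add hf hfi
      have h2 : Continuous fun t : ℝ => ∫ y, ‖f y‖ * (1 + (‖x + t • h - y‖ ^ 2)⁻¹) :=
        h1.comp (continuous_const.add (continuous_id.smul continuous_const))
      have h3 := (h2.integrableOn_Icc (μ := volume) (a := 0) (b := 1)).mono_set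
        Set.Ioc_subset_Icc_self
      refine h3.congr (ae_of_all _ fun t => ?_)
      refine integral_congr_ae (ae_of_all _ fun y => ?_)
      dsimp only
      rw [norm_mul, Real.norm_of_nonneg (by positivity : 0 ≤ 1 + (‖x + t • h - y‖ ^ 2)⁻¹)]
    · exact ((hfm.comp measurable_snd).mul (measurable_const.add
        (hseg.norm.pow_const 2).inv)).aestronglyMeasurable
  refine (hdom.norm.const_mul C).mono' ?_ (ae_of_all _ fun q => ?_)
  · exact ((hf.comp continuous_snd).stronglyMeasurable.smul
      ((stronglyMeasurable_of_continuousOn_compl_zero hk).comp_measurable hseg)).aestronglyMeasurable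
  · rw [norm_smul, norm_mul,
      Real.norm_of_nonneg (by positivity : 0 ≤ 1 + (‖x + q.1 • h - q.2‖ ^ 2)⁻¹), mul_left_comm]
    exact mul_le_mul_of_nonneg_left (hC _) (norm_nonneg _)

/-- A converse of the fundamental theorem of calculus. It avoids a domination of difference
quotients of a singular kernel, whose derivative has no integrable bound uniform in the base point.
-/
theorem hasFDerivAt_of_segment_integral {V : E → F} {V' : E → E →L[ℝ] F} (hV' : Continuous V')
    (h : ∀ x h, V (x + h) - V x = ∫ t in (0 : ℝ)..1, V' (x + t • h) h) (x : E) :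
    HasFDerivAt V (V' x) x := by
  rw [hasFDerivAt_iff_isLittleO_nhds_zero, Asymptotics.isLittleO_iff]
  intro ε hε
  obtain ⟨δ, hδ, hball⟩ := Metric.continuous_iff.mp hV' x ε hε
  filter_upwards [Metric.ball_mem_nhds (0 : E) hδ] with e he
  have hbound : ∀ t ∈ Set.uIoc (0 : ℝ) 1, ‖V' (x + t • e) e - V' x e‖ ≤ ε * ‖e‖ := by
    intro t ht
    rw [Set.uIoc_of_le zero_le_one] at ht
    rw [← sub_apply]
    refine (ContinuousLinearMap.le_opNorm _ _).trans ?_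
    gcongr
    rw [← dist_eq_norm]
    refine (hball _ ?_).le
    rw [dist_eq_norm, add_sub_cancel_left, norm_smul, Real.norm_of_nonneg ht.1.le]
    have : ‖e‖ < δ := by simpa using he
    nlinarith [ht.2, norm_nonneg e]
  have hc : Continuous fun t : ℝ => V' (x + t • e) e :=
    (hV'.comp (by fun_prop : Continuous fun t : ℝ => x + t • e)).clm_apply continuous_const
  have h1 := intervalIntegral.norm_integral_le_of_norm_le_const hbound
  rw [intervalIntegral.integral_sub (hc.intervalIntegrable _ _) intervalIntegrable_const,
    intervalIntegral.integral_const, ← h] at h1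
  simpa using h1

/-- Fubini on segment times space reduces the increment of the potential to the fundamental theorem
of calculus for `K` on almost every segment. The term `c y` is a normalization making the integral
converge; it does not affect the derivative. -/
theorem hasFDerivAt_integral_smul_singular {f : E → ℝ} (hf : Continuous f) (hfi : Integrable f)
    {K c : E → F} {K' : E → E →L[ℝ] F} (hK : ∀ z ≠ 0, HasFDerivAt K (K' z) z)
    (hK' : ContinuousOn K' {0}ᶜ) {C : ℝ} (hC : ∀ z, ‖K' z‖ ≤ C * (1 + (‖z‖ ^ 2)⁻¹))
    (hint : ∀ x, Integrable fun y => f y • (K (x - y) - c y)) (x : E) :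
    HasFDerivAt (fun x => ∫ y, f y • (K (x - y) - c y)) (∫ y, f y • K' (x - y)) x := by
  refine hasFDerivAt_of_segment_integral (V' := fun x => ∫ y, f y • K' (x - y))
    (continuous_integral_smul_singular hf hfi hK' hC) (fun x h => ?_) x
  have hprod : Integrable (fun q : ℝ × E => f q.2 • K' (x + q.1 • h - q.2) h)
      ((volume.restrict (Set.Ioc (0 : ℝ) 1)).prod volume) :=
    (ContinuousLinearMap.apply ℝ F h).integrable_comp
      (integrable_prod_segment_singular hf hfi hK' hC x h)
  have hcomm : ∀ t : ℝ, (∫ y, f y • K' (x + t • h - y)) h =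
      ∫ y, f y • K' (x + t • h - y) h := fun t => by
    rw [ContinuousLinearMap.integral_apply (integrable_smul_singular hf hfi hK' hC _)]
    rfl
  simp_rw [hcomm]
  rw [intervalIntegral.integral_of_le zero_le_one,
    integral_integral_swap (f := fun t y => f y • K' (x + t • h - y) h) hprod,
    ← integral_sub (hint _) (hint _)]
  refine integral_congr_ae ?_
  filter_upwards [ae_add_smul_ne x h] with y hy
  have hd : ∀ t ∈ Set.uIcc (0 : ℝ) 1, HasDerivAt (fun t : ℝ => f y • (K (x + t • h - y) - c y))
      (f y • K' (x + t • h - y) h) t := by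
    intro t _
    have h1 : HasDerivAt (fun t : ℝ => x + t • h - y) h t := by
      simpa using (((hasDerivAt_id t).smul_const h).const_add x).sub_const y
    exact (((hK _ (hy t)).comp_hasDerivAt t h1).sub_const _).const_smul (f y)
  have hcont : Continuous fun t : ℝ => f y • K' (x + t • h - y) h := by
    refine continuous_const.smul (Continuous.clm_apply ?_ continuous_const)
    exact hK'.comp_continuous (by fun_prop) fun t => hy t
  have := intervalIntegral.integral_eq_sub_of_hasDerivAt hd (hcont.intervalIntegrable 0 1)
  rw [← intervalIntegral.integral_of_le zero_le_one, this]
  simp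

end SingularKernels

/-! ### Derivatives and elementary bounds of `log|z|` -/

section LogKernel

variable {E : Type*} [NormedAddCommGroup E] [InnerProductSpace ℝ E]

/-- The inner product of a real inner product space as a continuous bilinear form. -/
noncomputable def innerBilin : E →L[ℝ] E →L[ℝ] ℝ :=
  LinearMap.mkContinuous₂ (innerₗ E : E →ₗ[ℝ] E →ₗ[ℝ] ℝ) 1 fun x y => by
    simpa using norm_inner_le_norm (𝕜 := ℝ) x y

@[simp] theorem innerBilin_apply (x y : E) : innerBilin x y = inner ℝ x y := rfl

theorem innerBilin_eq (x : E) : innerBilin x = innerSL ℝ x := rfl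

/-- The gradient of `z ↦ log ‖z‖` on the complement of the origin. -/
noncomputable def logGrad (z : E) : E →L[ℝ] ℝ := (‖z‖ ^ 2)⁻¹ • innerBilin z

/-- The Hessian of `z ↦ log ‖z‖` on the complement of the origin. -/
noncomputable def logHess (z : E) : E →L[ℝ] E →L[ℝ] ℝ :=
  (‖z‖ ^ 2)⁻¹ • innerBilin + ((-(2 * ((‖z‖ ^ 2) ^ 2)⁻¹)) • innerBilin z).smulRight (innerBilin z)

theorem hasFDerivAt_log_norm {z : E} (hz : z ≠ 0) :
    HasFDerivAt (fun z : E => Real.log ‖z‖) (logGrad z) z := by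
  have h1 : (fun z : E => Real.log ‖z‖) = fun z => (1 / 2 : ℝ) * Real.log (‖z‖ ^ 2) := by
    funext z; rw [Real.log_pow]; push_cast; ring
  rw [h1]
  have h2 := ((hasStrictFDerivAt_norm_sq z).hasFDerivAt.log (by positivity)).const_mul (1 / 2 : ℝ)
  refine h2.congr_fderiv (ContinuousLinearMap.ext fun h => ?_)
  simp [logGrad]
  ring

theorem hasFDerivAt_logGrad {z : E} (hz : z ≠ 0) : HasFDerivAt logGrad (logHess z) z := by
  have h0 : ‖z‖ ^ 2 ≠ 0 := by positivity
  have h1 : HasFDerivAt (fun z : E => (‖z‖ ^ 2)⁻¹)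
      ((-(2 * ((‖z‖ ^ 2) ^ 2)⁻¹)) • innerBilin z) z := by
    have := (hasDerivAt_inv h0).comp_hasFDerivAt z (hasStrictFDerivAt_norm_sq z).hasFDerivAt
    refine this.congr_fderiv (ContinuousLinearMap.ext fun h => ?_)
    simp
    ring
  exact h1.smul innerBilin.hasFDerivAt

theorem logHess_apply (z h k : E) : logHess z h k = (‖z‖ ^ 2)⁻¹ * inner ℝ h k -
    2 * ((‖z‖ ^ 2) ^ 2)⁻¹ * (inner ℝ z h * inner ℝ z k) := by
  simp [logHess]; ring

theorem inv_le_one_add_inv_sq (r : ℝ) : r⁻¹ ≤ 1 + (r ^ 2)⁻¹ := by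
  rw [← inv_pow]; nlinarith [sq_nonneg (r⁻¹ - 1)]

theorem norm_logGrad (z : E) : ‖logGrad z‖ = ‖z‖⁻¹ := by
  rw [logGrad, norm_smul, innerBilin_eq, innerSL_apply_norm, Real.norm_of_nonneg (by positivity)]
  by_cases hz : ‖z‖ = 0
  · simp [hz]
  · field_simp

theorem norm_logGrad_le (z : E) : ‖logGrad z‖ ≤ 1 * (1 + (‖z‖ ^ 2)⁻¹) := by
  rw [norm_logGrad, one_mul]; exact inv_le_one_add_inv_sq _

theorem norm_logHess_le_inv_sq (z : E) : ‖logHess z‖ ≤ 3 * (‖z‖ ^ 2)⁻¹ := by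
  refine ContinuousLinearMap.opNorm_le_bound _ (by positivity) fun h => ?_
  refine ContinuousLinearMap.opNorm_le_bound _ (by positivity) fun k => ?_
  rw [logHess_apply]
  have h1 : |inner ℝ h k| ≤ ‖h‖ * ‖k‖ := abs_real_inner_le_norm h k
  have h2 : |inner ℝ z h * inner ℝ z k| ≤ (‖z‖ * ‖h‖) * (‖z‖ * ‖k‖) := by
    rw [abs_mul]
    gcongr <;> exact abs_real_inner_le_norm _ _
  have h3 : ((‖z‖ ^ 2) ^ 2)⁻¹ * (‖z‖ * ‖z‖) = (‖z‖ ^ 2)⁻¹ := by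
    by_cases hz : ‖z‖ = 0
    · simp [hz]
    · field_simp
  calc _ ≤ |(‖z‖ ^ 2)⁻¹ * inner ℝ h k| + |2 * ((‖z‖ ^ 2) ^ 2)⁻¹ * (inner ℝ z h * inner ℝ z k)| :=
        abs_sub _ _
    _ = (‖z‖ ^ 2)⁻¹ * |inner ℝ h k| + 2 * ((‖z‖ ^ 2) ^ 2)⁻¹ * |inner ℝ z h * inner ℝ z k| := by
        rw [abs_mul, abs_mul, abs_of_nonneg (by positivity : 0 ≤ (‖z‖ ^ 2)⁻¹),
          abs_of_nonneg (by positivity : 0 ≤ 2 * ((‖z‖ ^ 2) ^ 2)⁻¹)]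
    _ ≤ (‖z‖ ^ 2)⁻¹ * (‖h‖ * ‖k‖) + 2 * ((‖z‖ ^ 2) ^ 2)⁻¹ * ((‖z‖ * ‖h‖) * (‖z‖ * ‖k‖)) := by
        gcongr
    _ = (‖z‖ ^ 2)⁻¹ * (‖h‖ * ‖k‖) + 2 * (((‖z‖ ^ 2) ^ 2)⁻¹ * (‖z‖ * ‖z‖)) * (‖h‖ * ‖k‖) := by ring
    _ = 3 * (‖z‖ ^ 2)⁻¹ * ‖h‖ * ‖k‖ := by rw [h3]; ring

theorem norm_logHess_le (z : E) : ‖logHess z‖ ≤ 3 * (1 + (‖z‖ ^ 2)⁻¹) :=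
  (norm_logHess_le_inv_sq z).trans (by linarith)

theorem continuousOn_inv_norm_sq : ContinuousOn (fun z : E => (‖z‖ ^ 2)⁻¹) {0}ᶜ :=
  ContinuousOn.inv₀ (by fun_prop) fun z hz => by
    have : z ≠ 0 := hz
    positivity

theorem continuousOn_logGrad : ContinuousOn (logGrad (E := E)) {0}ᶜ := fun _ hz =>
  (hasFDerivAt_logGrad hz).continuousAt.continuousWithinAt

theorem continuousOn_logHess : ContinuousOn (logHess (E := E)) {0}ᶜ := by
  have h2 : ContinuousOn (fun z : E => -(2 * ((‖z‖ ^ 2) ^ 2)⁻¹)) {0}ᶜ := by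
    refine (continuousOn_const.mul (ContinuousOn.inv₀ (by fun_prop) fun z hz => ?_)).neg
    have : z ≠ 0 := hz
    positivity
  have h3 : Continuous fun z : E => innerBilin z := innerBilin.continuous
  have h4 : ContinuousOn (fun z : E => (-(2 * ((‖z‖ ^ 2) ^ 2)⁻¹)) • innerBilin z) {0}ᶜ :=
    h2.smul h3.continuousOn
  have h5 : ContinuousOn (fun z : E => (‖z‖ ^ 2)⁻¹ • innerBilin (E := E)) {0}ᶜ :=
    continuousOn_inv_norm_sq.smul continuousOn_const
  have h6 : ContinuousOn (fun z : E =>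
      ((-(2 * ((‖z‖ ^ 2) ^ 2)⁻¹)) • innerBilin z).smulRight (innerBilin z)) {0}ᶜ :=
    ((ContinuousLinearMap.smulRightL ℝ E (E →L[ℝ] ℝ)).continuous.comp_continuousOn
      h4).clm_apply h3.continuousOn
  exact h5.add h6

/-- The identity term contributes `3|z|⁻²` and the rank-one term `-2|z|⁻²`. At the origin both sides
are zero by the convention for inverses. -/
theorem sum_logHess_apply (b : OrthonormalBasis (Fin 3) ℝ E) (z : E) :
    ∑ i : Fin 3, logHess z (b i) (b i) = (‖z‖ ^ 2)⁻¹ := by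
  have e : ∀ i, logHess z (b i) (b i) = (‖z‖ ^ 2)⁻¹ -
      2 * ((‖z‖ ^ 2) ^ 2)⁻¹ * (inner ℝ z (b i)) ^ 2 := by
    intro i
    rw [logHess_apply, real_inner_self_eq_norm_sq, OrthonormalBasis.norm_eq_one]
    ring
  simp_rw [e]
  rw [Finset.sum_sub_distrib, ← Finset.mul_sum]
  have : ∑ i : Fin 3, (inner ℝ z (b i)) ^ 2 = ‖z‖ ^ 2 := by
    rw [← b.sum_sq_norm_inner_left z]; simp
  rw [this]
  by_cases hz : ‖z‖ = 0
  · simp [hz]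
  · simp; field_simp; ring

open Real in
theorem posLog_norm_le (x y : E) : log⁺ ‖y‖ ≤ log (1 + ‖x‖) + log⁺ ‖x - y‖ := by
  rw [posLog_eq_log_max_one (norm_nonneg _), posLog_eq_log_max_one (norm_nonneg _),
    ← log_mul (by positivity) (by positivity)]
  have h1 : ‖y‖ ≤ ‖x‖ + ‖x - y‖ := by
    have := norm_sub_le x (x - y); rwa [sub_sub_cancel] at this
  have h2 := le_max_left 1 ‖x - y‖
  have h3 := le_max_right 1 ‖x - y‖
  refine log_le_log (by positivity) (max_le ?_ ?_) <;> nlinarith [norm_nonneg x]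

open Real in
theorem posLog_norm_sub_le (x y : E) : log⁺ ‖x - y‖ ≤ log (1 + ‖x‖) + log⁺ ‖y‖ := by
  have := posLog_norm_le x (x - y)
  rwa [sub_sub_cancel] at this

open Real in
theorem posLog_inv_norm_le (z : E) : log⁺ ‖z‖⁻¹ ≤ 1 + (‖z‖ ^ 2)⁻¹ := by
  refine le_trans ?_ (inv_le_one_add_inv_sq ‖z‖)
  refine max_le (inv_nonneg.mpr (norm_nonneg z)) ?_
  by_cases hz : ‖z‖ = 0
  · simp [hz]
  · exact (log_le_sub_one_of_pos (by positivity : 0 < ‖z‖⁻¹)).trans (by linarith)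

theorem laplacian_eq_sum_fderiv_fderiv [FiniteDimensional ℝ E] (b : OrthonormalBasis (Fin 3) ℝ E)
    (g : E → ℝ) (x : E) :
    Δ g x = ∑ i, fderiv ℝ (fderiv ℝ g) x (b i) (b i) := by
  rw [InnerProductSpace.laplacian_eq_iteratedFDeriv_orthonormalBasis g b]
  refine Finset.sum_congr rfl fun i _ => ?_
  rw [iteratedFDeriv_two_apply]; simp

end LogKernel

/-! ### The logarithmic potential: convergence, lower bound, derivatives -/

section LogPotential

variable {E : Type*} [NormedAddCommGroup E] [InnerProductSpace ℝ E] [FiniteDimensional ℝ E]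
  [MeasurableSpace E] [BorelSpace E]

/-- The logarithmic potential of the density `f`, normalized to vanish at the origin. -/
noncomputable def logPot (f : E → ℝ) (x : E) : ℝ := ∫ y, f y * (Real.log ‖y‖ - Real.log ‖x - y‖)

/-- The Riesz potential of the density `f` with kernel `‖x - y‖⁻²`. -/
noncomputable def rieszPot (f : E → ℝ) (x : E) : ℝ := ∫ y, f y * (‖x - y‖ ^ 2)⁻¹

variable [hE : Fact (Module.finrank ℝ E = 3)] {f : E → ℝ}

open Real in
theorem integrable_mul_posLog_inv_norm_sub (hf : Continuous f) (hfi : Integrable f) (x : E) :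
    Integrable fun y => f y * log⁺ ‖x - y‖⁻¹ := by
  refine (integrable_mul_one_add_inv_norm_sq hf hfi x).norm.mono' ?_ (ae_of_all _ fun y => ?_)
  · exact (hf.measurable.mul (continuous_posLog.measurable.comp
      (measurable_const.sub measurable_id).norm.inv)).aestronglyMeasurable
  · rw [norm_mul, norm_mul, norm_of_nonneg posLog_nonneg,
      norm_of_nonneg (by positivity : 0 ≤ 1 + (‖x - y‖ ^ 2)⁻¹)]
    exact mul_le_mul_of_nonneg_left (posLog_inv_norm_le _) (norm_nonneg _)

open Real in
theorem abs_posLog_norm_sub_le (x y : E) :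
    |log⁺ ‖y‖ - log⁺ ‖x - y‖| ≤ log (1 + ‖x‖) :=
  abs_sub_le_iff.mpr ⟨by linarith [posLog_norm_le x y], by linarith [posLog_norm_sub_le x y]⟩

open Real in
theorem integrable_mul_posLog_sub (hf : Continuous f) (hfi : Integrable f) (x : E) :
    Integrable fun y => f y * (log⁺ ‖y‖ - log⁺ ‖x - y‖) := by
  refine (hfi.norm.const_mul (log (1 + ‖x‖))).mono' ?_ (ae_of_all _ fun y => ?_)
  · exact (hf.mul ((continuous_posLog.comp continuous_norm).sub
      (continuous_posLog.comp (continuous_const.sub continuous_id).norm))).aestronglyMeasurable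
  · rw [norm_mul, mul_comm]
    gcongr
    exact abs_posLog_norm_sub_le x y

open Real in
-- Separates the long-range part, bounded in `y` for fixed `x`, from two local singularities at `x`
-- and at the origin. All later estimates treat these three pieces separately.
theorem log_sub_log_eq (x y : E) : log ‖y‖ - log ‖x - y‖ =
    (log⁺ ‖y‖ - log⁺ ‖x - y‖) + log⁺ ‖x - y‖⁻¹ - log⁺ ‖0 - y‖⁻¹ := by
  rw [← posLog_sub_posLog_inv, ← posLog_sub_posLog_inv, zero_sub, norm_neg]
  ring

open Real in
theorem integrable_mul_log_sub_log (hf : Continuous f) (hfi : Integrable f) (x : E) :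
    Integrable fun y => f y * (log ‖y‖ - log ‖x - y‖) := by
  refine (((integrable_mul_posLog_sub hf hfi x).add
    (integrable_mul_posLog_inv_norm_sub hf hfi x)).sub
    (integrable_mul_posLog_inv_norm_sub hf hfi 0)).congr (ae_of_all _ fun y => ?_)
  simp only [Pi.add_apply, Pi.sub_apply]
  rw [log_sub_log_eq]
  ring

open Real in
theorem logPot_eq (hf : Continuous f) (hfi : Integrable f) (x : E) :
    logPot f x = (∫ y, f y * (log⁺ ‖y‖ - log⁺ ‖x - y‖)) + (∫ y, f y * log⁺ ‖x - y‖⁻¹) -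
      ∫ y, f y * log⁺ ‖0 - y‖⁻¹ := by
  have h1 := integral_add (integrable_mul_posLog_sub hf hfi x)
    (integrable_mul_posLog_inv_norm_sub hf hfi x)
  have h2 := integral_sub ((integrable_mul_posLog_sub hf hfi x).add
    (integrable_mul_posLog_inv_norm_sub hf hfi x)) (integrable_mul_posLog_inv_norm_sub hf hfi 0)
  rw [← h1]
  refine Eq.trans ?_ h2
  refine integral_congr_ae (ae_of_all _ fun y => ?_)
  simp only [Pi.add_apply]
  rw [log_sub_log_eq]
  ring

open Real in
-- The singularity at `x` has the favourable sign and is dropped; the one at the origin contributes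
-- a constant.
theorem le_logPot (hf : Continuous f) (hfi : Integrable f) (hf0 : ∀ y, 0 ≤ f y) (x : E) :
    -(∫ y, f y) * log (1 + ‖x‖) - ∫ y, f y * log⁺ ‖0 - y‖⁻¹ ≤ logPot f x := by
  rw [logPot_eq hf hfi]
  have h1 : 0 ≤ ∫ y, f y * log⁺ ‖x - y‖⁻¹ :=
    integral_nonneg fun y => mul_nonneg (hf0 y) posLog_nonneg
  have h2 : -(∫ y, f y) * log (1 + ‖x‖) ≤ ∫ y, f y * (log⁺ ‖y‖ - log⁺ ‖x - y‖) := by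
    rw [neg_mul, ← integral_mul_const, ← integral_neg]
    refine integral_mono (hfi.mul_const _).neg (integrable_mul_posLog_sub hf hfi x) fun y => ?_
    have := (abs_le.mp (abs_posLog_norm_sub_le x y)).1
    dsimp only
    nlinarith [hf0 y]
  linarith

theorem hasFDerivAt_logPot (hf : Continuous f) (hfi : Integrable f) (x : E) :
    HasFDerivAt (logPot f) (-∫ y, f y • logGrad (x - y)) x := by
  have h := hasFDerivAt_integral_smul_singular hf hfi (K := fun z : E => Real.log ‖z‖)
    (c := fun y => Real.log ‖y‖) (K' := logGrad) (C := 1)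
    (fun z hz => hasFDerivAt_log_norm hz) continuousOn_logGrad norm_logGrad_le (fun x => by
      refine (integrable_mul_log_sub_log hf hfi x).neg.congr (ae_of_all _ fun y => ?_)
      simp only [Pi.neg_apply, smul_eq_mul]; ring) x
  have e : logPot f = fun x => -∫ y, f y • (Real.log ‖x - y‖ - Real.log ‖y‖) := by
    funext x
    rw [logPot, ← integral_neg]
    refine integral_congr_ae (ae_of_all _ fun y => ?_)
    simp only [smul_eq_mul]; ring
  rw [e]
  exact h.neg

theorem fderiv_logPot (hf : Continuous f) (hfi : Integrable f) :
    fderiv ℝ (logPot f) = fun x => -∫ y, f y • logGrad (x - y) :=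
  funext fun x => (hasFDerivAt_logPot hf hfi x).fderiv

theorem hasFDerivAt_fderiv_logPot (hf : Continuous f) (hfi : Integrable f) (x : E) :
    HasFDerivAt (fderiv ℝ (logPot f)) (-∫ y, f y • logHess (x - y)) x := by
  have h := hasFDerivAt_integral_smul_singular hf hfi (K := logGrad (E := E))
    (c := fun _ => 0) (K' := logHess) (C := 3)
    (fun z hz => hasFDerivAt_logGrad hz) continuousOn_logHess norm_logHess_le (fun x => by
      simpa using integrable_smul_singular hf hfi continuousOn_logGrad norm_logGrad_le x) x
  simp only [sub_zero] at h
  rw [fderiv_logPot hf hfi]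
  exact h.neg

theorem fderiv_fderiv_logPot (hf : Continuous f) (hfi : Integrable f) :
    fderiv ℝ (fderiv ℝ (logPot f)) = fun x => -∫ y, f y • logHess (x - y) :=
  funext fun x => (hasFDerivAt_fderiv_logPot hf hfi x).fderiv

/-- Two derivatives are what a continuous density gives directly, the Hessian kernel being of size
`|z|⁻²`. Full smoothness of `v` comes at the end from `v = u - p`. -/
theorem contDiff_logPot (hf : Continuous f) (hfi : Integrable f) : ContDiff ℝ 2 (logPot f) := by
  have h2 : ContDiff ℝ 1 (fderiv ℝ (logPot f)) := by
    rw [contDiff_one_iff_fderiv, fderiv_fderiv_logPot hf hfi]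
    exact ⟨fun x => (hasFDerivAt_fderiv_logPot hf hfi x).differentiableAt,
      (continuous_integral_smul_singular hf hfi continuousOn_logHess norm_logHess_le).neg⟩
  have : (2 : WithTop ℕ∞) = 1 + 1 := by norm_num
  rw [this, contDiff_succ_iff_fderiv]
  exact ⟨fun x => (hasFDerivAt_logPot hf hfi x).differentiableAt, by simp, h2⟩

theorem norm_inv_norm_sq_le (z : E) : ‖(‖z‖ ^ 2)⁻¹‖ ≤ 1 * (1 + (‖z‖ ^ 2)⁻¹) := by
  rw [Real.norm_of_nonneg (by positivity)]; linarith

theorem integrable_mul_inv_norm_sq (hf : Continuous f) (hfi : Integrable f) (x : E) :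
    Integrable fun y => f y * (‖x - y‖ ^ 2)⁻¹ :=
  integrable_smul_singular hf hfi continuousOn_inv_norm_sq norm_inv_norm_sq_le x

theorem continuous_rieszPot (hf : Continuous f) (hfi : Integrable f) : Continuous (rieszPot f) :=
  continuous_integral_smul_singular hf hfi continuousOn_inv_norm_sq norm_inv_norm_sq_le

theorem laplacian_logPot (hf : Continuous f) (hfi : Integrable f) (x : E) :
    Δ (logPot f) x = -rieszPot f x := by
  let b : OrthonormalBasis (Fin 3) ℝ E := (stdOrthonormalBasis ℝ E).reindex (finCongr hE.out)
  rw [laplacian_eq_sum_fderiv_fderiv b, fderiv_fderiv_logPot hf hfi]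
  have hi := integrable_smul_singular hf hfi continuousOn_logHess norm_logHess_le x
  have e : ∀ i, (-∫ y, f y • logHess (x - y)) (b i) (b i) =
      -∫ y, f y * logHess (x - y) (b i) (b i) := by
    intro i
    have h1 := ContinuousLinearMap.integral_apply hi (b i)
    have h2 := ContinuousLinearMap.integral_apply
      ((ContinuousLinearMap.apply ℝ (E →L[ℝ] ℝ) (b i)).integrable_comp hi) (b i)
    rw [neg_apply, neg_apply, h1]
    exact congrArg Neg.neg h2
  simp_rw [e]
  have hii : ∀ i, Integrable fun y => f y * logHess (x - y) (b i) (b i) := fun i =>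
    (ContinuousLinearMap.apply ℝ ℝ (b i)).integrable_comp
      ((ContinuousLinearMap.apply ℝ (E →L[ℝ] ℝ) (b i)).integrable_comp hi)
  rw [Finset.sum_neg_distrib, ← integral_finsetSum _ fun i _ => hii i, rieszPot]
  congr 2
  funext y
  rw [← Finset.mul_sum, sum_logHess_apply]

end LogPotential

/-! ### Mean value property for functions with constant Laplacian -/

section MeanValue

variable {E : Type*} [NormedAddCommGroup E] [InnerProductSpace ℝ E]

/-- A smooth even bump on the line, equal to `1` on `[-1, 1]` and supported in `[-2, 2]`. -/
noncomputable def lineBump : ContDiffBump (0 : ℝ) := ⟨1, 2, by norm_num, by norm_num⟩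

/-- A smooth radial bump on `E`, equal to `1` on the unit ball. -/
noncomputable def radialBump (y : E) : ℝ := lineBump (‖y‖ ^ 2)

/-- The compactly supported primitive of `lineBump / 2` on the half line `[0, ∞)`. -/
noncomputable def lineBumpPrim (s : ℝ) : ℝ := (∫ t in (2 : ℝ)..s, lineBump t) / 2

/-- A compactly supported radial function with gradient `radialBump y • y`. -/
noncomputable def radialBumpPrim (y : E) : ℝ := lineBumpPrim (‖y‖ ^ 2)

theorem hasDerivAt_lineBumpPrim (s : ℝ) : HasDerivAt lineBumpPrim (lineBump s / 2) s :=
  ((lineBump.continuous.integral_hasStrictDerivAt 2 s).hasDerivAt).div_const 2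

theorem hasFDerivAt_radialBumpPrim (y : E) :
    HasFDerivAt radialBumpPrim (radialBump y • innerBilin y) y := by
  refine ((hasDerivAt_lineBumpPrim (‖y‖ ^ 2)).comp_hasFDerivAt y
    (hasStrictFDerivAt_norm_sq y).hasFDerivAt).congr_fderiv (ContinuousLinearMap.ext fun h => ?_)
  simp [radialBump]
  ring

theorem contDiff_radialBump : ContDiff ℝ ∞ (radialBump (E := E)) :=
  lineBump.contDiff.comp (contDiff_norm_sq ℝ)

theorem continuous_radialBump : Continuous (radialBump (E := E)) :=
  contDiff_radialBump.continuous

theorem radialBump_nonneg (y : E) : 0 ≤ radialBump y := lineBump.nonneg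

theorem radialBump_le_one (y : E) : radialBump y ≤ 1 := lineBump.le_one

theorem radialBump_eq_one {y : E} (hy : ‖y‖ ≤ 1) : radialBump y = 1 := by
  refine lineBump.one_of_mem_closedBall ?_
  have : ‖y‖ ^ 2 ≤ 1 := pow_le_one₀ (norm_nonneg _) hy
  simpa [lineBump] using this

theorem radialBump_eq_zero {y : E} (hy : 2 < ‖y‖) : radialBump y = 0 := by
  refine lineBump.zero_of_le_dist ?_
  have : 2 ≤ ‖y‖ ^ 2 := by nlinarith
  simpa [lineBump] using this

theorem radialBumpPrim_eq_zero {y : E} (hy : 2 < ‖y‖) : radialBumpPrim y = 0 := by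
  have h2 : 2 ≤ ‖y‖ ^ 2 := by nlinarith
  have : ∫ t in (2 : ℝ)..‖y‖ ^ 2, lineBump t = ∫ t in (2 : ℝ)..‖y‖ ^ 2, (0 : ℝ) := by
    refine intervalIntegral.integral_congr fun t ht => lineBump.zero_of_le_dist ?_
    rw [Set.uIcc_of_le h2] at ht
    have : 2 ≤ |t| := ht.1.trans (le_abs_self _)
    simpa [lineBump] using this
  simp [radialBumpPrim, lineBumpPrim, this]

variable [FiniteDimensional ℝ E]

theorem hasCompactSupport_of_eq_zero_of_lt_norm {F : Type*} [Zero F] {g : E → F} {R : ℝ}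
    (h : ∀ y, R < ‖y‖ → g y = 0) : HasCompactSupport g := by
  have := FiniteDimensional.proper_real E
  refine HasCompactSupport.intro (isCompact_closedBall (0 : E) R) fun y hy => h y ?_
  simpa using hy

theorem hasCompactSupport_radialBump : HasCompactSupport (radialBump (E := E)) :=
  hasCompactSupport_of_eq_zero_of_lt_norm fun _ => radialBump_eq_zero

theorem hasCompactSupport_radialBumpPrim : HasCompactSupport (radialBumpPrim (E := E)) :=
  hasCompactSupport_of_eq_zero_of_lt_norm fun _ => radialBumpPrim_eq_zero

variable [MeasurableSpace E] [BorelSpace E]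

theorem integral_radialBump_pos : 0 < ∫ y : E, radialBump y := by
  refine continuous_radialBump.integral_pos_of_hasCompactSupport_nonneg_nonzero
    hasCompactSupport_radialBump radialBump_nonneg (x := 0) ?_
  rw [radialBump_eq_one (by simp)]; exact one_ne_zero

theorem continuous_radialBumpPrim : Continuous (radialBumpPrim (E := E)) :=
  continuous_iff_continuousAt.mpr fun y => (hasFDerivAt_radialBumpPrim y).continuousAt

theorem fderiv_radialBumpPrim : fderiv ℝ (radialBumpPrim (E := E)) =
    fun y => radialBump y • innerBilin y :=
  funext fun y => (hasFDerivAt_radialBumpPrim y).fderiv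

variable {p : E → ℝ} {c : ℝ}

theorem hasDerivAt_integral_radialBump (hp : ContDiff ℝ 1 p) (x : E) (r : ℝ) :
    HasDerivAt (fun r : ℝ => ∫ y, p (x + r • y) * radialBump y)
      (∫ y, fderiv ℝ p (x + r • y) y * radialBump y) r := by
  have := FiniteDimensional.proper_real E
  have hp0 := hp.continuous
  have hp1 := hp.continuous_fderiv one_ne_zero
  have hc : Continuous fun q : ℝ × E => fderiv ℝ p (x + q.1 • q.2) q.2 * radialBump q.2 :=
    ((hp1.comp (by fun_prop)).clm_apply continuous_snd).mul
      (continuous_radialBump.comp continuous_snd)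
  obtain ⟨M, hM⟩ := ((isCompact_closedBall r 1).prod
    (isCompact_closedBall (0 : E) 2)).exists_bound_of_continuousOn hc.continuousOn
  have hb : Integrable ((Metric.closedBall (0 : E) 2).indicator fun _ => M) :=
    (integrable_indicator_iff Metric.isClosed_closedBall.measurableSet).mpr
      (integrableOn_const (isCompact_closedBall _ _).measure_lt_top.ne)
  refine (hasDerivAt_integral_of_dominated_loc_of_deriv_le
    (F' := fun r y => fderiv ℝ p (x + r • y) y * radialBump y)
    (Metric.closedBall_mem_nhds r one_pos)
    (Eventually.of_forall fun s => ?_) ?_ ?_ (ae_of_all _ fun y s hs => ?_) hb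
    (ae_of_all _ fun y s _ => ?_)).2
  · exact ((hp0.comp (by fun_prop)).mul continuous_radialBump).aestronglyMeasurable
  · exact ((hp0.comp (by fun_prop)).mul continuous_radialBump).integrable_of_hasCompactSupport
      hasCompactSupport_radialBump.mul_left
  · exact (hc.comp (by fun_prop : Continuous fun y : E => (r, y))).aestronglyMeasurable
  · by_cases hy : y ∈ Metric.closedBall (0 : E) 2
    · rw [Set.indicator_of_mem hy]
      exact hM (s, y) ⟨hs, hy⟩
    · rw [Set.indicator_of_notMem hy, radialBump_eq_zero (by simpa using hy)]; simp
  · have h1 : HasDerivAt (fun s : ℝ => x + s • y) y s := by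
      simpa using ((hasDerivAt_id s).smul_const y).const_add x
    exact (((hp.differentiable one_ne_zero _).hasFDerivAt).comp_hasDerivAt s h1).mul_const _

/-- The field `radialBump y • y` is the gradient of `radialBumpPrim`, so integration by parts turns
the radial derivative into `Δp = c`. Smooth radial weights replace surface integrals over spheres.
-/
theorem integral_fderiv_mul_radialBump (b : OrthonormalBasis (Fin 3) ℝ E) (hp : ContDiff ℝ 2 p)
    (hΔ : ∀ x, Δ p x = c) (x : E) (r : ℝ) :
    ∫ y, fderiv ℝ p (x + r • y) y * radialBump y = -r * (c * ∫ y : E, radialBumpPrim y) := by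
  have hp1 : ContDiff ℝ 1 (fderiv ℝ p) := hp.fderiv_right (by norm_num)
  have hp1c := hp1.continuous
  have hp2c := hp1.continuous_fderiv one_ne_zero
  have hd : ∀ i y, HasFDerivAt (fun y => fderiv ℝ p (x + r • y) (b i))
      ((ContinuousLinearMap.apply ℝ ℝ (b i)).comp
        ((fderiv ℝ (fderiv ℝ p) (x + r • y)).comp (r • ContinuousLinearMap.id ℝ E))) y := by
    intro i y
    have h1 : HasFDerivAt (fun y : E => x + r • y) (r • ContinuousLinearMap.id ℝ E) y :=
      ((hasFDerivAt_id y).const_smul r).const_add x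
    exact (ContinuousLinearMap.apply ℝ ℝ (b i)).hasFDerivAt.comp y
      (((hp1.differentiable one_ne_zero _).hasFDerivAt).comp y h1)
  have hd' : ∀ i y, fderiv ℝ (fun y => fderiv ℝ p (x + r • y) (b i)) y (b i) =
      r * fderiv ℝ (fderiv ℝ p) (x + r • y) (b i) (b i) := by
    intro i y
    rw [(hd i y).fderiv]; simp
  have hgc : ∀ i, Continuous fun y => fderiv ℝ p (x + r • y) (b i) := fun i =>
    (hp1c.comp (by fun_prop)).clm_apply continuous_const
  have hg'c : ∀ i, Continuous fun y => r * fderiv ℝ (fderiv ℝ p) (x + r • y) (b i) (b i) := fun i =>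
    continuous_const.mul (((hp2c.comp (by fun_prop)).clm_apply continuous_const).clm_apply
      continuous_const)
  have hΨ' : ∀ i (y : E), fderiv ℝ radialBumpPrim y (b i) = radialBump y * inner ℝ y (b i) := by
    intro i y; rw [fderiv_radialBumpPrim]; simp
  have hi1 : ∀ i, Integrable fun y => r * fderiv ℝ (fderiv ℝ p) (x + r • y) (b i) (b i) *
      radialBumpPrim y := fun i =>
    ((hg'c i).mul continuous_radialBumpPrim).integrable_of_hasCompactSupport
      hasCompactSupport_radialBumpPrim.mul_left
  have hi2 : ∀ i, Integrable fun y => fderiv ℝ p (x + r • y) (b i) *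
      (radialBump y * inner ℝ y (b i)) := fun i =>
    ((hgc i).mul (continuous_radialBump.mul
      (by fun_prop : Continuous fun y : E => inner ℝ y (b i)))).integrable_of_hasCompactSupport
      (hasCompactSupport_radialBump.mul_right.mul_left)
  have ibp : ∀ i, ∫ y, fderiv ℝ p (x + r • y) (b i) * (radialBump y * inner ℝ y (b i)) =
      -∫ y, r * fderiv ℝ (fderiv ℝ p) (x + r • y) (b i) (b i) * radialBumpPrim y := by
    intro i
    have := integral_mul_fderiv_eq_neg_fderiv_mul_of_integrable (μ := (volume : Measure E))
      (f := fun y => fderiv ℝ p (x + r • y) (b i)) (g := radialBumpPrim) (v := b i)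
      (by simpa only [hd'] using hi1 i) (by simpa only [hΨ'] using hi2 i)
      (((hgc i).mul continuous_radialBumpPrim).integrable_of_hasCompactSupport
        hasCompactSupport_radialBumpPrim.mul_left)
      (fun y _ => (hd i y).differentiableAt)
      (fun y _ => (hasFDerivAt_radialBumpPrim y).differentiableAt)
    simpa only [hd', hΨ'] using this
  have hexp : ∀ y, fderiv ℝ p (x + r • y) y * radialBump y =
      ∑ i, fderiv ℝ p (x + r • y) (b i) * (radialBump y * inner ℝ y (b i)) := by
    intro y
    conv_lhs => enter [1]; rw [← b.sum_repr' y, map_sum]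
    rw [Finset.sum_mul]
    refine Finset.sum_congr rfl fun i _ => ?_
    rw [map_smul, real_inner_comm, smul_eq_mul, b.sum_repr' y]; ring
  simp_rw [hexp]
  rw [integral_finsetSum _ fun i _ => hi2 i]
  simp_rw [ibp]
  rw [Finset.sum_neg_distrib, ← integral_finsetSum _ fun i _ => hi1 i, ← integral_const_mul, neg_mul,
    ← integral_const_mul]
  congr 2
  funext y
  rw [← hΔ (x + r • y), laplacian_eq_sum_fderiv_fderiv b, ← Finset.sum_mul, ← Finset.mul_sum]
  ring

/-- The mean value property of functions with constant Laplacian. -/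
theorem integral_mul_radialBump (b : OrthonormalBasis (Fin 3) ℝ E) (hp : ContDiff ℝ 2 p)
    (hΔ : ∀ x, Δ p x = c) (x : E) (r : ℝ) :
    ∫ y, p (x + r • y) * radialBump y =
      p x * (∫ y : E, radialBump y) - r ^ 2 / 2 * (c * ∫ y : E, radialBumpPrim y) := by
  -- The corrected average is constant in `r`; its value at `r = 0` is `p x` times the mass of the
  -- bump.
  have hder : ∀ s : ℝ, HasDerivAt (fun r : ℝ => (∫ y, p (x + r • y) * radialBump y) +
      r ^ 2 / 2 * (c * ∫ y : E, radialBumpPrim y)) 0 s := by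
    intro s
    have h1 := hasDerivAt_integral_radialBump (hp.of_le (by norm_num)) x s
    rw [integral_fderiv_mul_radialBump b hp hΔ] at h1
    have h2 := (((hasDerivAt_id s).pow 2).div_const 2).mul_const (c * ∫ y : E, radialBumpPrim y)
    convert! h1.add h2 using 1
    simp
  have h := is_const_of_deriv_eq_zero (fun s => (hder s).differentiableAt)
    (fun s => (hder s).deriv) r 0
  simp only [zero_smul, add_zero, integral_const_mul] at h
  have h3 : p x * (∫ y : E, radialBump y) = ∫ y : E, p x * radialBump y :=
    (integral_const_mul _ _).symm
  simp at h
  linarith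

end MeanValue

/-! ### From constant Laplacian and an upper bound to a quadratic polynomial -/

section Liouville

variable {E : Type*} [NormedAddCommGroup E] [InnerProductSpace ℝ E] [FiniteDimensional ℝ E]
  [MeasurableSpace E] [BorelSpace E] {p : E → ℝ} {c : ℝ}

/-- Jensen's inequality for the exponential and an unnormalized density. -/
theorem exp_div_integral_mul_le {α : Type*} [MeasurableSpace α] {μ : Measure α} {a w : α → ℝ}
    (hw0 : ∀ y, 0 ≤ w y) (hw : Integrable w μ) (hpos : 0 < ∫ y, w y ∂μ)
    (haw : Integrable (fun y => a y * w y) μ)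
    (he : Integrable (fun y => Real.exp (a y) * w y) μ) :
    Real.exp ((∫ y, a y * w y ∂μ) / ∫ y, w y ∂μ) * (∫ y, w y ∂μ) ≤
      ∫ y, Real.exp (a y) * w y ∂μ := by
  set κ := ∫ y, w y ∂μ
  set m := (∫ y, a y * w y ∂μ) / κ
  -- The tangent line of the exponential at the weighted mean `m`.
  have h1 : ∀ y, Real.exp m * ((a y * w y) + (1 - m) * w y) ≤ Real.exp (a y) * w y := by
    intro y
    have h2 := Real.add_one_le_exp (a y - m)
    have h3 : Real.exp (a y) = Real.exp m * Real.exp (a y - m) := by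
      rw [← Real.exp_add]; congr 1; ring
    rw [h3, mul_assoc]
    refine mul_le_mul_of_nonneg_left ?_ (Real.exp_pos m).le
    nlinarith [hw0 y]
  have h4 := integral_mono ((haw.add (hw.const_mul (1 - m))).const_mul (Real.exp m)) he h1
  rw [integral_const_mul] at h4
  have h5 := integral_add haw (hw.const_mul (1 - m))
  simp only [Pi.add_apply] at h4
  rw [h5, integral_const_mul] at h4
  have h6 : ∫ y, a y * w y ∂μ = m * κ := by rw [div_mul_cancel₀ _ hpos.ne']
  rw [h6] at h4
  calc _ = Real.exp m * (m * κ + (1 - m) * κ) := by ring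
    _ ≤ _ := h4

theorem integrable_mul_radialBump {g : E → ℝ} (hg : Continuous g) :
    Integrable fun y => g y * radialBump y :=
  (hg.mul continuous_radialBump).integrable_of_hasCompactSupport
    hasCompactSupport_radialBump.mul_left

/-- Up to a constant `p x` is a bump average of `p`, so Jensen bounds `e^{3p(x)}` by an average of
`e^{3p}`, hence by the total mass of `f` times the growth factor near `x`. The bump lives in radius
2, which turns `1 + |z|` into `3 + |x|`. -/
theorem exists_le_log_of_exp_le (b : OrthonormalBasis (Fin 3) ℝ E) (hp : ContDiff ℝ 2 p)
    (hΔ : ∀ x, Δ p x = c) {f : E → ℝ} (hfi : Integrable f) (hf0 : ∀ y, 0 ≤ f y)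
    {A B : ℝ} (hB : 0 ≤ B)
    (h : ∀ z, Real.exp (3 * p z) ≤ f z * Real.exp (A + B * Real.log (1 + ‖z‖))) :
    ∃ C, ∀ x, p x ≤ C + B / 3 * Real.log (3 + ‖x‖) := by
  set κ := ∫ y : E, radialBump y with hκ
  have hκ0 : 0 < κ := integral_radialBump_pos
  set m := ∫ y : E, radialBumpPrim y
  set V := ∫ y, f y
  have hV : 0 ≤ V := integral_nonneg hf0
  have hbump : Integrable (radialBump (E := E)) :=
    continuous_radialBump.integrable_of_hasCompactSupport hasCompactSupport_radialBump
  refine ⟨(A + Real.log ((V + 1) / κ)) / 3 + c * m / (2 * κ), fun x => ?_⟩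
  have hmv := integral_mul_radialBump b hp hΔ x 1
  simp only [one_smul] at hmv
  have hpc : Continuous fun y => 3 * p (x + y) :=
    continuous_const.mul (hp.continuous.comp (by fun_prop))
  have hJ := exp_div_integral_mul_le radialBump_nonneg hbump hκ0 (integrable_mul_radialBump hpc)
    (integrable_mul_radialBump hpc.rexp)
  have h1 : ∫ y, Real.exp (3 * p (x + y)) * radialBump y ≤
      ∫ y, f (x + y) * Real.exp (A + B * Real.log (3 + ‖x‖)) := by
    refine integral_mono (integrable_mul_radialBump hpc.rexp)
      ((hfi.comp_add_left x).mul_const _) fun y => ?_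
    dsimp only
    by_cases hy : 2 < ‖y‖
    · rw [radialBump_eq_zero hy, mul_zero]
      exact mul_nonneg (hf0 _) (Real.exp_pos _).le
    · have h2 : Real.exp (3 * p (x + y)) * radialBump y ≤ Real.exp (3 * p (x + y)) :=
        mul_le_of_le_one_right (Real.exp_pos _).le (radialBump_le_one y)
      refine h2.trans ((h _).trans ?_)
      refine mul_le_mul_of_nonneg_left ?_ (hf0 _)
      have := norm_add_le x y
      refine Real.exp_le_exp.mpr (add_le_add_right (mul_le_mul_of_nonneg_left
        (Real.log_le_log (by positivity) (by linarith [not_lt.mp hy])) hB) A)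
  rw [integral_mul_const, integral_add_left_eq_self] at h1
  have h3 : ∫ y, 3 * p (x + y) * radialBump y = 3 * (p x * κ - 1 / 2 * (c * m)) := by
    simp_rw [mul_assoc]
    rw [integral_const_mul, hmv]; ring
  rw [h3] at hJ
  -- The mass is enlarged to `V + 1` so that its logarithm makes sense even when `V = 0`.
  have h4 : Real.exp (3 * (p x * κ - 1 / 2 * (c * m)) / κ) ≤
      (V + 1) / κ * Real.exp (A + B * Real.log (3 + ‖x‖)) := by
    rw [div_mul_eq_mul_div (V + 1), le_div_iff₀ hκ0]
    refine (hJ.trans h1).trans ?_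
    gcongr; linarith
  have h5 : (V + 1) / κ = Real.exp (Real.log ((V + 1) / κ)) :=
    (Real.exp_log (by positivity)).symm
  rw [h5, ← Real.exp_add, Real.exp_le_exp] at h4
  have h6 : 3 * (p x * κ - 1 / 2 * (c * m)) / κ = 3 * p x - 3 * (c * m / (2 * κ)) := by
    field_simp
  rw [h6] at h4
  linarith

theorem contDiff_fderiv_apply {g : E → ℝ} (hg : ContDiff ℝ ∞ g) (h : E) :
    ContDiff ℝ ∞ fun x => fderiv ℝ g x h :=
  (hg.fderiv_right (by simp)).clm_apply contDiff_const

theorem fderiv_convolution_apply {g : E → ℝ} (hg : ContDiff ℝ ∞ g) (hgs : HasCompactSupport g)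
    (hp : Continuous p) (h x : E) :
    fderiv ℝ (fun x => ∫ t, p t * g (x - t)) x h = ∫ t, p t * fderiv ℝ g (x - t) h := by
  have hg1 : ContDiff ℝ 1 g := hg.of_le (by simp)
  have h1 := hgs.hasFDerivAt_convolution_right (ContinuousLinearMap.mul ℝ ℝ)
    (hp.locallyIntegrable (μ := volume)) hg1 x
  have h2 := convolution_precompR_apply (ContinuousLinearMap.mul ℝ ℝ)
    (hp.locallyIntegrable (μ := volume)) (hgs.fderiv ℝ) (hg1.continuous_fderiv one_ne_zero) x h
  have h3 : HasFDerivAt (fun x => ∫ t, p t * g (x - t)) _ x := h1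
  rw [h3.fderiv, h2]
  rfl

theorem integral_mul_scaled_radialBump (hdim : Module.finrank ℝ E = 3) (q : E → ℝ) {r : ℝ}
    (hr : 0 < r) (x : E) :
    ∫ t, q t * radialBump (r⁻¹ • (x - t)) = r ^ 3 * ∫ y, q (x + (-r) • y) * radialBump y := by
  have h1 := Measure.integral_comp_inv_smul_of_nonneg (volume : Measure E)
    (fun y => q (x + (-r) • y) * radialBump y) hr.le
  rw [hdim, smul_eq_mul] at h1
  rw [← h1, ← integral_sub_left_eq_self _ volume x]
  refine integral_congr_ae (ae_of_all _ fun t => ?_)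
  dsimp only
  rw [neg_smul, smul_inv_smul₀ hr.ne', sub_sub_cancel, sub_eq_add_neg]

/-- The scaled bump functions reproduce functions with constant Laplacian up to constants. -/
theorem eq_integral_scaled_radialBump (b : OrthonormalBasis (Fin 3) ℝ E) (hp : ContDiff ℝ 2 p)
    (hΔ : ∀ x, Δ p x = c) {r : ℝ} (hr : 0 < r) (x : E) :
    p x = (r ^ 3 * ∫ y : E, radialBump y)⁻¹ * (∫ t, p t * radialBump (r⁻¹ • (x - t))) +
      r ^ 2 / 2 * (c * ∫ y : E, radialBumpPrim y) / ∫ y : E, radialBump y := by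
  have hdim : Module.finrank ℝ E = 3 := by
    simpa using Module.finrank_eq_card_basis b.toBasis
  have hκ0 : 0 < ∫ y : E, radialBump y := integral_radialBump_pos
  rw [integral_mul_scaled_radialBump hdim p hr, integral_mul_radialBump b hp hΔ]
  field_simp
  ring

/-- The mean value property writes `p` as its convolution with a smooth bump plus a constant. -/
theorem contDiff_of_laplacian_const (b : OrthonormalBasis (Fin 3) ℝ E) (hp : ContDiff ℝ 2 p)
    (hΔ : ∀ x, Δ p x = c) : ContDiff ℝ ∞ p := by
  have h : p = fun x => ((1 : ℝ) ^ 3 * ∫ y : E, radialBump y)⁻¹ *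
      (∫ t, p t * radialBump ((1 : ℝ)⁻¹ • (x - t))) +
      (1 : ℝ) ^ 2 / 2 * (c * ∫ y : E, radialBumpPrim y) / ∫ y : E, radialBump y :=
    funext fun x => eq_integral_scaled_radialBump b hp hΔ one_pos x
  rw [h]
  refine (contDiff_const.mul ?_).add contDiff_const
  have h1 := hasCompactSupport_radialBump.contDiff_convolution_right (μ := (volume : Measure E))
    (ContinuousLinearMap.mul ℝ ℝ) (hp.continuous.locallyIntegrable (μ := volume)) contDiff_radialBump
  simp only [inv_one, one_smul]
  exact h1

/-- The mass of `|p|` on balls is controlled by an upper bound for `p`. -/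
theorem integral_abs_mul_scaled_radialBump_le (b : OrthonormalBasis (Fin 3) ℝ E)
    (hp : ContDiff ℝ 2 p) (hΔ : ∀ x, Δ p x = c) {r S : ℝ} (hr : 0 < r) (x : E) (hS0 : 0 ≤ S)
    (hS : ∀ y, ‖y‖ ≤ 2 → p (x + (-r) • y) ≤ S) :
    ∫ t, |p t| * radialBump (r⁻¹ • (x - t)) ≤ r ^ 3 * (2 * S * (∫ y : E, radialBump y) -
      (p x * (∫ y : E, radialBump y) - r ^ 2 / 2 * (c * ∫ y : E, radialBumpPrim y))) := by
  have hdim : Module.finrank ℝ E = 3 := by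
    simpa using Module.finrank_eq_card_basis b.toBasis
  rw [integral_mul_scaled_radialBump hdim _ hr]
  gcongr
  have h1 := integral_mul_radialBump b hp hΔ x (-r)
  rw [neg_sq] at h1
  have hpc : Continuous fun y => p (x + (-r) • y) := hp.continuous.comp (by fun_prop)
  have hi : Integrable (radialBump (E := E)) :=
    continuous_radialBump.integrable_of_hasCompactSupport hasCompactSupport_radialBump
  rw [← h1, ← integral_const_mul, ← integral_sub (hi.const_mul _) (integrable_mul_radialBump hpc)]
  refine integral_mono (integrable_mul_radialBump hpc.abs)
    ((hi.const_mul _).sub (integrable_mul_radialBump hpc)) fun y => ?_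
  dsimp only
  rw [← sub_mul]
  by_cases hy : 2 < ‖y‖
  · simp [radialBump_eq_zero hy]
  · refine mul_le_mul_of_nonneg_right ?_ (radialBump_nonneg y)
    -- From `p ≤ S` and `0 ≤ S` follows `|p| ≤ 2S - p`, and the average of `p` itself is known
    -- exactly.
    rw [abs_le']
    have := hS y (not_lt.mp hy)
    constructor <;> linarith

theorem fderiv_integral_scaled {g : E → ℝ} (hg : ContDiff ℝ ∞ g) (hgs : HasCompactSupport g)
    (hp : Continuous p) {r : ℝ} (hr : r ≠ 0) (h x : E) :
    fderiv ℝ (fun x => ∫ t, p t * g (r • (x - t))) x h =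
      r * ∫ t, p t * fderiv ℝ g (r • (x - t)) h := by
  have h1 := fderiv_convolution_apply (g := fun z => g (r • z)) (hg.comp (contDiff_const_smul r))
    (hgs.comp_homeomorph (Homeomorph.smulOfNeZero r hr)) hp h x
  rw [h1, ← integral_const_mul]
  refine integral_congr_ae (ae_of_all _ fun t => ?_)
  dsimp only
  rw [fderiv_comp_smul]
  simp
  ring

theorem fderiv_apply_eq_zero_of_eq_zero {g : E → ℝ} (hg : ∀ y, 2 < ‖y‖ → g y = 0) (h : E) :
    ∀ y, 2 < ‖y‖ → fderiv ℝ g y h = 0 := by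
  intro y hy
  have : g =ᶠ[𝓝 y] fun _ => 0 := by
    filter_upwards [(isOpen_lt continuous_const continuous_norm).mem_nhds hy] with z hz
    exact hg z hz
  rw [this.fderiv_eq]; simp

/-- Three derivatives of the reproducing formula at scale `r` cost `r⁻³` beyond the normalization
`r⁻³`, while the mass of `|p|` at that scale is `O(r⁵)`, the term `c r²` being the worst. The result
is `O(1/r)`. -/
theorem fderiv_fderiv_fderiv_apply_eq_zero (b : OrthonormalBasis (Fin 3) ℝ E)
    (hp : ContDiff ℝ 2 p) (hΔ : ∀ x, Δ p x = c) {C B : ℝ} (hB : 0 ≤ B)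
    (hle : ∀ x, p x ≤ C + B * Real.log (3 + ‖x‖)) (h x : E) :
    fderiv ℝ (fun y => fderiv ℝ (fun z => fderiv ℝ p z h) y h) x h = 0 := by
  set κ := ∫ y : E, radialBump y with hκ
  have hκ0 : 0 < κ := integral_radialBump_pos
  set m := ∫ y : E, radialBumpPrim y with hm
  let D : (E → ℝ) → E → ℝ := fun g x => fderiv ℝ g x h
  have hDc : ∀ g, ContDiff ℝ ∞ g → ContDiff ℝ ∞ (D g) := fun g hg => contDiff_fderiv_apply hg h
  have hDs : ∀ g : E → ℝ, (∀ y, 2 < ‖y‖ → g y = 0) → ∀ y, 2 < ‖y‖ → D g y = 0 := fun g hg =>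
    fderiv_apply_eq_zero_of_eq_zero hg h
  let ψ : E → ℝ := radialBump
  have hψ0 : ContDiff ℝ ∞ ψ := contDiff_radialBump
  have hψs : ∀ y, 2 < ‖y‖ → ψ y = 0 := fun _ => radialBump_eq_zero
  obtain ⟨M, hM⟩ := (hasCompactSupport_of_eq_zero_of_lt_norm
    (hDs _ (hDs _ (hDs _ hψs)))).exists_bound_of_continuous
    (hDc _ (hDc _ (hDc _ hψ0))).continuous
  have hM0 : 0 ≤ M := (norm_nonneg _).trans (hM 0)
  -- The zero constant is kept on the right so that the step can be iterated.
  have hstep : ∀ (g : E → ℝ) (_ : ContDiff ℝ ∞ g) (_ : ∀ y, 2 < ‖y‖ → g y = 0) (r : ℝ) (_ : 0 < r)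
      (a k : ℝ), D (fun x => k * (∫ t, p t * g (r⁻¹ • (x - t))) + a) =
        fun x => (k * r⁻¹) * (∫ t, p t * D g (r⁻¹ • (x - t))) + 0 := by
    intro g hg hgs r hr a k
    funext x
    have hd : Differentiable ℝ fun x => ∫ t, p t * g (r⁻¹ • (x - t)) := by
      have h1 := HasCompactSupport.contDiff_convolution_right (μ := (volume : Measure E))
        (ContinuousLinearMap.mul ℝ ℝ) (f := p) (g := fun z => g (r⁻¹ • z)) (n := ⊤)
        ((hasCompactSupport_of_eq_zero_of_lt_norm hgs).comp_homeomorph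
          (Homeomorph.smulOfNeZero r⁻¹ (inv_ne_zero hr.ne')))
        (hp.continuous.locallyIntegrable (μ := volume)) (hg.comp (contDiff_const_smul r⁻¹))
      exact h1.differentiable (by simp)
    have h2 := fderiv_integral_scaled hg (hasCompactSupport_of_eq_zero_of_lt_norm hgs)
      hp.continuous (inv_ne_zero hr.ne') h x
    simp only [D]
    rw [fderiv_add_const, fderiv_const_mul (hd x), smul_apply, h2, smul_eq_mul]
    ring
  have hform : ∀ r : ℝ, 0 < r → D (D (D p)) x = (r ^ 3 * κ)⁻¹ * r⁻¹ * r⁻¹ * r⁻¹ *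
      ∫ t, p t * D (D (D ψ)) (r⁻¹ • (x - t)) := by
    intro r hr
    have h0 : p = fun x => (r ^ 3 * κ)⁻¹ * (∫ t, p t * ψ (r⁻¹ • (x - t))) +
        r ^ 2 / 2 * (c * m) / κ := funext fun x => eq_integral_scaled_radialBump b hp hΔ hr x
    have h1 : D (D (D p)) = D (D (D (fun x => (r ^ 3 * κ)⁻¹ * (∫ t, p t * ψ (r⁻¹ • (x - t))) +
        r ^ 2 / 2 * (c * m) / κ))) := congrArg (fun q => D (D (D q))) h0
    rw [h1, hstep _ hψ0 hψs r hr, hstep _ (hDc _ hψ0) (hDs _ hψs) r hr,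
      hstep _ (hDc _ (hDc _ hψ0)) (hDs _ (hDs _ hψs)) r hr]
    exact add_zero _
  have hbound : ∀ r : ℝ, 1 ≤ r → |D (D (D p)) x| ≤
      (κ⁻¹ * M * 8 * (2 * (|C| + B * (2 + ‖x‖ + 4)) * κ + |p x * κ| + 2 * |c * m|)) * r⁻¹ := by
    intro r hr
    have hr0 : 0 < r := by linarith
    -- A crude linear bound from `log s ≤ s - 1` suffices. The scale is `2r` because the bump at
    -- that scale equals one on the support of the differentiated bump at scale `r`.
    set S := |C| + B * (2 + ‖x‖ + 4 * r) with hSdef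
    have hS0 : 0 ≤ S := by positivity
    have hS : ∀ y : E, ‖y‖ ≤ 2 → p (x + (-(2 * r)) • y) ≤ S := by
      intro y hy
      refine (hle _).trans ?_
      have h1 : Real.log (3 + ‖x + (-(2 * r)) • y‖) ≤ 2 + ‖x‖ + 4 * r := by
        refine (Real.log_le_sub_one_of_pos (by positivity)).trans ?_
        have h2 := norm_add_le x ((-(2 * r)) • y)
        rw [norm_smul, norm_neg, Real.norm_of_nonneg (by positivity : 0 ≤ 2 * r)] at h2
        nlinarith
      exact add_le_add (le_abs_self C) (mul_le_mul_of_nonneg_left h1 hB)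
    have hL1 := integral_abs_mul_scaled_radialBump_le b hp hΔ (by positivity : 0 < 2 * r) x hS0 hS
    have hI : |∫ t, p t * D (D (D ψ)) (r⁻¹ • (x - t))| ≤
        M * ∫ t, |p t| * radialBump ((2 * r)⁻¹ • (x - t)) := by
      rw [← integral_const_mul, ← Real.norm_eq_abs]
      refine norm_integral_le_of_norm_le (Integrable.const_mul ?_ M) (ae_of_all _ fun t => ?_)
      · have hcs : HasCompactSupport fun t => radialBump ((2 * r)⁻¹ • (x - t)) := by
          refine hasCompactSupport_of_eq_zero_of_lt_norm (R := ‖x‖ + 4 * r) fun t ht => ?_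
          refine radialBump_eq_zero ?_
          rw [norm_smul, Real.norm_of_nonneg (by positivity), lt_inv_mul_iff₀ (by positivity)]
          have := norm_sub_norm_le t x
          rw [norm_sub_rev] at this
          linarith
        exact (hp.continuous.abs.mul (continuous_radialBump.comp
          (by fun_prop))).integrable_of_hasCompactSupport hcs.mul_left
      · rw [norm_mul, Real.norm_eq_abs]
        by_cases hy : 2 < ‖r⁻¹ • (x - t)‖
        · rw [hDs _ (hDs _ (hDs _ hψs)) _ hy, norm_zero, mul_zero]
          exact mul_nonneg hM0 (mul_nonneg (abs_nonneg _) (radialBump_nonneg _))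
        · have h1 : radialBump ((2 * r)⁻¹ • (x - t)) = 1 := by
            refine radialBump_eq_one ?_
            rw [mul_inv, mul_smul, norm_smul]
            norm_num
            linarith [not_lt.mp hy]
          rw [h1, mul_one, mul_comm]
          exact mul_le_mul_of_nonneg_right (hM _) (abs_nonneg _)
    have hbr : 2 * S * κ - (p x * κ - (2 * r) ^ 2 / 2 * (c * m)) ≤
        (2 * (|C| + B * (2 + ‖x‖ + 4)) * κ + |p x * κ| + 2 * |c * m|) * r ^ 2 := by
      have h1 : S ≤ (|C| + B * (2 + ‖x‖ + 4)) * r ^ 2 := by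
        have e1 : |C| ≤ |C| * r ^ 2 := le_mul_of_one_le_right (abs_nonneg _) (one_le_pow₀ hr)
        have e2 : 2 + ‖x‖ + 4 * r ≤ (2 + ‖x‖ + 4) * r ^ 2 := by
          nlinarith [norm_nonneg x, one_le_pow₀ hr (n := 2), mul_nonneg (norm_nonneg x)
            (sub_nonneg.mpr (one_le_pow₀ hr (n := 2)))]
        have e3 := mul_le_mul_of_nonneg_left e2 hB
        rw [hSdef]; linarith
      have h2 : -(p x * κ) ≤ |p x * κ| * r ^ 2 :=
        (neg_le_abs _).trans (le_mul_of_one_le_right (abs_nonneg _) (one_le_pow₀ hr))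
      have h3 : c * m ≤ |c * m| := le_abs_self _
      have h4 := mul_le_mul_of_nonneg_right h1 hκ0.le
      have h5 := mul_le_mul_of_nonneg_right h3 (sq_nonneg r)
      linarith
    rw [hform r hr0, abs_mul, abs_of_nonneg (by positivity)]
    have h6 := hI.trans (mul_le_mul_of_nonneg_left (hL1.trans
      (mul_le_mul_of_nonneg_left hbr (by positivity))) hM0)
    refine (mul_le_mul_of_nonneg_left h6 (by positivity)).trans (le_of_eq ?_)
    field_simp
    ring
  have hlim : Tendsto (fun r : ℝ =>
      (κ⁻¹ * M * 8 * (2 * (|C| + B * (2 + ‖x‖ + 4)) * κ + |p x * κ| + 2 * |c * m|)) * r⁻¹)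
      atTop (𝓝 0) := by
    simpa using tendsto_inv_atTop_zero.const_mul
      (κ⁻¹ * M * 8 * (2 * (|C| + B * (2 + ‖x‖ + 4)) * κ + |p x * κ| + 2 * |c * m|))
  have := ge_of_tendsto hlim ((eventually_ge_atTop 1).mono hbound)
  exact abs_nonpos_iff.mp this

/-- A smooth function with vanishing third directional derivatives is a quadratic polynomial. -/
theorem eq_quadratic_of_fderiv_fderiv_fderiv_eq_zero (hp : ContDiff ℝ ∞ p)
    (h3 : ∀ h x, fderiv ℝ (fun y => fderiv ℝ (fun z => fderiv ℝ p z h) y h) x h = 0) (x : E) :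
    p x = p 0 + fderiv ℝ p 0 x + fderiv ℝ (fderiv ℝ p) 0 x x / 2 := by
  have hline : ∀ {g : E → ℝ}, ContDiff ℝ ∞ g → ∀ t : ℝ,
      HasDerivAt (fun t : ℝ => g (t • x)) (fderiv ℝ g (t • x) x) t := by
    intro g hg t
    have h1 : HasDerivAt (fun t : ℝ => t • x) x t := by
      simpa using (hasDerivAt_id t).smul_const x
    exact ((hg.differentiable (by simp) _).hasFDerivAt).comp_hasDerivAt t h1
  have hp1 := contDiff_fderiv_apply hp x
  have hp2 := contDiff_fderiv_apply hp1 x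
  set p1 := fun z => fderiv ℝ p z x with hp1d
  set p2 := fun z => fderiv ℝ p1 z x with hp2d
  have c2 : ∀ t : ℝ, p2 (t • x) = p2 0 := by
    intro t
    have := is_const_of_deriv_eq_zero (fun t => (hline hp2 t).differentiableAt)
      (fun t => by rw [(hline hp2 t).deriv]; exact h3 x _) t 0
    simpa using this
  have c1 : ∀ t : ℝ, p1 (t • x) = p1 0 + t * p2 0 := by
    intro t
    have hd : ∀ t : ℝ, HasDerivAt (fun t : ℝ => p1 (t • x) - t * p2 0) 0 t := by
      intro t
      have := (hline hp1 t).sub ((hasDerivAt_id t).mul_const (p2 0))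
      refine this.congr_deriv ?_
      change p2 (t • x) - 1 * p2 0 = 0
      rw [c2]; ring
    have := is_const_of_deriv_eq_zero (fun t => (hd t).differentiableAt)
      (fun t => (hd t).deriv) t 0
    simp at this
    linarith
  have hd : ∀ t : ℝ, HasDerivAt (fun t : ℝ => p (t • x) - (t * p1 0 + t ^ 2 / 2 * p2 0)) 0 t := by
    intro t
    have := (hline hp t).sub (((hasDerivAt_id t).mul_const (p1 0)).add
      ((((hasDerivAt_id t).pow 2).div_const 2).mul_const (p2 0)))
    refine this.congr_deriv ?_
    change p1 (t • x) - _ = 0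
    rw [c1]; simp
  have := is_const_of_deriv_eq_zero (fun t => (hd t).differentiableAt)
    (fun t => (hd t).deriv) 1 0
  have hp20 : p2 0 = fderiv ℝ (fderiv ℝ p) 0 x x := by
    have hd2 : DifferentiableAt ℝ (fderiv ℝ p) 0 :=
      (hp.fderiv_right (m := ∞) (by simp)).differentiable (by simp) 0
    have : HasFDerivAt p1 ((ContinuousLinearMap.apply ℝ ℝ x).comp (fderiv ℝ (fderiv ℝ p) 0)) 0 :=
      (ContinuousLinearMap.apply ℝ ℝ x).hasFDerivAt.comp 0 hd2.hasFDerivAt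
    simp only [hp2d]
    rw [this.fderiv]; rfl
  rw [← hp20]
  simp at this
  linarith

end Liouville

/-! ### Quadratic polynomials with logarithmic growth from above -/

section QuadraticPolynomials

theorem tendsto_log_three_add_div {s : ℝ} (hs : 0 < s) (C B : ℝ) :
    Tendsto (fun t : ℝ => (C + B * Real.log (3 + s * t)) / t) atTop (𝓝 0) := by
  have h1 := Real.tendsto_pow_log_div_mul_add_atTop s⁻¹ (-(3 * s⁻¹)) 1 (inv_ne_zero hs.ne')
  have h2 : Tendsto (fun t : ℝ => 3 + s * t) atTop atTop :=
    tendsto_atTop_add_const_left _ _ (tendsto_id.const_mul_atTop hs)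
  have h3 := ((h1.comp h2).const_mul B).add (tendsto_inv_atTop_zero.const_mul C)
  simp only [mul_zero, add_zero] at h3
  refine h3.congr fun t => ?_
  simp only [Function.comp_apply, pow_one]
  have : s⁻¹ * (3 + s * t) + -(3 * s⁻¹) = t := by field_simp; ring
  rw [this]
  ring

/-- A quadratic polynomial on the line with at most logarithmic growth from above. -/
theorem quadratic_le_log {a b s C B : ℝ} (hs : 0 < s)
    (h : ∀ t : ℝ, b * t + a * t ^ 2 ≤ C + B * Real.log (3 + s * |t|)) :
    a ≤ 0 ∧ (a = 0 → b = 0) := by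
  have hlim := tendsto_log_three_add_div hs C B
  constructor
  -- Adding the inequalities at `t` and `-t` cancels the linear term.
  · have h1 : Tendsto (fun t : ℝ => (C + B * Real.log (3 + s * t)) / t * t⁻¹) atTop (𝓝 0) := by
      simpa using hlim.mul tendsto_inv_atTop_zero
    refine ge_of_tendsto h1 ((eventually_gt_atTop 0).mono fun t ht => ?_)
    have h2 := h t
    have h3 := h (-t)
    rw [abs_neg] at h3
    rw [abs_of_pos ht] at h2 h3
    rw [← div_eq_mul_inv, div_div, le_div_iff₀ (by positivity)]
    nlinarith
  · intro ha
    have : |b| ≤ 0 := by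
      refine ge_of_tendsto hlim ((eventually_gt_atTop 0).mono fun t ht => ?_)
      have h2 := h t
      have h3 := h (-t)
      rw [abs_neg] at h3
      rw [abs_of_pos ht] at h2 h3
      rw [le_div_iff₀ ht]
      rcases abs_cases b with ⟨hb, -⟩ | ⟨hb, -⟩ <;> rw [hb] <;> subst ha <;> linarith
    exact abs_nonpos_iff.mp this

theorem exists_bound_quadratic {a b : ℝ} (ha : a ≤ 0) (hb : a = 0 → b = 0) :
    ∃ K : ℝ, ∀ t : ℝ, b * t + a * t ^ 2 ≤ K := by
  rcases ha.lt_or_eq with h | h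
  · refine ⟨-b ^ 2 / (4 * a), fun t => ?_⟩
    rw [le_div_iff_of_neg (by linarith)]
    nlinarith [sq_nonneg (2 * a * t + b)]
  · exact ⟨0, fun t => by simp [h, hb h]⟩

/-- In an eigenbasis of the quadratic form `p` is a sum of one-variable quadratics. On each axis the
logarithmic bound forces a nonpositive leading coefficient, and no linear term where it vanishes. -/
theorem bddAbove_of_quadratic_of_le_log {E : Type*} [NormedAddCommGroup E] [InnerProductSpace ℝ E]
    [FiniteDimensional ℝ E] {p : E → ℝ} {c₀ : ℝ} {l : E →L[ℝ] ℝ} {Q : E →L[ℝ] E →L[ℝ] ℝ}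
    (hQ : ∀ x y, Q x y = Q y x) (hp : ∀ x, p x = c₀ + l x + Q x x / 2) {C B : ℝ}
    (hle : ∀ x, p x ≤ C + B * Real.log (3 + ‖x‖)) : BddAbove (Set.range p) := by
  let T : E →ₗ[ℝ] E := ((InnerProductSpace.toDual ℝ E).symm.toLinearIsometry.toLinearMap).comp
    (Q : E →ₗ[ℝ] E →L[ℝ] ℝ)
  have hT : ∀ x y, inner ℝ (T x) y = Q x y := fun x y => by
    simp only [T]
    exact InnerProductSpace.toDual_symm_apply
  have hTs : T.IsSymmetric := fun x y => by
    rw [hT, real_inner_comm, hT, hQ]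
  set e := hTs.eigenvectorBasis rfl
  set μ := hTs.eigenvalues rfl
  have hTe : ∀ i, T (e i) = μ i • e i := fun i => hTs.apply_eigenvectorBasis rfl i
  have hdecomp : ∀ x, p x = c₀ + ∑ i, (l (e i) * inner ℝ (e i) x +
      μ i / 2 * (inner ℝ (e i) x) ^ 2) := by
    intro x
    have h1 : l x = ∑ i, l (e i) * inner ℝ (e i) x := by
      conv_lhs => rw [← e.sum_repr' x, map_sum]
      exact Finset.sum_congr rfl fun i _ => by rw [map_smul, smul_eq_mul, mul_comm]
    have h2 : Q x x = ∑ i, μ i * (inner ℝ (e i) x) ^ 2 := by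
      rw [← hT, ← e.sum_inner_mul_inner]
      refine Finset.sum_congr rfl fun i _ => ?_
      rw [hTs, hTe, inner_smul_right, real_inner_comm]; ring
    rw [hp, h1, h2, Finset.sum_add_distrib, Finset.sum_div, add_assoc]
    congr 2
    exact Finset.sum_congr rfl fun i _ => by ring
  have hterm : ∀ i, ∃ K : ℝ, ∀ t : ℝ, l (e i) * t + μ i / 2 * t ^ 2 ≤ K := by
    intro i
    have hq := quadratic_le_log (a := μ i / 2) (b := l (e i)) (s := 1) (C := C - c₀) (B := B)
      one_pos fun t => by
        have h1 := hle (t • e i)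
        rw [hp, norm_smul, e.norm_eq_one, mul_one, Real.norm_eq_abs] at h1
        have h2 : Q (t • e i) (t • e i) = μ i * t ^ 2 := by
          rw [← hT, map_smul, hTe, inner_smul_left, inner_smul_left, inner_smul_right,
            real_inner_self_eq_norm_sq, e.norm_eq_one]
          simp; ring
        rw [h2, map_smul, smul_eq_mul] at h1
        rw [one_mul]
        linarith
    exact exists_bound_quadratic hq.1 hq.2
  choose K hK using hterm
  refine ⟨c₀ + ∑ i, K i, ?_⟩
  rintro _ ⟨x, rfl⟩
  rw [hdecomp]
  gcongr with i
  exact hK i _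

open MvPolynomial in
-- Degree one would make `P` a constant plus a nonzero linear form, which is unbounded above along
-- some line.
theorem totalDegree_eq_zero_or_two {P : MvPolynomial (Fin 3) ℝ} (hP : P.totalDegree ≤ 2)
    (hb : BddAbove (Set.range fun x : EuclideanSpace ℝ (Fin 3) => eval (fun i => x i) P)) :
    P.totalDegree = 0 ∨ P.totalDegree = 2 := by
  by_contra! hne
  have h1 : P.totalDegree = 1 := by omega
  obtain ⟨K, hK⟩ := hb
  have hsum : P = homogeneousComponent 0 P + homogeneousComponent 1 P := by
    conv_lhs => rw [← sum_homogeneousComponent P, h1]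
    simp [Finset.sum_range_succ]
  have hh : ∀ (t : ℝ) (x : Fin 3 → ℝ), eval (fun i => t * x i) (homogeneousComponent 1 P) =
      t * eval x (homogeneousComponent 1 P) := by
    intro t x
    rw [eval_eq', eval_eq', Finset.mul_sum]
    refine Finset.sum_congr rfl fun d hd => ?_
    have hd1 : ∑ i, d i = 1 := by
      have := homogeneousComponent_isHomogeneous 1 P (mem_support_iff.mp hd)
      rw [← Finsupp.degree_eq_sum, Finsupp.degree_eq_weight_one]
      exact this
    simp_rw [mul_pow]
    rw [Finset.prod_mul_distrib, Finset.prod_pow_eq_pow_sum, hd1]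
    ring
  have hz : homogeneousComponent 1 P = 0 := by
    refine MvPolynomial.funext fun x => ?_
    rw [map_zero]
    have := quadratic_le_log (a := 0) (b := eval x (homogeneousComponent 1 P)) (s := 1)
      (C := K - coeff 0 P) (B := 0) one_pos fun t => by
        have h2 := hK ⟨WithLp.toLp 2 (fun i => t * x i), rfl⟩
        simp only at h2
        rw [hsum, map_add, hh, homogeneousComponent_zero, eval_C] at h2
        linarith
    exact this.2 rfl
  rw [hz, add_zero, homogeneousComponent_zero] at hsum
  rw [hsum, totalDegree_C] at h1
  exact zero_ne_one h1

open MvPolynomial in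
theorem exists_mvPolynomial_of_quadratic (c₀ : ℝ) (l : EuclideanSpace ℝ (Fin 3) →L[ℝ] ℝ)
    (Q : EuclideanSpace ℝ (Fin 3) →L[ℝ] EuclideanSpace ℝ (Fin 3) →L[ℝ] ℝ) :
    ∃ P : MvPolynomial (Fin 3) ℝ, P.totalDegree ≤ 2 ∧ ∀ x : EuclideanSpace ℝ (Fin 3),
      eval (fun i => x i) P = c₀ + l x + Q x x / 2 := by
  set e := EuclideanSpace.basisFun (Fin 3) ℝ
  refine ⟨C c₀ + ∑ i, C (l (e i)) * X i + ∑ i, ∑ j, C (Q (e i) (e j) / 2) * X i * X j, ?_, ?_⟩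
  · refine (totalDegree_add _ _).trans (max_le ((totalDegree_add _ _).trans (max_le ?_ ?_)) ?_)
    · simp
    · refine totalDegree_finsetSum_le fun i _ => ?_
      refine (totalDegree_mul _ _).trans ?_
      simp
    · refine totalDegree_finsetSum_le fun i _ => totalDegree_finsetSum_le fun j _ => ?_
      refine (totalDegree_mul _ _).trans ?_
      have := totalDegree_mul (C (Q (e i) (e j) / 2)) (X i : MvPolynomial (Fin 3) ℝ)
      simp at this ⊢
      omega
  · intro x
    have hx : x = ∑ i, x i • e i := by
      conv_lhs => rw [← e.sum_repr x]
      simp [e]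
    have h1 : l x = ∑ i, l (e i) * x i := by
      conv_lhs => rw [hx, map_sum]
      exact Finset.sum_congr rfl fun i _ => by rw [map_smul, smul_eq_mul, mul_comm]
    have h2 : Q x x = ∑ i, ∑ j, Q (e i) (e j) * x i * x j := by
      have h3 : ∀ y, Q x y = ∑ i, x i * Q (e i) y := fun y => by
        conv_lhs => rw [hx, map_sum]
        rw [sum_apply]
        exact Finset.sum_congr rfl fun i _ => by rw [map_smul, smul_apply, smul_eq_mul]
      rw [h3]
      refine Finset.sum_congr rfl fun i _ => ?_
      conv_lhs => rw [hx, map_sum]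
      simp only [← hx]
      rw [Finset.mul_sum]
      refine Finset.sum_congr rfl fun j _ => ?_
      rw [map_smul, smul_eq_mul]; ring
    rw [h1, h2]
    simp only [map_add, map_sum, map_mul, eval_C, eval_X, Finset.sum_div]
    congr 1
    exact Finset.sum_congr rfl fun i _ => Finset.sum_congr rfl fun j _ => by ring

end QuadraticPolynomials

/-! ### The Fourier transform of `|z|⁻²` in dimension three, by Gaussian subordination -/

section RieszFourier

theorem integral_exp_neg_pi_mul_sq {a : ℝ} (ha : 0 < a) :
    ∫ t in Set.Ioi (0 : ℝ), Real.exp (-(Real.pi * a ^ 2 * t)) = (Real.pi * a ^ 2)⁻¹ := by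
  have := Real.integral_rpow_mul_exp_neg_mul_Ioi (a := 1) (r := Real.pi * a ^ 2) one_pos
    (by positivity)
  simpa using this

/-- The substitution `t ↦ 1/t` turns this into the integral for `Γ(1/2) = √π`. The weight `t^{-3/2}`
is the one that the Fourier transform of a three-dimensional Gaussian produces. -/
theorem integral_rpow_mul_exp_neg_pi_div {a : ℝ} (ha : 0 < a) :
    ∫ t in Set.Ioi (0 : ℝ), t ^ (-(3 / 2) : ℝ) * Real.exp (-(Real.pi * a ^ 2 / t)) = a⁻¹ := by
  have h1 := Real.integral_rpow_mul_exp_neg_mul_Ioi (a := 1 / 2) (r := Real.pi * a ^ 2)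
    (by norm_num) (by positivity)
  have h2 := integral_comp_rpow_Ioi
    (fun t : ℝ => t ^ ((1 / 2 : ℝ) - 1) * Real.exp (-(Real.pi * a ^ 2 * t))) (p := -1) (by norm_num)
  rw [h1] at h2
  have h3 : (1 / (Real.pi * a ^ 2)) ^ (1 / 2 : ℝ) * Real.Gamma (1 / 2) = a⁻¹ := by
    rw [Real.Gamma_one_half_eq, ← Real.sqrt_eq_rpow, ← Real.sqrt_mul (by positivity)]
    rw [← Real.sqrt_sq (inv_nonneg.mpr ha.le)]
    congr 1
    have := Real.pi_pos
    field_simp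
  rw [h3] at h2
  rw [← h2]
  refine setIntegral_congr_fun measurableSet_Ioi fun t ht => ?_
  have ht : 0 < t := ht
  rw [Real.rpow_neg_one, smul_eq_mul, ← mul_assoc, abs_neg, abs_one, one_mul,
    Real.inv_rpow ht.le, ← Real.rpow_neg ht.le, ← Real.rpow_add ht, div_eq_mul_inv (Real.pi * a ^ 2)]
  norm_num

variable {E : Type*} [NormedAddCommGroup E] [InnerProductSpace ℝ E] [FiniteDimensional ℝ E]
  [MeasurableSpace E] [BorelSpace E] [hE : Fact (Module.finrank ℝ E = 3)]

theorem fourier_gaussian_of_finrank_eq_three {t : ℝ} (ht : 0 < t) (w : E) :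
    𝓕 (fun v : E => Complex.exp (-(Real.pi * t : ℝ) * ‖v‖ ^ 2)) w =
      ((t ^ (-(3 / 2) : ℝ) * Real.exp (-(Real.pi * ‖w‖ ^ 2 / t)) : ℝ) : ℂ) := by
  have hb : 0 < ((Real.pi * t : ℝ) : ℂ).re := by
    rw [Complex.ofReal_re]; positivity
  rw [fourier_gaussian_innerProductSpace hb, hE.out]
  push_cast
  have hpi := Real.pi_pos.ne'
  congr 1
  · rw [← Complex.ofReal_mul, ← Complex.ofReal_div]
    have h1 : Real.pi / (Real.pi * t) = t⁻¹ := by field_simp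
    rw [h1]
    have h2 : ((3 : ℂ) / 2) = ((3 / 2 : ℝ) : ℂ) := by push_cast; ring
    rw [h2, ← Complex.ofReal_cpow (by positivity), Real.inv_rpow ht.le, ← Real.rpow_neg ht.le]
  · congr 1
    have h3 : (Real.pi : ℂ) ≠ 0 := by exact_mod_cast hpi
    have h4 : (t : ℂ) ≠ 0 := by exact_mod_cast ht.ne'
    field_simp

theorem integrable_gaussian {t : ℝ} (ht : 0 < t) :
    Integrable fun v : E => Complex.exp (-(Real.pi * t : ℝ) * ‖v‖ ^ 2) := by
  have hb : 0 < ((Real.pi * t : ℝ) : ℂ).re := by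
    rw [Complex.ofReal_re]; positivity
  simpa using GaussianFourier.integrable_cexp_neg_mul_sq_norm_add hb 0 (0 : E)

theorem integral_gaussian_mul_fourier {Θ : E → ℂ} (hΘ : Integrable Θ) {t : ℝ} (ht : 0 < t) :
    ∫ z, (Real.exp (-(Real.pi * ‖z‖ ^ 2 * t)) : ℂ) * 𝓕 Θ z =
      ∫ ξ, ((t ^ (-(3 / 2) : ℝ) * Real.exp (-(Real.pi * ‖ξ‖ ^ 2 / t)) : ℝ) : ℂ) * Θ ξ := by
  have h := VectorFourier.integral_fourierIntegral_smul_eq_flip (L := innerₗ E)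
    (μ := volume) (ν := volume) Real.continuous_fourierChar continuous_inner
    (integrable_gaussian (E := E) ht) hΘ
  simp only [smul_eq_mul, flip_innerₗ] at h
  have e1 : ∀ z : E, (Real.exp (-(Real.pi * ‖z‖ ^ 2 * t)) : ℂ) =
      Complex.exp (-(Real.pi * t : ℝ) * ‖z‖ ^ 2) := fun z => by
    push_cast; congr 1; ring
  simp_rw [e1, ← fourier_gaussian_of_finrank_eq_three ht]
  exact h.symm

/-- The transform of `|z|⁻²` is `π|ξ|⁻¹`: both kernels are superpositions of Gaussians, and the
Gaussian identity is integrated over `t`. -/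
theorem integral_inv_norm_sq_mul_fourier {Θ : E → ℂ} (hΘ : Integrable Θ)
    (hΘ' : Integrable fun ξ => ((‖ξ‖⁻¹ : ℝ) : ℂ) * Θ ξ)
    (hF : Integrable fun z => (((‖z‖ ^ 2)⁻¹ : ℝ) : ℂ) * 𝓕 Θ z) :
    ∫ z, (((‖z‖ ^ 2)⁻¹ : ℝ) : ℂ) * 𝓕 Θ z = Real.pi * ∫ ξ, ((‖ξ‖⁻¹ : ℝ) : ℂ) * Θ ξ := by
  have hne : ∀ᵐ z : E, 0 < ‖z‖ := by
    have : Nontrivial E := Module.nontrivial_of_finrank_pos (R := ℝ) (by rw [hE.out]; norm_num)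
    filter_upwards [Measure.ae_ne volume (0 : E)] with z hz
    exact norm_pos_iff.mpr hz
  -- Fubini in a form that serves both superpositions. Integrability in `t` is automatic, since a
  -- nonintegrable function would have integral zero while `K` is positive.
  have key : ∀ (k : ℝ → ℝ → ℝ) (K : ℝ → ℝ) (g : E → ℂ), (∀ t a, 0 < t → 0 ≤ k t a) →
      Measurable (Function.uncurry k) →
      (∀ a, 0 < a → ∫ t in Set.Ioi (0 : ℝ), k t a = K a) → (∀ a, 0 < a → 0 < K a) →
      AEStronglyMeasurable g volume → Integrable (fun z => ((K ‖z‖ : ℝ) : ℂ) * g z) →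
      ∫ t in Set.Ioi (0 : ℝ), ∫ z, ((k t ‖z‖ : ℝ) : ℂ) * g z = ∫ z, ((K ‖z‖ : ℝ) : ℂ) * g z := by
    intro k K g hk hkm hkK hK hg hKg
    have hkint : ∀ a, 0 < a → IntegrableOn (fun t => k t a) (Set.Ioi 0) := fun a ha => by
      by_contra hni
      have := hkK a ha
      rw [integral_undef hni] at this
      exact (hK a ha).ne this
    have hmeas : AEStronglyMeasurable (fun q : ℝ × E => ((k q.1 ‖q.2‖ : ℝ) : ℂ) * g q.2)
        ((volume.restrict (Set.Ioi (0 : ℝ))).prod volume) := by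
      refine AEStronglyMeasurable.mul ?_ hg.comp_snd
      exact (Complex.measurable_ofReal.comp (hkm.comp (measurable_fst.prodMk
        measurable_snd.norm))).aestronglyMeasurable
    have hint : Integrable (fun q : ℝ × E => ((k q.1 ‖q.2‖ : ℝ) : ℂ) * g q.2)
        ((volume.restrict (Set.Ioi (0 : ℝ))).prod volume) := by
      rw [integrable_prod_iff' hmeas]
      constructor
      · filter_upwards [hne] with z hz
        exact (hkint _ hz).ofReal.mul_const _
      · refine hKg.norm.congr ?_
        filter_upwards [hne] with z hz
        simp only [norm_mul, Complex.norm_real]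
        rw [integral_mul_const, ← hkK _ hz, Real.norm_of_nonneg
          (setIntegral_nonneg measurableSet_Ioi fun t ht => hk t _ ht)]
        congr 1
        refine setIntegral_congr_fun measurableSet_Ioi fun t ht => ?_
        exact (Real.norm_of_nonneg (hk t _ ht)).symm
    rw [integral_integral_swap (f := fun t z => ((k t ‖z‖ : ℝ) : ℂ) * g z) hint]
    refine integral_congr_ae ?_
    filter_upwards [hne] with z hz
    rw [integral_mul_const, integral_complex_ofReal, hkK _ hz]
  have hFc : Continuous (𝓕 Θ) :=
    VectorFourier.fourierIntegral_continuous Real.continuous_fourierChar continuous_inner hΘ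
  have h1 := key (fun t a => Real.exp (-(Real.pi * a ^ 2 * t))) (fun a => (Real.pi * a ^ 2)⁻¹) (𝓕 Θ)
    (fun _ _ _ => (Real.exp_pos _).le) (by fun_prop) (fun a ha => integral_exp_neg_pi_mul_sq ha)
    (fun a ha => by positivity) hFc.aestronglyMeasurable (by
      refine (hF.const_mul ((Real.pi⁻¹ : ℝ) : ℂ)).congr (ae_of_all _ fun z => ?_)
      dsimp only
      rw [mul_inv, Complex.ofReal_mul, mul_assoc])
  have h2 := key (fun t a => t ^ (-(3 / 2) : ℝ) * Real.exp (-(Real.pi * a ^ 2 / t)))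
    (fun a => a⁻¹) Θ (fun t a ht => by positivity) (by fun_prop)
    (fun a ha => integral_rpow_mul_exp_neg_pi_div ha) (fun a ha => by positivity)
    hΘ.aestronglyMeasurable hΘ'
  have h3 : ∫ z, (((Real.pi * ‖z‖ ^ 2)⁻¹ : ℝ) : ℂ) * 𝓕 Θ z =
      ((Real.pi⁻¹ : ℝ) : ℂ) * ∫ z, (((‖z‖ ^ 2)⁻¹ : ℝ) : ℂ) * 𝓕 Θ z := by
    rw [← integral_const_mul]
    refine integral_congr_ae (ae_of_all _ fun z => ?_)
    dsimp only
    rw [mul_inv, Complex.ofReal_mul, mul_assoc]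
  rw [← h2, ← setIntegral_congr_fun measurableSet_Ioi
    (fun t ht => integral_gaussian_mul_fourier hΘ ht), h1, h3, ← mul_assoc, ← Complex.ofReal_mul,
    mul_inv_cancel₀ Real.pi_pos.ne', Complex.ofReal_one, one_mul]

theorem integrable_inv_norm_sq_mul {g : E → ℂ} (hg : Continuous g) (hgi : Integrable g) (y : E) :
    Integrable fun z => (((‖y - z‖ ^ 2)⁻¹ : ℝ) : ℂ) * g z := by
  refine (integrable_mul_inv_norm_sq hg.norm hgi.norm y).mono' ?_ (ae_of_all _ fun z => ?_)
  · exact ((Complex.measurable_ofReal.comp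
      (by fun_prop : Measurable fun z : E => (‖y - z‖ ^ 2)⁻¹)).aestronglyMeasurable).mul
      hg.aestronglyMeasurable
  · rw [norm_mul, Complex.norm_real, Real.norm_of_nonneg (by positivity), mul_comm]

theorem fourier_char_smul (Θ : E → ℂ) (y w : E) :
    𝓕 (fun ξ => Complex.exp ((2 * Real.pi * inner ℝ ξ y : ℝ) * Complex.I) * Θ ξ) w =
      𝓕⁻ Θ (y - w) := by
  rw [Real.fourier_eq', Real.fourierInv_eq']
  congr 1
  funext v
  rw [smul_eq_mul, smul_eq_mul, ← mul_assoc, ← Complex.exp_add, inner_sub_right]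
  congr 2
  push_cast
  ring

theorem integrable_char_mul {Θ : E → ℂ} (hΘ : Integrable Θ) (y : E) :
    Integrable fun ξ => Complex.exp ((2 * Real.pi * inner ℝ ξ y : ℝ) * Complex.I) * Θ ξ := by
  refine hΘ.norm.mono' (AEStronglyMeasurable.mul ?_ hΘ.aestronglyMeasurable)
    (ae_of_all _ fun ξ => ?_)
  · exact (by fun_prop : Continuous fun ξ : E =>
      Complex.exp ((2 * Real.pi * inner ℝ ξ y : ℝ) * Complex.I)).aestronglyMeasurable
  · rw [norm_mul, Complex.norm_exp_ofReal_mul_I, one_mul]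

theorem contDiff_inv_norm_mul {Θ : E → ℂ} (hΘ : ContDiff ℝ ∞ Θ) (h0 : ∀ᶠ ξ in 𝓝 0, Θ ξ = 0) :
    ContDiff ℝ ∞ fun ξ => (((2 * Real.pi * ‖ξ‖)⁻¹ : ℝ) : ℂ) * Θ ξ := by
  rw [contDiff_iff_contDiffAt]
  intro ξ
  by_cases hξ : ξ = 0
  · subst hξ
    refine contDiffAt_const (c := (0 : ℂ)) |>.congr_of_eventuallyEq ?_
    filter_upwards [h0] with η hη
    rw [hη, mul_zero]
  · have h1 : ContDiffAt ℝ ∞ (fun ξ : E => (2 * Real.pi * ‖ξ‖)⁻¹) ξ :=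
      (contDiffAt_const.mul (contDiffAt_norm ℝ hξ)).inv (by
        have := Real.pi_pos
        positivity)
    exact (Complex.ofRealCLM.contDiff.contDiffAt.comp ξ h1).mul hΘ.contDiffAt

/-- A Schwartz function whose half-Laplacian is the given function with frequencies supported away
from the origin; it is reproduced by the Riesz potential. -/
theorem exists_schwartzMap_riesz {Θ : E → ℂ} (hΘ : ContDiff ℝ ∞ Θ) (hs : HasCompactSupport Θ)
    (h0 : ∀ᶠ ξ in 𝓝 0, Θ ξ = 0) :
    ∃ φ : 𝓢(E, ℂ), 𝓕⁻ (fun ξ : E => ((2 * Real.pi * ‖ξ‖ : ℝ) : ℂ) * 𝓕 (φ : E → ℂ) ξ) = 𝓕⁻ Θ ∧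
      ∀ y, ∫ z, (((‖y - z‖ ^ 2)⁻¹ : ℝ) : ℂ) * 𝓕⁻ Θ z = 2 * Real.pi ^ 2 * φ y := by
  -- Dividing by the symbol keeps the function smooth because `Θ` vanishes near the origin, the only
  -- place where `|ξ|` is not smooth.
  set θ : E → ℂ := fun ξ => (((2 * Real.pi * ‖ξ‖)⁻¹ : ℝ) : ℂ) * Θ ξ with hθ
  have hθs : HasCompactSupport θ := hs.mul_left
  have hθc : ContDiff ℝ ∞ θ := contDiff_inv_norm_mul hΘ h0
  set θS : 𝓢(E, ℂ) := hθs.toSchwartzMap hθc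
  set ΘS : 𝓢(E, ℂ) := hs.toSchwartzMap hΘ
  have hΘ0 : Θ 0 = 0 := h0.self_of_nhds
  refine ⟨𝓕⁻ θS, ?_, fun y => ?_⟩
  · congr 1
    funext ξ
    have h1 : 𝓕 ((𝓕⁻ θS : 𝓢(E, ℂ)) : E → ℂ) ξ = θ ξ := by
      rw [← SchwartzMap.fourier_coe, FourierTransform.fourier_fourierInv_eq]; rfl
    rw [h1, hθ]
    dsimp only
    rw [← mul_assoc, ← Complex.ofReal_mul]
    by_cases hξ : ξ = 0
    · rw [hξ, hΘ0]; simp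
    · have := Real.pi_pos
      rw [mul_inv_cancel₀ (by positivity), Complex.ofReal_one, one_mul]
  · have hΘi : Integrable Θ := ΘS.integrable
    have hψ : ((𝓕⁻ ΘS : 𝓢(E, ℂ)) : E → ℂ) = 𝓕⁻ Θ := SchwartzMap.fourierInv_coe ΘS
    have hψc : Continuous (𝓕⁻ Θ) := hψ ▸ (𝓕⁻ ΘS).continuous
    have hψi : Integrable (𝓕⁻ Θ) := hψ ▸ (𝓕⁻ ΘS).integrable
    have e1 : ∀ ξ, ((‖ξ‖⁻¹ : ℝ) : ℂ) *
        (Complex.exp ((2 * Real.pi * inner ℝ ξ y : ℝ) * Complex.I) * Θ ξ) =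
        (2 * Real.pi : ℂ) *
          (Complex.exp ((2 * Real.pi * inner ℝ ξ y : ℝ) * Complex.I) * θ ξ) := by
      intro ξ
      have : (Real.pi : ℂ) ≠ 0 := by exact_mod_cast Real.pi_pos.ne'
      rw [hθ]
      dsimp only
      by_cases hξ : ‖ξ‖ = 0
      · simp [hξ]
      · have : (‖ξ‖ : ℂ) ≠ 0 := by exact_mod_cast hξ
        push_cast
        field_simp
    -- Modulation by a character moves the centre of the kernel to `y`. The constant `2π²` is `π`
    -- from the transform times `2π` from the symbol.
    have h1 := integral_inv_norm_sq_mul_fourier (integrable_char_mul hΘi y)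
      (by
        simp_rw [e1]
        exact (integrable_char_mul θS.integrable y).const_mul _)
      (by
        simp_rw [fourier_char_smul]
        have := (integrable_inv_norm_sq_mul hψc hψi y).comp_sub_left y
        simpa using this)
    simp_rw [fourier_char_smul, e1] at h1
    rw [integral_const_mul] at h1
    have h2 : ((𝓕⁻ θS : 𝓢(E, ℂ)) : E → ℂ) y =
        ∫ ξ, Complex.exp ((2 * Real.pi * inner ℝ ξ y : ℝ) * Complex.I) * θ ξ := by
      rw [SchwartzMap.fourierInv_coe, Real.fourierInv_eq']
      rfl
    rw [h2]
    rw [← integral_sub_left_eq_self _ volume y]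
    simp only [sub_sub_cancel]
    rw [h1]
    ring

end RieszFourier

/-! ### Pairing the Riesz potential with bounded integrable functions -/

section RieszDuality

variable {E : Type*} [NormedAddCommGroup E] [InnerProductSpace ℝ E] [FiniteDimensional ℝ E]
  [MeasurableSpace E] [BorelSpace E] [hE : Fact (Module.finrank ℝ E = 3)] {f : E → ℝ}

theorem integral_inv_norm_sq_mul_norm_le {ψ : E → ℂ} (hψ : Continuous ψ) (hψi : Integrable ψ)
    {M : ℝ} (hM : ∀ z, ‖ψ z‖ ≤ M) (y : E) :
    ∫ z, ‖(((‖y - z‖ ^ 2)⁻¹ : ℝ) : ℂ) * ψ z‖ ≤ 2 * (∫ z, ‖ψ z‖) +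
      M * ∫ z, (Metric.ball (0 : E) 1).indicator (fun z : E => (‖z‖ ^ 2)⁻¹) z := by
  have hJ := integrable_indicator_inv_norm_sq (E := E)
  rw [← integral_sub_left_eq_self
    ((Metric.ball (0 : E) 1).indicator fun z : E => (‖z‖ ^ 2)⁻¹) volume y, ← integral_const_mul, ← integral_const_mul,
    ← integral_add (hψi.norm.const_mul 2) ((hJ.comp_sub_left y).const_mul M)]
  refine integral_mono (integrable_inv_norm_sq_mul hψ hψi y).norm
    ((hψi.norm.const_mul 2).add ((hJ.comp_sub_left y).const_mul M)) fun z => ?_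
  have h1 := one_add_inv_norm_sq_le (y - z)
  have h2 : 0 ≤ (Metric.ball (0 : E) 1).indicator (fun z : E => (‖z‖ ^ 2)⁻¹) (y - z) :=
    Set.indicator_nonneg (fun _ _ => by positivity) _
  dsimp only
  rw [norm_mul, Complex.norm_real, Real.norm_of_nonneg (by positivity)]
  nlinarith [hM z, norm_nonneg (ψ z)]

theorem integrable_prod_riesz (hf : Continuous f) (hfi : Integrable f) {ψ : E → ℂ}
    (hψ : Continuous ψ) (hψi : Integrable ψ) {M : ℝ} (hM : ∀ z, ‖ψ z‖ ≤ M) :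
    Integrable (fun q : E × E => (f q.1 : ℂ) * ((((‖q.1 - q.2‖ ^ 2)⁻¹ : ℝ) : ℂ) * ψ q.2))
      (volume.prod volume) := by
  have hmeas : AEStronglyMeasurable (fun q : E × E =>
      (f q.1 : ℂ) * ((((‖q.1 - q.2‖ ^ 2)⁻¹ : ℝ) : ℂ) * ψ q.2)) (volume.prod volume) := by
    refine ((Complex.continuous_ofReal.comp
      (hf.comp continuous_fst)).aestronglyMeasurable).mul (AEStronglyMeasurable.mul ?_
      (hψ.comp continuous_snd).aestronglyMeasurable)
    exact (Complex.measurable_ofReal.comp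
      (by fun_prop : Measurable fun q : E × E => (‖q.1 - q.2‖ ^ 2)⁻¹)).aestronglyMeasurable
  rw [integrable_prod_iff hmeas]
  refine ⟨ae_of_all _ fun y => (integrable_inv_norm_sq_mul hψ hψi y).const_mul (f y : ℂ), ?_⟩
  refine (hfi.norm.mul_const (2 * (∫ z, ‖ψ z‖) +
      M * ∫ z, (Metric.ball (0 : E) 1).indicator (fun z : E => (‖z‖ ^ 2)⁻¹) z)).mono'
    hmeas.norm.integral_prod_right' (ae_of_all _ fun y => ?_)
  dsimp only
  rw [Real.norm_of_nonneg (integral_nonneg fun _ => norm_nonneg _)]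
  simp_rw [norm_mul (f y : ℂ)]
  rw [integral_const_mul, Complex.norm_real]
  exact mul_le_mul_of_nonneg_left (integral_inv_norm_sq_mul_norm_le hψ hψi hM y) (norm_nonneg _)

theorem ofReal_rieszPot_mul (z : E) (w : ℂ) : (rieszPot f z : ℂ) * w =
    ∫ y, (f y : ℂ) * ((((‖y - z‖ ^ 2)⁻¹ : ℝ) : ℂ) * w) := by
  rw [rieszPot, ← integral_complex_ofReal, ← integral_mul_const]
  refine integral_congr_ae (ae_of_all _ fun y => ?_)
  dsimp only
  rw [Complex.ofReal_mul, mul_assoc, norm_sub_rev]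

theorem integrable_rieszPot_mul (hf : Continuous f) (hfi : Integrable f) {ψ : E → ℂ}
    (hψ : Continuous ψ) (hψi : Integrable ψ) {M : ℝ} (hM : ∀ z, ‖ψ z‖ ≤ M) :
    Integrable fun z => (rieszPot f z : ℂ) * ψ z := by
  simp_rw [ofReal_rieszPot_mul]
  exact (integrable_prod_riesz hf hfi hψ hψi hM).integral_prod_right

theorem integral_rieszPot_mul (hf : Continuous f) (hfi : Integrable f) {ψ : E → ℂ}
    (hψ : Continuous ψ) (hψi : Integrable ψ) {M : ℝ} (hM : ∀ z, ‖ψ z‖ ≤ M) :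
    ∫ z, (rieszPot f z : ℂ) * ψ z = ∫ y, (f y : ℂ) * ∫ z, (((‖y - z‖ ^ 2)⁻¹ : ℝ) : ℂ) * ψ z := by
  simp_rw [ofReal_rieszPot_mul, ← integral_const_mul]
  exact (integral_integral_swap (f := fun y z =>
    (f y : ℂ) * ((((‖y - z‖ ^ 2)⁻¹ : ℝ) : ℂ) * ψ z)) (integrable_prod_riesz hf hfi hψ hψi hM)).symm

theorem continuous_inv_one_add_norm_pow : Continuous fun x : E => (1 + ‖x‖ ^ 4)⁻¹ :=
  Continuous.inv₀ (by fun_prop) fun x => by positivity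

theorem integrable_inv_one_add_norm_pow : Integrable fun x : E => (1 + ‖x‖ ^ 4)⁻¹ := by
  have h := (integrable_one_add_norm (E := E) (μ := volume) (r := 4)
    (by rw [hE.out]; norm_num)).const_mul 8
  refine h.mono' continuous_inv_one_add_norm_pow.aestronglyMeasurable (ae_of_all _ fun x => ?_)
  rw [Real.norm_of_nonneg (by positivity), Real.rpow_neg (by positivity), ← div_eq_mul_inv,
    inv_le_comm₀ (by positivity) (by positivity), inv_div,
    div_le_iff₀ (by norm_num)]
  norm_cast
  have h0 := norm_nonneg x
  nlinarith [sq_nonneg (‖x‖ ^ 2 - 1), sq_nonneg (‖x‖ - 1), sq_nonneg (‖x‖ ^ 2 - ‖x‖),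
    mul_nonneg h0 (sq_nonneg (‖x‖ - 1))]

/-- The weight is itself bounded and integrable, so it may be used as the test function. -/
theorem integrable_rieszPot_div (hf : Continuous f) (hfi : Integrable f) :
    Integrable fun x => rieszPot f x * (1 + ‖x‖ ^ 4)⁻¹ := by
  have h := integrable_rieszPot_mul hf hfi (ψ := fun x => (((1 + ‖x‖ ^ 4)⁻¹ : ℝ) : ℂ)) (M := 1)
    (Complex.continuous_ofReal.comp continuous_inv_one_add_norm_pow)
    integrable_inv_one_add_norm_pow.ofReal (fun z => by
      rw [Complex.norm_real, Real.norm_of_nonneg (by positivity)]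
      exact inv_le_one_of_one_le₀ (by linarith [pow_nonneg (norm_nonneg z) 4]))
  refine h.re.congr (ae_of_all _ fun x => ?_)
  simp only [← Complex.ofReal_mul]
  exact Complex.ofReal_re _

end RieszDuality

/-! ### Liouville's theorem for `(-Δ)^{1/2}` by band-limited mollifiers -/

section HalfLaplacianLiouville

variable {E : Type*} [NormedAddCommGroup E] [InnerProductSpace ℝ E] [FiniteDimensional ℝ E]
  [MeasurableSpace E] [BorelSpace E] [hE : Fact (Module.finrank ℝ E = 3)]

/-- The smooth frequency cutoff, as a complex-valued Schwartz function. -/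
noncomputable def freqBump (E : Type*) [NormedAddCommGroup E] [InnerProductSpace ℝ E]
    [FiniteDimensional ℝ E] : 𝓢(E, ℂ) :=
  HasCompactSupport.toSchwartzMap (f := fun ξ : E => (radialBump ξ : ℂ))
    (hasCompactSupport_radialBump.comp_left Complex.ofReal_zero)
    (Complex.ofRealCLM.contDiff.comp contDiff_radialBump)

theorem freqBump_apply (ξ : E) : freqBump E ξ = (radialBump ξ : ℂ) := rfl

/-- The Schwartz mollifier of integral one whose Fourier transform is a bump function. -/
noncomputable def mollifier (E : Type*) [NormedAddCommGroup E] [InnerProductSpace ℝ E]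
    [FiniteDimensional ℝ E] [MeasurableSpace E] [BorelSpace E] : 𝓢(E, ℂ) := 𝓕⁻ (freqBump E)

/-- The mollifier at scale `l⁻¹` centred at `x`. -/
noncomputable def scaledMollifier (l : ℝ) (x y : E) : ℂ := (l : ℂ) ^ 3 * mollifier E (l • (y - x))

/-- The Fourier transform of the scaled mollifier. -/
noncomputable def scaledFreqBump (l : ℝ) (x ξ : E) : ℂ :=
  Complex.exp ((-(2 * Real.pi * inner ℝ ξ x) : ℝ) * Complex.I) * freqBump E (l⁻¹ • ξ)

theorem integral_mollifier : ∫ y, mollifier E y = 1 := by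
  have h : 𝓕 ((mollifier E : 𝓢(E, ℂ)) : E → ℂ) 0 = 1 := by
    rw [mollifier, ← SchwartzMap.fourier_coe, FourierTransform.fourier_fourierInv_eq,
      freqBump_apply, radialBump_eq_one (by simp)]
    simp
  rw [Real.fourier_eq'] at h
  simpa using h

theorem integral_comp_smul_sub {F : Type*} [NormedAddCommGroup F] [NormedSpace ℝ F] (g : E → F)
    {l : ℝ} (hl : 0 < l) (x : E) : ∫ y, g (l • (y - x)) = (l ^ 3)⁻¹ • ∫ y, g y := by
  rw [integral_sub_right_eq_self (fun y => g (l • y)) x,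
    Measure.integral_comp_smul_of_nonneg _ _ _ (hR := hl.le), hE.out]

theorem integral_scaledMollifier {l : ℝ} (hl : 0 < l) (x : E) :
    ∫ y, scaledMollifier l x y = 1 := by
  simp only [scaledMollifier]
  rw [integral_const_mul, integral_comp_smul_sub _ hl, integral_mollifier]
  have : (l : ℂ) ≠ 0 := by exact_mod_cast hl.ne'
  rw [Complex.real_smul]
  push_cast
  field_simp

theorem integral_norm_scaledMollifier {l : ℝ} (hl : 0 < l) (x : E) :
    ∫ y, ‖scaledMollifier l x y‖ = ∫ y, ‖mollifier E y‖ := by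
  simp only [scaledMollifier, norm_mul, norm_pow, Complex.norm_real, Real.norm_of_nonneg hl.le]
  rw [integral_const_mul, integral_comp_smul_sub (fun y => ‖mollifier E y‖) hl, smul_eq_mul]
  field_simp

theorem continuous_scaledMollifier (l : ℝ) (x : E) : Continuous (scaledMollifier l x) :=
  continuous_const.mul ((mollifier E).continuous.comp (by fun_prop))

theorem contDiff_scaledFreqBump (l : ℝ) (x : E) : ContDiff ℝ ∞ (scaledFreqBump l x) := by
  have h1 : ContDiff ℝ ∞ fun ξ : E => -(2 * Real.pi * inner ℝ ξ x) :=
    (contDiff_const.mul (contDiff_id.inner ℝ contDiff_const)).neg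
  have h2 : ContDiff ℝ ∞ fun ξ : E => freqBump E (l⁻¹ • ξ) :=
    ((freqBump E).smooth ⊤).comp (contDiff_const_smul l⁻¹)
  exact (((Complex.ofRealCLM.contDiff.comp h1).mul contDiff_const).cexp).mul h2

theorem scaledFreqBump_eq_zero {l : ℝ} (hl : 0 < l) (x : E) {ξ : E} (hξ : 2 * l < ‖ξ‖) :
    scaledFreqBump l x ξ = 0 := by
  rw [scaledFreqBump, freqBump_apply, radialBump_eq_zero]
  · simp
  · rw [norm_smul, Real.norm_of_nonneg (by positivity), lt_inv_mul_iff₀ hl]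
    linarith

theorem scaledFreqBump_eq_char {l : ℝ} (hl : 0 < l) (x : E) {ξ : E} (hξ : ‖ξ‖ ≤ l) :
    scaledFreqBump l x ξ = Complex.exp ((-(2 * Real.pi * inner ℝ ξ x) : ℝ) * Complex.I) := by
  rw [scaledFreqBump, freqBump_apply, radialBump_eq_one]
  · simp
  · rw [norm_smul, Real.norm_of_nonneg (by positivity), inv_mul_le_iff₀ hl]
    linarith

theorem integrable_scaledFreqBump {l : ℝ} (hl : 0 < l) (x : E) :
    Integrable (scaledFreqBump l x) :=
  (contDiff_scaledFreqBump l x).continuous.integrable_of_hasCompactSupport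
    (hasCompactSupport_of_eq_zero_of_lt_norm fun _ => scaledFreqBump_eq_zero hl x)

theorem fourierInv_scaledFreqBump {l : ℝ} (hl : 0 < l) (x y : E) :
    𝓕⁻ (scaledFreqBump l x) y = scaledMollifier l x y := by
  rw [Real.fourierInv_eq', scaledMollifier, mollifier, SchwartzMap.fourierInv_coe,
    Real.fourierInv_eq']
  have h := Measure.integral_comp_inv_smul_of_nonneg (volume : Measure E) (fun ζ : E =>
    Complex.exp ((2 * Real.pi * inner ℝ ζ (l • (y - x)) : ℝ) * Complex.I) • freqBump E ζ) hl.le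
  rw [hE.out, Complex.real_smul, Complex.ofReal_pow] at h
  rw [← h]
  refine integral_congr_ae (ae_of_all _ fun ξ => ?_)
  simp only [scaledFreqBump, smul_eq_mul]
  rw [← mul_assoc, ← Complex.exp_add, inner_smul_left, inner_smul_right, inner_sub_right]
  congr 2
  have : (l : ℂ) ≠ 0 := by exact_mod_cast hl.ne'
  simp
  field_simp
  ring

theorem exists_decay_schwartz (η : 𝓢(E, ℂ)) :
    ∃ C : ℝ, 0 ≤ C ∧ (∀ z, (1 + ‖z‖) ^ 4 * ‖η z‖ ≤ C) ∧
      ∀ z, (1 + ‖z‖) ^ 4 * ‖fderiv ℝ η z‖ ≤ C := by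
  have h0 := fun z => SchwartzMap.one_add_le_sup_seminorm_apply (𝕜 := ℝ) (m := (4, 1)) (k := 4)
    (n := 0) le_rfl zero_le_one η z
  have h1 := fun z => SchwartzMap.one_add_le_sup_seminorm_apply (𝕜 := ℝ) (m := (4, 1)) (k := 4)
    (n := 1) le_rfl le_rfl η z
  refine ⟨_, le_trans (by positivity) (h0 0), fun z => ?_, fun z => ?_⟩
  · simpa only [norm_iteratedFDeriv_zero] using h0 z
  · simpa only [norm_iteratedFDeriv_one] using h1 z

theorem one_add_norm_pow_le (y : E) : 1 + ‖y‖ ^ 4 ≤ (1 + ‖y‖) ^ 4 := by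
  have h := norm_nonneg y
  nlinarith [pow_nonneg h 2, pow_nonneg h 3]

theorem one_add_norm_le_mul (x y : E) : 1 + ‖y‖ ≤ (1 + ‖x‖) * (1 + ‖y - x‖) := by
  have h1 := norm_sub_norm_le y x
  nlinarith [norm_nonneg x, norm_nonneg (y - x), mul_nonneg (norm_nonneg x) (norm_nonneg (y - x))]

theorem exists_scaledMollifier_le {l : ℝ} (hl : 0 < l) (x : E) :
    ∃ C : ℝ, ∀ y, ‖scaledMollifier l x y‖ ≤ C * (1 + ‖y‖ ^ 4)⁻¹ := by
  obtain ⟨C, hC, h0, -⟩ := exists_decay_schwartz (mollifier E)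
  refine ⟨l ^ 3 * (((1 + ‖x‖) * (1 + l⁻¹)) ^ 4 * C), fun y => ?_⟩
  rw [← div_eq_mul_inv, le_div_iff₀ (by positivity), scaledMollifier, norm_mul, norm_pow,
    Complex.norm_real, Real.norm_of_nonneg hl.le, mul_assoc]
  refine mul_le_mul_of_nonneg_left ?_ (by positivity)
  have h1 : 1 + ‖y‖ ≤ ((1 + ‖x‖) * (1 + l⁻¹)) * (1 + ‖l • (y - x)‖) := by
    refine (one_add_norm_le_mul x y).trans ?_
    rw [mul_assoc]
    gcongr
    rw [norm_smul, Real.norm_of_nonneg hl.le]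
    have h2 : (1 + l⁻¹) * (1 + l * ‖y - x‖) = 1 + l⁻¹ + l * ‖y - x‖ + ‖y - x‖ := by
      field_simp; ring
    rw [h2]
    have : 0 ≤ l⁻¹ + l * ‖y - x‖ := by positivity
    linarith
  calc ‖mollifier E (l • (y - x))‖ * (1 + ‖y‖ ^ 4)
      ≤ ‖mollifier E (l • (y - x))‖ * (((1 + ‖x‖) * (1 + l⁻¹)) * (1 + ‖l • (y - x)‖)) ^ 4 := by
        gcongr
        exact (one_add_norm_pow_le y).trans (by gcongr)
    _ = ((1 + ‖x‖) * (1 + l⁻¹)) ^ 4 *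
        ((1 + ‖l • (y - x)‖) ^ 4 * ‖mollifier E (l • (y - x))‖) := by ring
    _ ≤ _ := mul_le_mul_of_nonneg_left (h0 _) (by positivity)

variable {g : E → ℝ}

theorem integrable_mul_scaledMollifier (hg : Continuous g)
    (hgi : Integrable fun x => g x * (1 + ‖x‖ ^ 4)⁻¹) {l : ℝ} (hl : 0 < l) (x : E) :
    Integrable fun y => (g y : ℂ) * scaledMollifier l x y := by
  obtain ⟨C, hC⟩ := exists_scaledMollifier_le hl x
  refine (hgi.norm.const_mul C).mono' ((Complex.continuous_ofReal.comp hg).mul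
    (continuous_scaledMollifier l x)).aestronglyMeasurable (ae_of_all _ fun y => ?_)
  rw [norm_mul, Complex.norm_real, norm_mul,
    Real.norm_of_nonneg (by positivity : 0 ≤ (1 + ‖y‖ ^ 4)⁻¹)]
  calc _ ≤ ‖g y‖ * (C * (1 + ‖y‖ ^ 4)⁻¹) := by gcongr; exact hC y
    _ = _ := by ring

/-- Four powers of decay against the normalization `l³` leave the gain `l⁻¹`, with the weight `(1 +
|y|⁴)⁻¹` to spare. -/
theorem scaledMollifier_far_le {C : ℝ} (hC : ∀ z, (1 + ‖z‖) ^ 4 * ‖mollifier E z‖ ≤ C)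
    {l δ : ℝ} (hl : 0 < l) (hδ : 0 < δ) {x y : E} (hxy : δ ≤ ‖y - x‖) :
    ‖scaledMollifier l x y‖ ≤ l⁻¹ * (C * ((1 + ‖x‖) * (1 + δ⁻¹)) ^ 4) * (1 + ‖y‖ ^ 4)⁻¹ := by
  have h0 : 0 < ‖y - x‖ := hδ.trans_le hxy
  rw [← div_eq_mul_inv, le_div_iff₀ (by positivity), scaledMollifier, norm_mul, norm_pow,
    Complex.norm_real, Real.norm_of_nonneg hl.le]
  have h1 : 1 + ‖y‖ ≤ ((1 + ‖x‖) * (1 + δ⁻¹)) * ‖y - x‖ := by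
    refine (one_add_norm_le_mul x y).trans ?_
    rw [mul_assoc]
    gcongr
    have : 1 ≤ δ⁻¹ * ‖y - x‖ := by rw [le_inv_mul_iff₀ hδ]; linarith
    linarith
  have h2 : (l * ‖y - x‖) ^ 4 * ‖mollifier E (l • (y - x))‖ ≤ C := by
    refine le_trans ?_ (hC (l • (y - x)))
    gcongr
    rw [norm_smul, Real.norm_of_nonneg hl.le]
    linarith
  calc l ^ 3 * ‖mollifier E (l • (y - x))‖ * (1 + ‖y‖ ^ 4)
      ≤ l ^ 3 * ‖mollifier E (l • (y - x))‖ * (((1 + ‖x‖) * (1 + δ⁻¹)) * ‖y - x‖) ^ 4 := by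
        gcongr
        exact (one_add_norm_pow_le y).trans (by gcongr)
    _ = l⁻¹ * (((l * ‖y - x‖) ^ 4 * ‖mollifier E (l • (y - x))‖) *
        ((1 + ‖x‖) * (1 + δ⁻¹)) ^ 4) := by field_simp
    _ ≤ _ := by gcongr

theorem norm_integral_mul_scaledMollifier_sub_le (hg : Continuous g)
    (hgi : Integrable fun x => g x * (1 + ‖x‖ ^ 4)⁻¹) (x : E) {e : ℝ} (he : 0 < e) :
    ∃ B : ℝ, ∀ l : ℝ, 0 < l → ‖(∫ y, (g y : ℂ) * scaledMollifier l x y) - g x‖ ≤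
      e * (∫ y, ‖mollifier E y‖) + B * l⁻¹ := by
  obtain ⟨C, -, hC, -⟩ := exists_decay_schwartz (mollifier E)
  obtain ⟨δ, hδ, hgδ⟩ := Metric.continuous_iff.mp hg x e he
  set K := C * ((1 + ‖x‖) * (1 + δ⁻¹)) ^ 4
  have hKi : Integrable fun y : E => (g y - g x) * (1 + ‖y‖ ^ 4)⁻¹ := by
    exact (hgi.sub (integrable_inv_one_add_norm_pow.const_mul (g x))).congr
      (ae_of_all _ fun y => by simp [sub_mul])
  refine ⟨K * ∫ y, ‖(g y - g x) * (1 + ‖y‖ ^ 4)⁻¹‖, fun l hl => ?_⟩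
  have hmi : Integrable (scaledMollifier l x) := by
    obtain ⟨C, hC⟩ := exists_scaledMollifier_le hl x
    exact (integrable_inv_one_add_norm_pow.const_mul C).mono'
      (continuous_scaledMollifier l x).aestronglyMeasurable (ae_of_all _ hC)
  have h1 : (∫ y, (g y : ℂ) * scaledMollifier l x y) - g x =
      ∫ y, ((g y - g x : ℝ) : ℂ) * scaledMollifier l x y := by
    have h2 : (g x : ℂ) = ∫ y, (g x : ℂ) * scaledMollifier l x y := by
      rw [integral_const_mul, integral_scaledMollifier hl, mul_one]
    rw [h2, ← integral_sub (integrable_mul_scaledMollifier hg hgi hl x) (hmi.const_mul _)]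
    refine integral_congr_ae (ae_of_all _ fun y => ?_)
    dsimp only
    push_cast
    ring
  rw [h1]
  have hbi : Integrable fun y => e * ‖scaledMollifier l x y‖ +
      l⁻¹ * K * ‖(g y - g x) * (1 + ‖y‖ ^ 4)⁻¹‖ :=
    (hmi.norm.const_mul e).add (hKi.norm.const_mul _)
  refine (norm_integral_le_of_norm_le hbi (ae_of_all _ fun y => ?_)).trans (le_of_eq ?_)
  · rw [norm_mul, Complex.norm_real]
    have n1 : 0 ≤ l⁻¹ * K * ‖(g y - g x) * (1 + ‖y‖ ^ 4)⁻¹‖ := by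
      have : 0 ≤ C := le_trans (by positivity) (hC 0)
      positivity
    by_cases hy : ‖y - x‖ < δ
    · have h3 := hgδ y (by rwa [dist_eq_norm])
      rw [dist_eq_norm] at h3
      have := mul_le_mul_of_nonneg_right h3.le (norm_nonneg (scaledMollifier l x y))
      linarith
    · have h3 := scaledMollifier_far_le hC hl hδ (not_lt.mp hy)
      have h4 := mul_le_mul_of_nonneg_left h3 (norm_nonneg (g y - g x))
      have h5 : ‖g y - g x‖ * (l⁻¹ * K * (1 + ‖y‖ ^ 4)⁻¹) =
          l⁻¹ * K * ‖(g y - g x) * (1 + ‖y‖ ^ 4)⁻¹‖ := by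
        rw [norm_mul, Real.norm_of_nonneg (by positivity : 0 ≤ (1 + ‖y‖ ^ 4)⁻¹)]; ring
      have n2 : 0 ≤ e * ‖scaledMollifier l x y‖ := by positivity
      linarith
  · rw [integral_add (hmi.norm.const_mul e) (hKi.norm.const_mul _), integral_const_mul,
      integral_const_mul, integral_norm_scaledMollifier hl]
    ring

/-- Both bounds serve dominated convergence as `l → 0`: the first is the majorant, the second the
pointwise limit. The mean value theorem supplies a factor `l⁴`, which decay of the gradient in the
scaled variable trades for the weight in `y`. -/
theorem norm_scaledMollifier_sub_le {C : ℝ} (hC0 : 0 ≤ C)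
    (hC : ∀ z, (1 + ‖z‖) ^ 4 * ‖fderiv ℝ (mollifier E) z‖ ≤ C) {l : ℝ} (hl : 0 < l) (hl1 : l ≤ 1)
    (x y : E) : ‖scaledMollifier l x y - scaledMollifier l 0 y‖ ≤
      C * ‖x‖ * (1 + ‖x‖) ^ 4 * (1 + ‖y‖ ^ 4)⁻¹ ∧
      ‖scaledMollifier l x y - scaledMollifier l 0 y‖ ≤ C * ‖x‖ * l ^ 4 := by
  have hseg : ∀ z ∈ segment ℝ (l • y) (l • (y - x)), l * (1 + ‖y‖) ≤ (1 + ‖x‖) * (1 + ‖z‖) := by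
    intro z hz
    rw [segment_eq_image'] at hz
    obtain ⟨s, hs, rfl⟩ := hz
    dsimp only
    have h1 : l • y + s • (l • (y - x) - l • y) = l • (y - s • x) := by
      module
    rw [h1, norm_smul, Real.norm_of_nonneg hl.le]
    have h2 : ‖y‖ ≤ ‖y - s • x‖ + ‖x‖ := by
      have h3 := norm_sub_norm_le y (s • x)
      rw [norm_smul, Real.norm_of_nonneg hs.1] at h3
      nlinarith [hs.2, norm_nonneg x]
    nlinarith [norm_nonneg x, norm_nonneg (y - s • x), mul_le_mul_of_nonneg_left h2 hl.le,
      mul_nonneg (norm_nonneg x) (mul_nonneg hl.le (norm_nonneg (y - s • x)))]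
  have hmv : ∀ D : ℝ, (∀ z ∈ segment ℝ (l • y) (l • (y - x)), ‖fderiv ℝ (mollifier E) z‖ ≤ D) →
      ‖scaledMollifier l x y - scaledMollifier l 0 y‖ ≤ l ^ 3 * (D * (l * ‖x‖)) := by
    intro D hD
    have h1 := (convex_segment (𝕜 := ℝ) (l • y) (l • (y - x))).norm_image_sub_le_of_norm_fderiv_le
      (𝕜 := ℝ) (f := mollifier E) (fun z _ => (mollifier E).differentiableAt) hD
      (left_mem_segment ℝ _ _) (right_mem_segment ℝ _ _)
    have h2 : l • (y - x) - l • y = -(l • x) := by module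
    rw [h2, norm_neg, norm_smul, Real.norm_of_nonneg hl.le] at h1
    simp only [scaledMollifier, sub_zero]
    rw [← mul_sub, norm_mul, norm_pow, Complex.norm_real, Real.norm_of_nonneg hl.le]
    gcongr
  constructor
  · refine (hmv (C * ((1 + ‖x‖) ^ 4 * (l * (1 + ‖y‖))⁻¹ ^ 4)) fun z hz => ?_).trans ?_
    · have h1 : 1 ≤ ((1 + ‖x‖) * (l * (1 + ‖y‖))⁻¹) * (1 + ‖z‖) := by
        rw [mul_right_comm, ← div_eq_mul_inv, le_div_iff₀ (by positivity), one_mul]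
        exact hseg z hz
      have h2 := one_le_pow₀ h1 (n := 4)
      calc ‖fderiv ℝ (mollifier E) z‖
          ≤ ‖fderiv ℝ (mollifier E) z‖ * (((1 + ‖x‖) * (l * (1 + ‖y‖))⁻¹) * (1 + ‖z‖)) ^ 4 :=
            le_mul_of_one_le_right (norm_nonneg _) h2
        _ = ((1 + ‖z‖) ^ 4 * ‖fderiv ℝ (mollifier E) z‖) *
            ((1 + ‖x‖) ^ 4 * (l * (1 + ‖y‖))⁻¹ ^ 4) := by ring
        _ ≤ _ := by gcongr; exact hC z
    · have h3 : ((1 + ‖y‖) ^ 4)⁻¹ ≤ (1 + ‖y‖ ^ 4)⁻¹ :=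
        inv_anti₀ (by positivity) (one_add_norm_pow_le y)
      calc _ = C * ‖x‖ * (1 + ‖x‖) ^ 4 * ((1 + ‖y‖) ^ 4)⁻¹ := by field_simp
        _ ≤ _ := by gcongr
  · refine (hmv C fun z _ => ?_).trans (le_of_eq (by ring))
    refine le_trans ?_ (hC z)
    exact le_mul_of_one_le_left (norm_nonneg _)
      (one_le_pow₀ (by linarith [norm_nonneg z]))

/-- Liouville's theorem for the half-Laplacian. -/
theorem eq_of_integral_mul_fourierInv_eq_zero (hg : Continuous g)
    (hgi : Integrable fun x => g x * (1 + ‖x‖ ^ 4)⁻¹)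
    (h : ∀ Θ : E → ℂ, ContDiff ℝ ∞ Θ → HasCompactSupport Θ → (∀ᶠ ξ in 𝓝 0, Θ ξ = 0) →
      ∫ z, (g z : ℂ) * 𝓕⁻ Θ z = 0) (x : E) : g x = g 0 := by
  -- Two frequency cutoffs with the same centre agree near the origin, so their difference is an
  -- admissible `Θ`.
  have hscale : ∀ (x : E) (l m : ℝ), 0 < l → 0 < m →
      ∫ y, (g y : ℂ) * scaledMollifier l x y = ∫ y, (g y : ℂ) * scaledMollifier m x y := by
    intro x l m hl hm
    have h1 := h (fun ξ => scaledFreqBump l x ξ - scaledFreqBump m x ξ)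
      ((contDiff_scaledFreqBump l x).sub (contDiff_scaledFreqBump m x))
      ((hasCompactSupport_of_eq_zero_of_lt_norm fun _ => scaledFreqBump_eq_zero hl x).sub
        (hasCompactSupport_of_eq_zero_of_lt_norm fun _ => scaledFreqBump_eq_zero hm x))
      (by
        filter_upwards [Metric.closedBall_mem_nhds (0 : E) (lt_min hl hm)] with ξ hξ
        rw [mem_closedBall_zero_iff, le_min_iff] at hξ
        rw [scaledFreqBump_eq_char hl x hξ.1, scaledFreqBump_eq_char hm x hξ.2, sub_self])
    have h2 : ∀ y, 𝓕⁻ (fun ξ => scaledFreqBump l x ξ - scaledFreqBump m x ξ) y =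
        scaledMollifier l x y - scaledMollifier m x y := by
      intro y
      rw [← fourierInv_scaledFreqBump hl, ← fourierInv_scaledFreqBump hm,
        Real.fourierInv_eq', Real.fourierInv_eq', Real.fourierInv_eq']
      simp only [smul_eq_mul, mul_sub]
      exact integral_sub (integrable_char_mul (integrable_scaledFreqBump hl x) y)
        (integrable_char_mul (integrable_scaledFreqBump hm x) y)
    simp_rw [h2, mul_sub] at h1
    rw [integral_sub (integrable_mul_scaledMollifier hg hgi hl x)
      (integrable_mul_scaledMollifier hg hgi hm x)] at h1
    exact sub_eq_zero.mp h1
  -- The average is independent of the scale, so it equals its limit under concentration at `x`.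
  have hval : ∀ (x : E) (l : ℝ), 0 < l → ∫ y, (g y : ℂ) * scaledMollifier l x y = g x := by
    intro x l hl
    rw [← sub_eq_zero, ← norm_le_zero_iff]
    have h1 : ∀ e : ℝ, 0 < e → ‖(∫ y, (g y : ℂ) * scaledMollifier l x y) - g x‖ ≤
        e * ∫ y, ‖mollifier E y‖ := by
      intro e he
      obtain ⟨B, hB⟩ := norm_integral_mul_scaledMollifier_sub_le hg hgi x he
      have hlim : Tendsto (fun m : ℝ => e * (∫ y, ‖mollifier E y‖) + B * m⁻¹) atTop
          (𝓝 (e * ∫ y, ‖mollifier E y‖)) := by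
        simpa using (tendsto_inv_atTop_zero.const_mul B).const_add (e * ∫ y, ‖mollifier E y‖)
      refine ge_of_tendsto hlim ((eventually_gt_atTop 0).mono fun m hm => ?_)
      rw [hscale x l m hl hm]
      exact hB m hm
    have hlim : Tendsto (fun e : ℝ => e * ∫ y, ‖mollifier E y‖) (𝓝[>] 0) (𝓝 0) := by
      have : Tendsto (fun e : ℝ => e * ∫ y, ‖mollifier E y‖) (𝓝 0) (𝓝 0) := by
        simpa using (tendsto_id (x := 𝓝 (0 : ℝ))).mul_const (∫ y, ‖mollifier E y‖)
      exact this.mono_left nhdsWithin_le_nhds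
    exact ge_of_tendsto hlim (eventually_mem_nhdsWithin.mono fun e he => h1 e he)
  obtain ⟨C, hC0, -, hC⟩ := exists_decay_schwartz (mollifier E)
  have hdiff : ∀ l : ℝ, 0 < l → ∫ y, (g y : ℂ) * (scaledMollifier l x y - scaledMollifier l 0 y) =
      (g x : ℂ) - g 0 := by
    intro l hl
    simp_rw [mul_sub]
    rw [integral_sub (integrable_mul_scaledMollifier hg hgi hl x)
      (integrable_mul_scaledMollifier hg hgi hl 0), hval x l hl, hval 0 l hl]
  have hmem : ∀ᶠ l : ℝ in 𝓝[>] 0, 0 < l ∧ l ≤ 1 := by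
    filter_upwards [Ioc_mem_nhdsGT one_pos] with l hl using hl
  have hlim : Tendsto (fun l : ℝ =>
      ∫ y, (g y : ℂ) * (scaledMollifier l x y - scaledMollifier l 0 y)) (𝓝[>] 0)
      (𝓝 (∫ _ : E, (0 : ℂ))) := by
    refine tendsto_integral_filter_of_dominated_convergence
      (fun y => (C * ‖x‖ * (1 + ‖x‖) ^ 4) * ‖g y * (1 + ‖y‖ ^ 4)⁻¹‖) ?_ ?_
      (hgi.norm.const_mul _) (ae_of_all _ fun y => ?_)
    · exact Eventually.of_forall fun l => ((Complex.continuous_ofReal.comp hg).mul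
        ((continuous_scaledMollifier l x).sub
          (continuous_scaledMollifier l 0))).aestronglyMeasurable
    · filter_upwards [hmem] with l hl
      refine ae_of_all _ fun y => ?_
      have h1 := (norm_scaledMollifier_sub_le hC0 hC hl.1 hl.2 x y).1
      rw [norm_mul, Complex.norm_real, norm_mul,
        Real.norm_of_nonneg (by positivity : 0 ≤ (1 + ‖y‖ ^ 4)⁻¹)]
      calc _ ≤ ‖g y‖ * (C * ‖x‖ * (1 + ‖x‖) ^ 4 * (1 + ‖y‖ ^ 4)⁻¹) := by gcongr
        _ = _ := by ring
    · have h1 : Tendsto (fun l : ℝ => ‖g y‖ * (C * ‖x‖ * l ^ 4)) (𝓝[>] 0) (𝓝 0) := by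
        have : Tendsto (fun l : ℝ => ‖g y‖ * (C * ‖x‖ * l ^ 4)) (𝓝 0)
            (𝓝 (‖g y‖ * (C * ‖x‖ * 0 ^ 4))) :=
          (by fun_prop : Continuous fun l : ℝ => ‖g y‖ * (C * ‖x‖ * l ^ 4)).tendsto 0
        simp only [ne_eq, OfNat.ofNat_ne_zero, not_false_eq_true, zero_pow, mul_zero] at this
        exact this.mono_left nhdsWithin_le_nhds
      refine squeeze_zero_norm' ?_ h1
      filter_upwards [hmem] with l hl
      rw [norm_mul, Complex.norm_real]
      gcongr
      exact (norm_scaledMollifier_sub_le hC0 hC hl.1 hl.2 x y).2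
  rw [integral_zero] at hlim
  have hconst : Tendsto (fun l : ℝ =>
      ∫ y, (g y : ℂ) * (scaledMollifier l x y - scaledMollifier l 0 y)) (𝓝[>] 0)
      (𝓝 ((g x : ℂ) - g 0)) :=
    tendsto_const_nhds.congr' (hmem.mono fun l hl => (hdiff l hl.1).symm)
  have := tendsto_nhds_unique hconst hlim
  exact_mod_cast sub_eq_zero.mp this

end HalfLaplacianLiouville

/-! ### Behaviour of the logarithmic potential at infinity -/

section LogPotentialAtInfinity

variable {E : Type*} [NormedAddCommGroup E] [InnerProductSpace ℝ E] [FiniteDimensional ℝ E]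

theorem isCountablyGenerated_cocompact : IsCountablyGenerated (cocompact E) := by
  rw [← Metric.cobounded_eq_cocompact, ← comap_norm_atTop]
  infer_instance

theorem eventually_cocompact_iff {P : E → Prop} :
    (∀ᶠ x in cocompact E, P x) ↔ ∃ R : ℝ, ∀ x, R ≤ ‖x‖ → P x := by
  rw [← Metric.cobounded_eq_cocompact, hasBasis_cobounded_norm.eventually_iff]
  simp

theorem tendsto_sub_const_cocompact (z : E) :
    Tendsto (fun x => x - z) (cocompact E) (cocompact E) :=
  (Homeomorph.subRight z).isClosedEmbedding.tendsto_cocompact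

theorem tendsto_log_norm_cocompact :
    Tendsto (fun x : E => Real.log ‖x‖) (cocompact E) atTop :=
  Real.tendsto_log_atTop.comp tendsto_norm_cocompact_atTop

theorem log_one_add_le {r : ℝ} (hr : 2 ≤ r) : Real.log (1 + r) ≤ 2 * Real.log r := by
  rw [← Real.log_rpow (by linarith)]
  refine Real.log_le_log (by linarith) ?_
  norm_cast
  nlinarith

theorem le_one_add_inv_sq_mul {C : ℝ} (hC : 0 ≤ C) {z : E} (hz : z ∉ Metric.ball (0 : E) 1) :
    C * (1 + (‖z‖ ^ 2)⁻¹) ≤ C * 2 := by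
  have h1 : 1 ≤ ‖z‖ := by simpa using hz
  have : (‖z‖ ^ 2)⁻¹ ≤ 1 := inv_le_one_of_one_le₀ (one_le_pow₀ h1)
  gcongr
  linarith

theorem bounded_of_tendsto_zero {f : E → ℝ} (hf : Continuous f)
    (h : Tendsto f (cocompact E) (𝓝 0)) : ∃ B, ∀ x, ‖f x‖ ≤ B := by
  obtain ⟨R, hR⟩ := eventually_cocompact_iff.mp
    (h.norm.eventually (gt_mem_nhds (by simp : ‖(0 : ℝ)‖ < 1)))
  obtain ⟨B, hB⟩ := (isCompact_closedBall (0 : E) R).exists_bound_of_continuousOn hf.continuousOn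
  refine ⟨max B 1, fun x => ?_⟩
  rcases le_total R ‖x‖ with h1 | h1
  · exact (hR x h1).le.trans (le_max_right _ _)
  · exact (hB x (by simpa using h1)).trans (le_max_left _ _)

variable [MeasurableSpace E] [BorelSpace E] [hE : Fact (Module.finrank ℝ E = 3)] {f : E → ℝ}

section Kernel

variable {F : Type*} [NormedAddCommGroup F] [NormedSpace ℝ F] [FiniteDimensional ℝ F]

/-- The kernel is cut at radius one. Near part: `f` is bounded and tends to zero, while the kernel
is integrable. Far part: `f` is integrable, while the kernel is bounded and tends to zero. -/
theorem tendsto_integral_smul_singular (hf : Continuous f) (hfi : Integrable f)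
    (hf0 : Tendsto f (cocompact E) (𝓝 0)) {k : E → F} (hk : ContinuousOn k {0}ᶜ) {C : ℝ}
    (hC0 : 0 ≤ C) (hC : ∀ z, ‖k z‖ ≤ C * (1 + (‖z‖ ^ 2)⁻¹))
    (hk0 : Tendsto k (cocompact E) (𝓝 0)) :
    Tendsto (fun x => ∫ y, f y • k (x - y)) (cocompact E) (𝓝 0) := by
  have := isCountablyGenerated_cocompact (E := E)
  obtain ⟨B, hB⟩ := bounded_of_tendsto_zero hf hf0
  have hkm : StronglyMeasurable k := stronglyMeasurable_of_continuousOn_compl_zero hk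
  have hball : MeasurableSet (Metric.ball (0 : E) 1) := Metric.isOpen_ball.measurableSet
  set near := (Metric.ball (0 : E) 1).indicator k
  set far := (Metric.ball (0 : E) 1)ᶜ.indicator k
  have hnm : StronglyMeasurable near := hkm.indicator hball
  have hfm : StronglyMeasurable far := hkm.indicator hball.compl
  have hBi : Integrable ((Metric.ball (0 : E) 1).indicator
      fun z : E => B * (C * (1 + (‖z‖ ^ 2)⁻¹))) := by
    refine IntegrableOn.integrable_indicator ?_ hball
    refine ((IntegrableOn.add ?_ (integrableOn_ball_inv_norm_sq 1)).const_mul C).const_mul B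
    exact integrableOn_const (measure_ball_lt_top.ne)
  have hnear_le : ∀ x z, ‖f (x - z) • near z‖ ≤ (Metric.ball (0 : E) 1).indicator
      (fun z : E => B * (C * (1 + (‖z‖ ^ 2)⁻¹))) z := by
    intro x z
    by_cases hz : z ∈ Metric.ball (0 : E) 1
    · simp only [near, Set.indicator_of_mem hz, norm_smul]
      exact mul_le_mul (hB _) (hC z) (norm_nonneg _) ((norm_nonneg _).trans (hB 0))
    · simp [near, Set.indicator_of_notMem hz]
  have hfar_le : ∀ z, ‖far z‖ ≤ C * 2 := by
    intro z
    by_cases hz : z ∈ Metric.ball (0 : E) 1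
    · rw [show far z = 0 from Set.indicator_of_notMem (by simpa using hz) _, norm_zero]
      positivity
    · rw [show far z = k z from Set.indicator_of_mem (by simpa using hz) _]
      exact (hC z).trans (le_one_add_inv_sq_mul hC0 hz)
  have hnear_meas : ∀ x, AEStronglyMeasurable (fun z => f (x - z) • near z) := fun x =>
    (hf.comp (by fun_prop)).aestronglyMeasurable.smul hnm.aestronglyMeasurable
  have hfar_meas : ∀ x, AEStronglyMeasurable (fun y => f y • far (x - y)) := fun x =>
    hf.aestronglyMeasurable.smul
      (hfm.comp_measurable (by fun_prop : Measurable fun y => x - y)).aestronglyMeasurable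
  have hfar_bound : ∀ x y, ‖f y • far (x - y)‖ ≤ ‖f y‖ * (C * 2) := fun x y => by
    rw [norm_smul]; gcongr; exact hfar_le _
  have hsplit : ∀ x, ∫ y, f y • k (x - y) =
      (∫ z, f (x - z) • near z) + ∫ y, f y • far (x - y) := by
    intro x
    have h1 : Integrable fun y => f y • near (x - y) := by
      have := (hBi.mono' (hnear_meas x) (ae_of_all _ (hnear_le x))).comp_sub_left x
      simpa only [sub_sub_cancel] using this
    have h2 : Integrable fun y => f y • far (x - y) :=
      (hfi.norm.mul_const (C * 2)).mono' (hfar_meas x) (ae_of_all _ (hfar_bound x))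
    rw [← integral_sub_left_eq_self (fun z => f (x - z) • near z) volume x]
    simp only [sub_sub_cancel]
    rw [← integral_add h1 h2]
    refine integral_congr_ae (ae_of_all _ fun y => ?_)
    dsimp only
    rw [← smul_add, Set.indicator_self_add_compl_apply]
  have t1 : Tendsto (fun x => ∫ z, f (x - z) • near z) (cocompact E) (𝓝 (∫ _ : E, (0 : F))) := by
    refine tendsto_integral_filter_of_dominated_convergence _ (Eventually.of_forall hnear_meas)
      (Eventually.of_forall fun x => ae_of_all _ (hnear_le x)) hBi (ae_of_all _ fun z => ?_)
    simpa using (hf0.comp (tendsto_sub_const_cocompact z)).smul_const (near z)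
  have hfar0 : Tendsto far (cocompact E) (𝓝 0) := by
    refine squeeze_zero_norm (fun z => ?_) (by simpa using hk0.norm)
    exact norm_indicator_le_norm_self _ _
  have t2 : Tendsto (fun x => ∫ y, f y • far (x - y)) (cocompact E) (𝓝 (∫ _ : E, (0 : F))) := by
    refine tendsto_integral_filter_of_dominated_convergence _ (Eventually.of_forall hfar_meas)
      (Eventually.of_forall fun x => ae_of_all _ (hfar_bound x)) (hfi.norm.mul_const _)
      (ae_of_all _ fun y => ?_)
    simpa using (hfar0.comp (tendsto_sub_const_cocompact y)).const_smul (f y)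
  simp_rw [hsplit]
  simpa using t1.add t2

end Kernel

theorem tendsto_fderiv_logPot (hf : Continuous f) (hfi : Integrable f)
    (hf0 : Tendsto f (cocompact E) (𝓝 0)) :
    Tendsto (fderiv ℝ (logPot f)) (cocompact E) (𝓝 0) := by
  rw [fderiv_logPot hf hfi]
  have := (tendsto_integral_smul_singular hf hfi hf0 continuousOn_logGrad zero_le_one norm_logGrad_le
    (squeeze_zero_norm (fun z => (norm_logGrad z).le)
      (tendsto_inv_atTop_zero.comp tendsto_norm_cocompact_atTop))).neg
  simpa using this

theorem tendsto_fderiv_fderiv_logPot (hf : Continuous f) (hfi : Integrable f)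
    (hf0 : Tendsto f (cocompact E) (𝓝 0)) :
    Tendsto (fderiv ℝ (fderiv ℝ (logPot f))) (cocompact E) (𝓝 0) := by
  rw [fderiv_fderiv_logPot hf hfi]
  have h1 : Tendsto (fun z : E => 3 * (‖z‖ ^ 2)⁻¹) (cocompact E) (𝓝 0) := by
    have := (tendsto_inv_atTop_zero (𝕜 := ℝ)).comp
      ((tendsto_pow_atTop two_ne_zero).comp (tendsto_norm_cocompact_atTop (E := E)))
    simpa using this.const_mul 3
  have := (tendsto_integral_smul_singular hf hfi hf0 continuousOn_logHess zero_le_three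
    norm_logHess_le (squeeze_zero_norm norm_logHess_le_inv_sq h1)).neg
  simpa using this

open Real in
theorem isLittleO_integral_mul_posLog_sub (hf : Continuous f) (hfi : Integrable f) :
    (fun x => (∫ y, f y * (log⁺ ‖y‖ - log⁺ ‖x - y‖)) + (∫ y, f y) * log ‖x‖)
      =o[cocompact E] fun x => log ‖x‖ := by
  have := isCountablyGenerated_cocompact (E := E)
  have hlog := tendsto_log_norm_cocompact (E := E)
  refine isLittleO_of_tendsto' ((hlog.eventually_gt_atTop 0).mono fun x h1 h2 =>
    absurd h2 h1.ne') ?_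
  have heq : ∀ x : E, ((∫ y, f y * (log⁺ ‖y‖ - log⁺ ‖x - y‖)) + (∫ y, f y) * log ‖x‖) / log ‖x‖ =
      ∫ y, f y * ((log⁺ ‖y‖ - log⁺ ‖x - y‖ + log ‖x‖) * (log ‖x‖)⁻¹) := by
    intro x
    rw [← integral_mul_const, ← integral_add (integrable_mul_posLog_sub hf hfi x)
      (hfi.mul_const _), div_eq_mul_inv, ← integral_mul_const]
    refine integral_congr_ae (ae_of_all _ fun y => ?_)
    dsimp only
    ring
  simp_rw [heq]
  rw [show (0 : ℝ) = ∫ _ : E, (0 : ℝ) by simp]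
  -- The factor 3 is `2 + 1`: for `|x| ≥ 2` the kernel difference is at most `log(1 + |x|) ≤ 2
  -- log|x|`, and the added `log|x|` counts once.
  refine tendsto_integral_filter_of_dominated_convergence (fun y => ‖f y‖ * 3) ?_ ?_
    (hfi.norm.mul_const 3) (ae_of_all _ fun y => ?_)
  · refine Eventually.of_forall fun x => (hf.mul ((((continuous_posLog.comp continuous_norm).sub
      (continuous_posLog.comp (continuous_const.sub continuous_id).norm)).add
      continuous_const).mul continuous_const)).aestronglyMeasurable
  · filter_upwards [hlog.eventually_gt_atTop 0,
      (tendsto_norm_cocompact_atTop (E := E)).eventually_ge_atTop 2] with x h0 h2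
    refine ae_of_all _ fun y => ?_
    rw [norm_mul]
    gcongr
    rw [← div_eq_mul_inv, norm_div, norm_of_nonneg h0.le, div_le_iff₀ h0]
    have h3 := abs_posLog_norm_sub_le x y
    have h4 := log_one_add_le h2
    calc _ ≤ |log⁺ ‖y‖ - log⁺ ‖x - y‖| + |log ‖x‖| := abs_add_le _ _
      _ ≤ _ := by rw [abs_of_pos h0]; linarith
  · have h1 : Tendsto (fun x : E => |f y| * ((log⁺ ‖y‖ + log (1 + ‖y‖)) * (log ‖x‖)⁻¹))
        (cocompact E) (𝓝 0) := by
      simpa using ((tendsto_inv_atTop_zero.comp hlog).const_mul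
        (log⁺ ‖y‖ + log (1 + ‖y‖))).const_mul |f y|
    refine squeeze_zero_norm' ?_ h1
    filter_upwards [hlog.eventually_gt_atTop 0,
      (tendsto_norm_cocompact_atTop (E := E)).eventually_ge_atTop 1] with x h0 h2
    rw [norm_mul, norm_mul, norm_inv, norm_of_nonneg h0.le]
    simp only [Real.norm_eq_abs]
    gcongr
    have h3 := abs_posLog_norm_sub_le y x
    rw [norm_sub_rev, posLog_eq_log (x := ‖x‖) (by rwa [abs_of_nonneg (norm_nonneg _)])] at h3
    calc |log⁺ ‖y‖ - log⁺ ‖x - y‖ + log ‖x‖|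
        = |log⁺ ‖y‖ + (log ‖x‖ - log⁺ ‖x - y‖)| := by ring_nf
      _ ≤ |log⁺ ‖y‖| + |log ‖x‖ - log⁺ ‖x - y‖| := abs_add_le _ _
      _ ≤ _ := by rw [abs_of_nonneg posLog_nonneg]; linarith

open Real in
theorem posLog_inv_norm_le_indicator (z : E) : log⁺ ‖z‖⁻¹ ≤
    (Metric.ball (0 : E) 1).indicator (fun z : E => (‖z‖ ^ 2)⁻¹) z ∧ (log⁺ ‖z‖⁻¹) ^ 2 ≤
    (Metric.ball (0 : E) 1).indicator (fun z : E => (‖z‖ ^ 2)⁻¹) z := by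
  have h0 : log⁺ ‖z‖⁻¹ ≤ ‖z‖⁻¹ := by
    refine max_le (by positivity) ?_
    by_cases hz : ‖z‖ = 0
    · simp [hz]
    · exact (log_le_sub_one_of_pos (by positivity : 0 < ‖z‖⁻¹)).trans (by linarith)
  by_cases hz : z ∈ Metric.ball (0 : E) 1
  · rw [Set.indicator_of_mem hz]
    have h1 : ‖z‖ < 1 := by simpa using hz
    have h2 : (log⁺ ‖z‖⁻¹) ^ 2 ≤ (‖z‖ ^ 2)⁻¹ := by
      rw [← inv_pow]; exact pow_le_pow_left₀ posLog_nonneg h0 2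
    refine ⟨?_, h2⟩
    rcases eq_or_ne z 0 with rfl | hz0
    · simp
    · have h3 : 1 ≤ ‖z‖⁻¹ := (one_le_inv₀ (norm_pos_iff.mpr hz0)).mpr h1.le
      refine h0.trans ?_
      rw [← inv_pow]
      exact le_self_pow₀ h3 two_ne_zero
  · rw [Set.indicator_of_notMem hz]
    have h1 : 1 ≤ ‖z‖ := by simpa using hz
    have h2 : log⁺ ‖z‖⁻¹ = 0 := by
      rw [posLog_eq_zero_iff, abs_of_nonneg (by positivity)]
      exact inv_le_one_of_one_le₀ h1
    simp [h2]

open Real in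
theorem integral_mul_posLog_inv_le (hf : Continuous f) (hfi : Integrable f) {B : ℝ}
    (hB : ∀ x, f x ≤ B) (hf0 : ∀ x, 0 ≤ f x) (x : E) : ∫ y, f y * log⁺ ‖x - y‖⁻¹ ≤
    B * ∫ z, (Metric.ball (0 : E) 1).indicator (fun z : E => (‖z‖ ^ 2)⁻¹) z := by
  rw [← integral_sub_left_eq_self
    ((Metric.ball (0 : E) 1).indicator fun z : E => (‖z‖ ^ 2)⁻¹) volume x, ← integral_const_mul]
  refine integral_mono (integrable_mul_posLog_inv_norm_sub hf hfi x)
    ((integrable_indicator_inv_norm_sq.comp_sub_left x).const_mul B) fun y => ?_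
  exact mul_le_mul (hB y) (posLog_inv_norm_le_indicator _).1 posLog_nonneg ((hf0 y).trans (hB y))

open Real in
-- Boundedness of `f` is needed only for the local singularity at `x`, which then contributes a
-- bounded term.
theorem isLittleO_logPot_add (hf : Continuous f) (hfi : Integrable f) {B : ℝ}
    (hB : ∀ x, f x ≤ B) (hf0 : ∀ x, 0 ≤ f x) :
    (fun x => logPot f x + (∫ y, f y) * log ‖x‖) =o[cocompact E] fun x => log ‖x‖ := by
  have h1 := isLittleO_integral_mul_posLog_sub hf hfi
  have hlog : Tendsto (norm ∘ fun x : E => log ‖x‖) (cocompact E) atTop :=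
    tendsto_norm_atTop_atTop.comp tendsto_log_norm_cocompact
  have h2 : (fun x : E => ∫ y, f y * log⁺ ‖x - y‖⁻¹) =o[cocompact E] fun x => log ‖x‖ := by
    refine IsBigO.trans_isLittleO (g := fun _ => (1 : ℝ)) ?_
      (isLittleO_const_left.mpr (Or.inr hlog))
    refine IsBigO.of_bound (B * ∫ z, (Metric.ball (0 : E) 1).indicator
      (fun z : E => (‖z‖ ^ 2)⁻¹) z) (Eventually.of_forall fun x => ?_)
    rw [norm_one, mul_one, norm_of_nonneg
      (integral_nonneg fun y => mul_nonneg (hf0 y) posLog_nonneg)]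
    exact integral_mul_posLog_inv_le hf hfi hB hf0 x
  have h3 : (fun _ : E => ∫ y, f y * log⁺ ‖0 - y‖⁻¹) =o[cocompact E] fun x => log ‖x‖ :=
    isLittleO_const_left.mpr (Or.inr hlog)
  refine ((h1.add h2).sub h3).congr_left fun x => ?_
  rw [logPot_eq hf hfi]
  ring

end LogPotentialAtInfinity

/-! ### Boundedness and decay of a density controlled by its own potential -/

section ExponentialIntegrability

variable {E : Type*} [NormedAddCommGroup E] [InnerProductSpace ℝ E] [FiniteDimensional ℝ E]
  [MeasurableSpace E] [BorelSpace E] [hE : Fact (Module.finrank ℝ E = 3)] {f : E → ℝ}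

theorem integral_rieszPot_mul_le (hf : Continuous f) (hfi : Integrable f) (hf0 : ∀ x, 0 ≤ f x)
    {ψ : E → ℝ} (hψ : Continuous ψ) (hψi : Integrable ψ) {M : ℝ} (hψ0 : ∀ z, 0 ≤ ψ z)
    (hM : ∀ z, ψ z ≤ M) : ∫ z, rieszPot f z * ψ z ≤ (∫ y, f y) * (2 * (∫ z, ψ z) +
      M * ∫ z, (Metric.ball (0 : E) 1).indicator (fun z : E => (‖z‖ ^ 2)⁻¹) z) := by
  have hψc : Continuous fun z => (ψ z : ℂ) := Complex.continuous_ofReal.comp hψ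
  have hnorm : ∀ z, ‖(ψ z : ℂ)‖ = ψ z := fun z => by
    rw [Complex.norm_real, Real.norm_of_nonneg (hψ0 z)]
  have h1 := integral_rieszPot_mul hf hfi hψc hψi.ofReal (M := M) (fun z => (hnorm z).trans_le (hM z))
  have h2 : ((∫ z, rieszPot f z * ψ z : ℝ) : ℂ) = ∫ z, (rieszPot f z : ℂ) * (ψ z : ℂ) := by
    rw [← integral_complex_ofReal]; simp
  rw [← h2] at h1
  have h3 := congrArg norm h1
  rw [Complex.norm_real] at h3
  refine (le_abs_self _).trans (h3.trans_le ?_)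
  rw [← integral_mul_const]
  refine norm_integral_le_of_norm_le (hfi.mul_const _) (ae_of_all _ fun y => ?_)
  rw [norm_mul, Complex.norm_real, Real.norm_of_nonneg (hf0 y)]
  refine mul_le_mul_of_nonneg_left ((norm_integral_le_integral_norm _).trans ?_) (hf0 y)
  have := integral_inv_norm_sq_mul_norm_le hψc hψi.ofReal (fun z => (hnorm z).trans_le (hM z)) y
  simpa only [hnorm] using this

theorem integrable_radialBump_comp_sub (x : E) :
    Integrable fun y : E => radialBump (y - x) :=
  (continuous_radialBump.integrable_of_hasCompactSupport hasCompactSupport_radialBump).comp_sub_right x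

open Real in
/-- Exponential integrability of the logarithmic potential of a density of small mass. -/
theorem exp_integral_posLog_mul_le (hf : Continuous f) (hfi : Integrable f) (hf0 : ∀ x, 0 ≤ f x)
    (hpos : 0 < ∫ y, f y) {K : ℝ} (hm : K * ∫ y, f y ≤ 1) (x : E) :
    exp (K * ∫ y, f y * log⁺ ‖x - y‖⁻¹) * ∫ y, f y ≤ (∫ y, f y) + rieszPot f x := by
  set m := ∫ y, f y
  have hexp : ∀ y, exp (K * m * log⁺ ‖x - y‖⁻¹) ≤ 1 + (‖x - y‖ ^ 2)⁻¹ := by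
    intro y
    have h1 : exp (log⁺ ‖x - y‖⁻¹) ≤ 1 + (‖x - y‖ ^ 2)⁻¹ := by
      rw [posLog_eq_log_max_one (by positivity), exp_log (by positivity)]
      refine max_le (by linarith [show (0 : ℝ) ≤ (‖x - y‖ ^ 2)⁻¹ by positivity]) ?_
      exact inv_le_one_add_inv_sq _
    refine le_trans (exp_le_exp.mpr ?_) h1
    exact mul_le_of_le_one_left posLog_nonneg hm
  have hmeas : Measurable fun y => log⁺ ‖x - y‖⁻¹ :=
    continuous_posLog.measurable.comp (measurable_const.sub measurable_id).norm.inv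
  have hint := integrable_mul_one_add_inv_norm_sq hf hfi x
  have hle : ∀ y, exp (K * m * log⁺ ‖x - y‖⁻¹) * f y ≤ f y * (1 + (‖x - y‖ ^ 2)⁻¹) := fun y => by
    rw [mul_comm]; exact mul_le_mul_of_nonneg_left (hexp y) (hf0 y)
  have hei : Integrable fun y => exp (K * m * log⁺ ‖x - y‖⁻¹) * f y := by
    refine hint.mono' ((measurable_exp.comp (hmeas.const_mul _)).mul
      hf.measurable).aestronglyMeasurable (ae_of_all _ fun y => ?_)
    rw [norm_of_nonneg (mul_nonneg (exp_nonneg _) (hf0 y))]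
    exact hle y
  have hTi := integrable_mul_posLog_inv_norm_sub hf hfi x
  -- Jensen for the probability density `f / m`. Small mass keeps the exponent `K m` at most one, so
  -- the exponential stays below the locally integrable `1 + |z|⁻²`.
  have h1 := exp_div_integral_mul_le (μ := volume) (a := fun y => K * m * log⁺ ‖x - y‖⁻¹) hf0 hfi
    hpos ((hTi.const_mul (K * m)).congr (ae_of_all _ fun y => by dsimp only; ring)) hei
  have h2 : (∫ y, K * m * log⁺ ‖x - y‖⁻¹ * f y) / m = K * ∫ y, f y * log⁺ ‖x - y‖⁻¹ := by
    rw [div_eq_iff hpos.ne', mul_right_comm, ← integral_const_mul (K * m)]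
    refine integral_congr_ae (ae_of_all _ fun y => ?_)
    dsimp only
    ring
  rw [h2] at h1
  refine h1.trans ((integral_mono hei hint hle).trans_eq ?_)
  rw [rieszPot, ← integral_add hfi (integrable_mul_inv_norm_sq hf hfi x)]
  simp only [mul_add, mul_one]

theorem tendsto_integral_mul_radialBump (hf : Continuous f) (hfi : Integrable f) :
    Tendsto (fun x => ∫ y, f y * radialBump ((3 : ℝ)⁻¹ • (x - y))) (cocompact E) (𝓝 0) := by
  have := isCountablyGenerated_cocompact (E := E)
  rw [show (0 : ℝ) = ∫ _ : E, (0 : ℝ) by simp]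
  refine tendsto_integral_filter_of_dominated_convergence (fun y => ‖f y‖) ?_ ?_ hfi.norm
    (ae_of_all _ fun y => ?_)
  · exact Eventually.of_forall fun x =>
      (hf.mul (continuous_radialBump.comp (by fun_prop))).aestronglyMeasurable
  · refine Eventually.of_forall fun x => ae_of_all _ fun y => ?_
    rw [norm_mul, Real.norm_of_nonneg (radialBump_nonneg _)]
    exact mul_le_of_le_one_right (norm_nonneg _) (radialBump_le_one _)
  · refine tendsto_const_nhds.congr' ?_
    filter_upwards [(tendsto_norm_cocompact_atTop.comp
      (tendsto_sub_const_cocompact y)).eventually_gt_atTop 6] with x hx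
    rw [radialBump_eq_zero, mul_zero]
    rw [norm_smul, Real.norm_of_nonneg (by positivity)]
    simp only [Function.comp_apply] at hx
    linarith

open Real in
/-- If `f` is controlled by the exponential of its own logarithmic potential near `x` and has small
mass there, then that potential is bounded at `x`. -/
theorem integral_mul_posLog_inv_le_of_le_exp (hf : Continuous f) (hfi : Integrable f)
    (hf0 : ∀ x, 0 < f x) {M K : ℝ} {x : E}
    (h : ∀ z, ‖x - z‖ ≤ 2 → f z ≤ M * exp (K * ∫ y, f y * log⁺ ‖z - y‖⁻¹))
    (hm : 2 * K * ∫ y, f y * radialBump ((3 : ℝ)⁻¹ • (x - y)) ≤ 1) :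
    ∫ y, f y * log⁺ ‖x - y‖⁻¹ ≤ M ^ 2 * (3 * (∫ y : E, radialBump y) +
      ∫ z, (Metric.ball (0 : E) 1).indicator (fun z : E => (‖z‖ ^ 2)⁻¹) z) +
      ∫ z, (Metric.ball (0 : E) 1).indicator (fun z : E => (‖z‖ ^ 2)⁻¹) z := by
  set J : E → ℝ := (Metric.ball (0 : E) 1).indicator fun z : E => (‖z‖ ^ 2)⁻¹
  set w : E → ℝ := fun y => f y * radialBump ((3 : ℝ)⁻¹ • (x - y)) with hw
  set m := ∫ y, w y
  have hwc : Continuous w := hf.mul (continuous_radialBump.comp (by fun_prop))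
  have hw0 : ∀ y, 0 ≤ w y := fun y => mul_nonneg (hf0 y).le (radialBump_nonneg _)
  have hws : HasCompactSupport w := by
    refine HasCompactSupport.intro (isCompact_closedBall x 6) fun y hy => ?_
    rw [hw]
    dsimp only
    rw [radialBump_eq_zero, mul_zero]
    rw [Metric.mem_closedBall, not_le, dist_eq_norm, norm_sub_rev] at hy
    rw [norm_smul, Real.norm_of_nonneg (by positivity)]
    linarith
  have hwi : Integrable w := hwc.integrable_of_hasCompactSupport hws
  have hmpos : 0 < m := by
    refine hwc.integral_pos_of_hasCompactSupport_nonneg_nonzero hws hw0 (x := x) ?_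
    simp only [hw, sub_self, smul_zero]
    rw [radialBump_eq_one (by simp), mul_one]
    exact (hf0 x).ne'
  set ψ : E → ℝ := fun z => radialBump (z - x)
  have hψc : Continuous ψ := continuous_radialBump.comp (by fun_prop)
  have hψi : Integrable ψ := integrable_radialBump_comp_sub x
  have hψint : ∫ z, ψ z = ∫ y : E, radialBump y := integral_sub_right_eq_self (fun y => radialBump y) x
  -- Squaring doubles the exponent, which explains `2 * K` in the smallness hypothesis. For `z`
  -- within 2 of `x` the local potential only sees points within 3 of `x`, where the cutoff in `w`
  -- is one.
  have hsq : ∀ z, ψ z * f z ^ 2 ≤ M ^ 2 * (ψ z + m⁻¹ * (rieszPot w z * ψ z)) := by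
    intro z
    by_cases hz : 2 < ‖z - x‖
    · simp only [ψ, radialBump_eq_zero hz, zero_mul, mul_zero, add_zero, le_refl]
    · rw [not_lt, norm_sub_rev] at hz
      have h1 : ∫ y, f y * log⁺ ‖z - y‖⁻¹ = ∫ y, w y * log⁺ ‖z - y‖⁻¹ := by
        refine integral_congr_ae (ae_of_all _ fun y => ?_)
        simp only [hw]
        by_cases hy : 1 ≤ ‖z - y‖
        · rw [(posLog_eq_zero_iff _).mpr]
          · simp
          · rw [abs_of_nonneg (by positivity)]; exact inv_le_one_of_one_le₀ hy
        · rw [radialBump_eq_one, mul_one]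
          rw [norm_smul, Real.norm_of_nonneg (by positivity)]
          have := norm_add_le (x - z) (z - y)
          rw [sub_add_sub_cancel] at this
          linarith
      have h2 := h z hz
      have h3 := exp_integral_posLog_mul_le hwc hwi hw0 hmpos hm z
      have h4 : f z ^ 2 ≤ M ^ 2 * exp (2 * K * ∫ y, w y * log⁺ ‖z - y‖⁻¹) := by
        rw [h1] at h2
        refine (pow_le_pow_left₀ (hf0 z).le h2 2).trans_eq ?_
        rw [mul_pow, ← exp_nat_mul]
        congr 2
        push_cast
        ring
      have h5 : exp (2 * K * ∫ y, w y * log⁺ ‖z - y‖⁻¹) ≤ 1 + m⁻¹ * rieszPot w z := by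
        rw [← le_div_iff₀ hmpos] at h3
        refine h3.trans_eq ?_
        rw [add_div, div_self hmpos.ne', inv_mul_eq_div]
      calc ψ z * f z ^ 2 ≤ ψ z * (M ^ 2 * (1 + m⁻¹ * rieszPot w z)) :=
            mul_le_mul_of_nonneg_left (h4.trans (mul_le_mul_of_nonneg_left h5 (sq_nonneg M)))
              (radialBump_nonneg _)
        _ = _ := by ring
  have hpt : ∀ y, f y * log⁺ ‖x - y‖⁻¹ ≤
      M ^ 2 * (ψ y + m⁻¹ * (rieszPot w y * ψ y)) + J (x - y) := by
    intro y
    have h1 := (posLog_inv_norm_le_indicator (x - y)).2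
    have h2 := hsq y
    by_cases hy : 1 ≤ ‖x - y‖
    · rw [(posLog_eq_zero_iff _).mpr, mul_zero]
      · refine add_nonneg (le_trans ?_ h2) (Set.indicator_nonneg (fun _ _ => by positivity) _)
        exact mul_nonneg (radialBump_nonneg _) (sq_nonneg _)
      · rw [abs_of_nonneg (by positivity)]; exact inv_le_one_of_one_le₀ hy
    · have h3 : ψ y = 1 := radialBump_eq_one (by rw [norm_sub_rev]; exact (not_le.mp hy).le)
      rw [h3, one_mul] at h2
      rw [h3]
      -- The local `L²` bound on `f` pairs with the square-integrable logarithmic singularity.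
      have h4 : f y * log⁺ ‖x - y‖⁻¹ ≤ f y ^ 2 + (log⁺ ‖x - y‖⁻¹) ^ 2 := by
        nlinarith [sq_nonneg (f y - log⁺ ‖x - y‖⁻¹), sq_nonneg (f y), sq_nonneg (log⁺ ‖x - y‖⁻¹)]
      linarith
  have hri : Integrable fun z => rieszPot w z * ψ z :=
    ((continuous_rieszPot hwc hwi).mul hψc).integrable_of_hasCompactSupport
      ((hasCompactSupport_radialBump.comp_homeomorph (Homeomorph.subRight x)).mul_left)
  have hJi : Integrable fun y => J (x - y) := integrable_indicator_inv_norm_sq.comp_sub_left x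
  have hsum : Integrable fun y => ψ y + m⁻¹ * (rieszPot w y * ψ y) := hψi.add (hri.const_mul m⁻¹)
  refine (integral_mono (integrable_mul_posLog_inv_norm_sub hf hfi x)
    ((hsum.const_mul (M ^ 2)).add hJi) hpt).trans ?_
  have e1 : ∫ y, (M ^ 2 * (ψ y + m⁻¹ * (rieszPot w y * ψ y)) + J (x - y)) =
      M ^ 2 * ((∫ y : E, radialBump y) + m⁻¹ * ∫ y, rieszPot w y * ψ y) + ∫ y, J y := by
    rw [integral_add (hsum.const_mul _) hJi, integral_const_mul,
      integral_add hψi (hri.const_mul _), integral_const_mul, hψint,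
      integral_sub_left_eq_self J volume x]
  refine e1.trans_le ?_
  have h6 := integral_rieszPot_mul_le hwc hwi hw0 hψc hψi (fun z => radialBump_nonneg _)
    (fun z => radialBump_le_one (z - x))
  rw [hψint] at h6
  have h7 : m⁻¹ * ∫ y, rieszPot w y * ψ y ≤ 2 * (∫ y : E, radialBump y) + 1 * ∫ z, J z := by
    rw [inv_mul_le_iff₀ hmpos]
    exact h6
  have h8 := mul_le_mul_of_nonneg_left h7 (sq_nonneg M)
  linarith

open Real in
theorem exists_le_of_le_exp_logPot (hf : Continuous f) (hfi : Integrable f) (hf0 : ∀ x, 0 < f x)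
    {M K : ℝ} (hK : 0 ≤ K) (hM : 0 ≤ M) (h : ∀ z, f z ≤ M * exp (K * logPot f z)) :
    ∃ B, ∀ x, f x ≤ B := by
  have hV : 0 < ∫ y, f y := by
    rw [integral_pos_iff_support_of_nonneg (fun y => (hf0 y).le) hfi]
    rw [Function.support_eq_univ fun y => (hf0 y).ne']
    exact NeZero.pos _
  -- The long-range part is `-V log|x|` with an error at most `V log|x|` far out, so it is
  -- nonpositive there.
  obtain ⟨R, hR⟩ : ∃ R : ℝ, ∀ x : E, R ≤ ‖x‖ → logPot f x ≤ ∫ y, f y * log⁺ ‖x - y‖⁻¹ := by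
    rw [← eventually_cocompact_iff]
    filter_upwards [(isLittleO_integral_mul_posLog_sub hf hfi).def hV,
      tendsto_log_norm_cocompact.eventually_ge_atTop 0] with x h1 h2
    rw [norm_of_nonneg h2] at h1
    have h3 := (le_abs_self _).trans h1
    have h4 : 0 ≤ ∫ y, f y * log⁺ ‖0 - y‖⁻¹ :=
      integral_nonneg fun y => mul_nonneg (hf0 y).le posLog_nonneg
    rw [logPot_eq hf hfi]
    linarith
  have hsmall : ∀ᶠ x in cocompact E,
      2 * K * ∫ y, f y * radialBump ((3 : ℝ)⁻¹ • (x - y)) ≤ 1 := by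
    have := (tendsto_integral_mul_radialBump hf hfi).const_mul (2 * K)
    rw [mul_zero] at this
    exact (this.eventually (gt_mem_nhds one_pos)).mono fun x hx => hx.le
  obtain ⟨R', hR'⟩ := eventually_cocompact_iff.mp hsmall
  set D := M ^ 2 * (3 * (∫ y : E, radialBump y) +
      ∫ z, (Metric.ball (0 : E) 1).indicator (fun z : E => (‖z‖ ^ 2)⁻¹) z) +
      ∫ z, (Metric.ball (0 : E) 1).indicator (fun z : E => (‖z‖ ^ 2)⁻¹) z
  -- The margin 2 keeps every point within distance 2 of `x` beyond radius `R`.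
  set S := max (max (R + 2) R') R
  obtain ⟨B, hB⟩ := (isCompact_closedBall (0 : E) S).exists_bound_of_continuousOn hf.continuousOn
  refine ⟨max B (M * exp (K * D)), fun x => ?_⟩
  rcases le_total S ‖x‖ with hx | hx
  · refine le_trans ?_ (le_max_right _ _)
    have h1 : R + 2 ≤ ‖x‖ := ((le_max_left _ _).trans (le_max_left _ _)).trans hx
    have h2 : R' ≤ ‖x‖ := ((le_max_right _ _).trans (le_max_left _ _)).trans hx
    have h3 := integral_mul_posLog_inv_le_of_le_exp hf hfi hf0 (x := x) (M := M) (fun z hz => by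
      refine (h z).trans ?_
      gcongr
      refine hR z ?_
      have := norm_sub_norm_le x z
      linarith) (hR' x h2)
    refine (h x).trans ?_
    gcongr
    exact (hR x (by linarith)).trans h3
  · exact ((le_abs_self _).trans (hB x (by simpa using hx))).trans (le_max_left _ _)

open Real in
-- Once `f` is bounded, its potential lies below `-(V/2) log|x|` far out, so `f` decays at least
-- like a negative power of `|x|`.
theorem tendsto_zero_of_le_exp_logPot (hf : Continuous f) (hfi : Integrable f)
    (hf0 : ∀ x, 0 < f x) {M K B : ℝ} (hK : 0 < K) (hM : 0 ≤ M)
    (h : ∀ z, f z ≤ M * exp (K * logPot f z)) (hB : ∀ x, f x ≤ B) :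
    Tendsto f (cocompact E) (𝓝 0) := by
  have hV : 0 < ∫ y, f y := by
    rw [integral_pos_iff_support_of_nonneg (fun y => (hf0 y).le) hfi]
    rw [Function.support_eq_univ fun y => (hf0 y).ne']
    exact NeZero.pos _
  set V := ∫ y, f y
  have hlog := tendsto_log_norm_cocompact (E := E)
  have h1 : Tendsto (fun x : E => M * exp (K * (-(V / 2) * log ‖x‖))) (cocompact E) (𝓝 0) := by
    have h2 : Tendsto (fun x : E => K * (-(V / 2) * log ‖x‖)) (cocompact E) atBot :=
      (hlog.const_mul_atTop_of_neg (by linarith)).const_mul_atBot hK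
    simpa using (tendsto_exp_atBot.comp h2).const_mul M
  refine squeeze_zero' (Eventually.of_forall fun x => (hf0 x).le) ?_ h1
  filter_upwards [(isLittleO_logPot_add hf hfi hB fun x => (hf0 x).le).def (half_pos hV),
    hlog.eventually_ge_atTop 0] with x h2 h3
  rw [norm_of_nonneg h3] at h2
  have h4 := (le_abs_self _).trans h2
  refine (h x).trans ?_
  gcongr
  linarith

end ExponentialIntegrability

instance fact_finrank_euclideanSpace : Fact (Module.finrank ℝ (EuclideanSpace ℝ (Fin 3)) = 3) :=
  ⟨finrank_euclideanSpace_fin⟩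

/-! ### Comparison of a solution with its logarithmic potential -/

section Representation

variable {E : Type*} [NormedAddCommGroup E] [InnerProductSpace ℝ E] [FiniteDimensional ℝ E]
  [MeasurableSpace E] [BorelSpace E] [hE : Fact (Module.finrank ℝ E = 3)] {f u : E → ℝ}

theorem integrable_mul_schwartz {g : E → ℝ} (hg : Continuous g)
    (hgi : Integrable fun x => g x * (1 + ‖x‖ ^ 4)⁻¹) (η : 𝓢(E, ℂ)) :
    Integrable fun x => (g x : ℂ) * η x := by
  obtain ⟨C, -, hC, -⟩ := exists_decay_schwartz η
  refine (hgi.norm.const_mul C).mono' ((Complex.continuous_ofReal.comp hg).mul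
    η.continuous).aestronglyMeasurable (ae_of_all _ fun y => ?_)
  rw [norm_mul, Complex.norm_real, norm_mul,
    Real.norm_of_nonneg (by positivity : 0 ≤ (1 + ‖y‖ ^ 4)⁻¹)]
  have h1 : ‖η y‖ ≤ C * (1 + ‖y‖ ^ 4)⁻¹ := by
    rw [← div_eq_mul_inv, le_div_iff₀ (by positivity), mul_comm]
    exact (mul_le_mul_of_nonneg_right (one_add_norm_pow_le y) (norm_nonneg _)).trans (hC y)
  calc _ ≤ ‖g y‖ * (C * (1 + ‖y‖ ^ 4)⁻¹) := by gcongr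
    _ = _ := by ring

theorem continuous_laplacian (b : OrthonormalBasis (Fin 3) ℝ E) (hu : ContDiff ℝ 2 u) :
    Continuous (Δ u) := by
  have h1 : ContDiff ℝ 1 (fderiv ℝ u) := hu.fderiv_right (by norm_num)
  have h2 : Continuous (fderiv ℝ (fderiv ℝ u)) := h1.continuous_fderiv one_ne_zero
  rw [show Δ u = fun x => ∑ i, fderiv ℝ (fderiv ℝ u) x (b i) (b i) from
    funext (laplacian_eq_sum_fderiv_fderiv b u)]
  fun_prop

/-- A solution of `(-Δ)^{3/2} u = 2 f` differs from the logarithmic potential of `f` by a function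
with constant Laplacian. -/
theorem laplacian_sub_logPot_eq (b : OrthonormalBasis (Fin 3) ℝ E) (hu : ContDiff ℝ 2 u)
    (hui : Integrable fun x => Δ u x * (1 + ‖x‖ ^ 4)⁻¹) (hf : Continuous f) (hfi : Integrable f)
    (h : ∀ φ : 𝓢(E, ℂ), ∫ x, ((-(Δ u x) : ℝ) : ℂ) *
      𝓕⁻ (fun ξ : E => ((2 * Real.pi * ‖ξ‖ : ℝ) : ℂ) * 𝓕 (φ : E → ℂ) ξ) x =
      ∫ x, ((2 * f x : ℝ) : ℂ) * φ x) (x : E) :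
    Δ (fun z => u z - 1 / Real.pi ^ 2 * logPot f z : E → ℝ) x =
      Δ (fun z => u z - 1 / Real.pi ^ 2 * logPot f z : E → ℝ) 0 := by
  set c : ℝ := 1 / Real.pi ^ 2 with hc
  have hlap : ∀ x, Δ (fun z => u z - c * logPot f z : E → ℝ) x = Δ u x + c * rieszPot f x := by
    intro x
    have h1 : (fun x => u x - c * logPot f x) = u + (-c) • logPot f := by
      ext x; simp; ring
    have h2 := contDiff_logPot hf hfi
    have h3 : ContDiff ℝ 2 ((-c) • logPot f) := h2.const_smul (-c)
    rw [h1, hu.contDiffAt.laplacian_add h3.contDiffAt,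
      InnerProductSpace.laplacian_smul _ h2.contDiffAt, laplacian_logPot hf hfi]
    simp
  set g : E → ℝ := fun x => Δ u x + c * rieszPot f x with hg
  have hgc : Continuous g :=
    (continuous_laplacian b hu).add (continuous_const.mul (continuous_rieszPot hf hfi))
  have hgi : Integrable fun x => g x * (1 + ‖x‖ ^ 4)⁻¹ :=
    (hui.add ((integrable_rieszPot_div hf hfi).const_mul c)).congr
      (ae_of_all _ fun x => by simp only [hg, Pi.add_apply]; ring)
  simp_rw [hlap]
  refine eq_of_integral_mul_fourierInv_eq_zero hgc hgi (fun Θ hΘ hs h0 => ?_) x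
  obtain ⟨φ, hφ, hφ'⟩ := exists_schwartzMap_riesz hΘ hs h0
  have h1 := h φ
  rw [hφ] at h1
  set ΘS : 𝓢(E, ℂ) := hs.toSchwartzMap hΘ
  have hS : 𝓕⁻ Θ = ((𝓕⁻ ΘS : 𝓢(E, ℂ)) : E → ℂ) := by
    rw [SchwartzMap.fourierInv_coe]; rfl
  obtain ⟨M, -, hM, -⟩ := exists_decay_schwartz (𝓕⁻ ΘS : 𝓢(E, ℂ))
  have hM' : ∀ z, ‖(𝓕⁻ ΘS : 𝓢(E, ℂ)) z‖ ≤ M := fun z =>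
    (le_mul_of_one_le_left (norm_nonneg _)
      (one_le_pow₀ (by linarith [norm_nonneg z]))).trans (hM z)
  have h2 := integral_rieszPot_mul hf hfi (𝓕⁻ ΘS : 𝓢(E, ℂ)).continuous
    (𝓕⁻ ΘS : 𝓢(E, ℂ)).integrable hM'
  rw [hS] at h1 ⊢
  simp_rw [hS] at hφ'
  simp_rw [hφ'] at h2
  have i1 := integrable_mul_schwartz (continuous_laplacian b hu) hui (𝓕⁻ ΘS : 𝓢(E, ℂ))
  have i2 := integrable_mul_schwartz (continuous_rieszPot hf hfi) (integrable_rieszPot_div hf hfi)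
    (𝓕⁻ ΘS : 𝓢(E, ℂ))
  have h3 : ∫ z, (g z : ℂ) * (𝓕⁻ ΘS : 𝓢(E, ℂ)) z =
      (∫ z, (Δ u z : ℂ) * (𝓕⁻ ΘS : 𝓢(E, ℂ)) z) +
      (c : ℂ) * ∫ z, (rieszPot f z : ℂ) * (𝓕⁻ ΘS : 𝓢(E, ℂ)) z := by
    rw [← integral_const_mul, ← integral_add i1 (i2.const_mul _)]
    refine integral_congr_ae (ae_of_all _ fun z => ?_)
    simp only [hg]
    push_cast
    ring
  have h4 : ∫ z, (Δ u z : ℂ) * (𝓕⁻ ΘS : 𝓢(E, ℂ)) z = -∫ z, ((2 * f z : ℝ) : ℂ) * φ z := by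
    rw [← h1, ← integral_neg]
    refine integral_congr_ae (ae_of_all _ fun z => ?_)
    simp
  -- The normalization `π⁻²` of the potential is what turns `2π²` into the factor 2 of the equation.
  have h5 : (c : ℂ) * ∫ y, (f y : ℂ) * (2 * Real.pi ^ 2 * φ y) =
      ∫ z, ((2 * f z : ℝ) : ℂ) * φ z := by
    rw [← integral_const_mul]
    refine integral_congr_ae (ae_of_all _ fun z => ?_)
    have : (Real.pi : ℂ) ≠ 0 := by exact_mod_cast Real.pi_ne_zero
    simp only [hc]
    push_cast
    field_simp
  rw [h3, h2, h4, h5, neg_add_cancel]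

theorem exp_sub_logPot_le (hf : Continuous f) (hfi : Integrable f) (hf0 : ∀ x, 0 ≤ f x) {c : ℝ}
    (hc : 0 ≤ c) : ∃ A, ∀ z, Real.exp (-(3 * (c * logPot f z))) ≤
      Real.exp (A + 3 * c * (∫ y, f y) * Real.log (1 + ‖z‖)) := by
  refine ⟨3 * (c * ∫ y, f y * Real.posLog ‖0 - y‖⁻¹), fun z => Real.exp_le_exp.mpr ?_⟩
  have := mul_le_mul_of_nonneg_left (le_logPot hf hfi hf0 z) hc
  linarith

theorem norm_iteratedFDeriv_two (g : E → ℝ) (x : E) :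
    ‖iteratedFDeriv ℝ 2 g x‖ = ‖fderiv ℝ (fderiv ℝ g) x‖ := by
  rw [← norm_iteratedFDeriv_one, norm_iteratedFDeriv_fderiv]

end Representation

/-! ### Assembly of the theorem -/

section Main

variable {u : EuclideanSpace ℝ (Fin 3) → ℝ}

/-- The logarithm of the quotient splits except at `y = 0` and `y = x`, a null set. -/
theorem logKernel_ae_eq (x : EuclideanSpace ℝ (Fin 3)) : logKernel u x =ᵐ[volume]
    fun y => Real.exp (3 * u y) * (Real.log ‖y‖ - Real.log ‖x - y‖) := by
  filter_upwards [(Set.toFinite {0, x}).countable.ae_notMem volume] with y hy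
  simp only [Set.mem_insert_iff, Set.mem_singleton_iff, not_or] at hy
  rw [logKernel, Real.log_div (norm_ne_zero_iff.mpr hy.1)
    (norm_ne_zero_iff.mpr (sub_ne_zero.mpr (Ne.symm hy.2))), mul_comm]

theorem logPotential_eq_logPot : logPotential u =
    fun x => 1 / Real.pi ^ 2 * logPot (fun y => Real.exp (3 * u y)) x := by
  ext x
  rw [logPotential, logPot, integral_congr_ae (logKernel_ae_eq x)]

end Main

theorem theorem1p2 (u : EuclideanSpace ℝ (Fin 3) → ℝ)
    (hu : IsSmoothSolution u (fun x => 2 * Real.exp (3 * u x)))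
    (hV : Integrable (fun x => Real.exp (3 * u x)) volume) :
    (∀ x, Integrable (logKernel u x) volume) ∧
    (∃ p : MvPolynomial (Fin 3) ℝ,
      (p.totalDegree = 0 ∨ p.totalDegree = 2) ∧
      BddAbove (Set.range fun x : EuclideanSpace ℝ (Fin 3) =>
        MvPolynomial.eval (fun i => x i) p) ∧
      ∀ x, u x = logPotential u x + MvPolynomial.eval (fun i => x i) p) ∧
    ContDiff ℝ ∞ (logPotential u) ∧
    Tendsto (iteratedFDeriv ℝ 1 (logPotential u))
      (cocompact (EuclideanSpace ℝ (Fin 3))) (𝓝 0) ∧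
    Tendsto (iteratedFDeriv ℝ 2 (logPotential u))
      (cocompact (EuclideanSpace ℝ (Fin 3))) (𝓝 0) ∧
    0 < confVolume u / Real.pi ^ 2 ∧
    (fun x => logPotential u x - (-(confVolume u / Real.pi ^ 2) * Real.log ‖x‖))
      =o[cocompact (EuclideanSpace ℝ (Fin 3))] (fun x => Real.log ‖x‖) := by
  set b := EuclideanSpace.basisFun (Fin 3) ℝ
  set f : EuclideanSpace ℝ (Fin 3) → ℝ := fun x => Real.exp (3 * u x) with hfdef
  set c : ℝ := 1 / Real.pi ^ 2 with hcdef
  have hc0 : 0 < c := by positivity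
  have hf : Continuous f := Real.continuous_exp.comp (continuous_const.mul hu.smooth.continuous)
  have hf0 : ∀ x, 0 < f x := fun x => Real.exp_pos _
  have hf0' : ∀ x, 0 ≤ f x := fun x => (hf0 x).le
  have hVpos : 0 < ∫ y, f y := integral_exp_pos hV
  have hlogPot : logPotential u = fun x => c * logPot f x := logPotential_eq_logPot
  set p : EuclideanSpace ℝ (Fin 3) → ℝ := fun x => u x - c * logPot f x with hp
  have hu2 : ContDiff ℝ 2 u := contDiff_infty.mp hu.smooth 2
  have hp2 : ContDiff ℝ 2 p := hu2.sub (contDiff_const.mul (contDiff_logPot hf hV))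
  have hui : Integrable fun x => Δ u x * (1 + ‖x‖ ^ 4)⁻¹ := by
    refine hu.laplacian_mem.2.mono ((continuous_laplacian b hu2).mul
      continuous_inv_one_add_norm_pow).aestronglyMeasurable (ae_of_all _ fun x => ?_)
    simp [div_eq_mul_inv]
  have hΔ := laplacian_sub_logPot_eq b hu2 hui hf hV hu.weak_eq
  obtain ⟨A, hA⟩ := exp_sub_logPot_le hf hV hf0' hc0.le
  have hB : 0 ≤ 3 * c * ∫ y, f y := by positivity
  -- Uses `e^{3p} = f e^{-3v}` and the lower bound for `v`.
  obtain ⟨C, hC⟩ := exists_le_log_of_exp_le b hp2 hΔ hV hf0' hB (A := A) (fun z => by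
    refine le_of_eq_of_le ?_ (mul_le_mul_of_nonneg_left (hA z) (hf0' z))
    rw [hfdef, ← Real.exp_add]
    congr 1
    simp only [hp]
    ring)
  have hp_smooth : ContDiff ℝ ∞ p := contDiff_of_laplacian_const b hp2 hΔ
  have hquad := eq_quadratic_of_fderiv_fderiv_fderiv_eq_zero hp_smooth
    (fderiv_fderiv_fderiv_apply_eq_zero b hp2 hΔ (by positivity) hC)
  have hsymm : ∀ x y, fderiv ℝ (fderiv ℝ p) 0 x y = fderiv ℝ (fderiv ℝ p) 0 y x := fun x y =>
    (hp2.contDiffAt.isSymmSndFDerivAt (by simp)).eq x y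
  have hbdd := bddAbove_of_quadratic_of_le_log hsymm hquad hC
  obtain ⟨P, hPdeg, hP⟩ := exists_mvPolynomial_of_quadratic (p 0) (fderiv ℝ p 0)
    (fderiv ℝ (fderiv ℝ p) 0)
  have hPp : (fun x : EuclideanSpace ℝ (Fin 3) => MvPolynomial.eval (fun i => x i) P) = p :=
    funext fun x => (hP x).trans (hquad x).symm
  obtain ⟨S, hS⟩ := hbdd
  -- The upper bound `p ≤ S` closes the loop: `f` is now controlled by its own potential.
  have hfM : ∀ z, f z ≤ Real.exp (3 * S) * Real.exp (3 * c * logPot f z) := by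
    intro z
    have := hS (Set.mem_range_self z)
    rw [hfdef, ← Real.exp_add, Real.exp_le_exp]
    simp only [hp] at this
    linarith
  have hK : 0 < 3 * c := by positivity
  obtain ⟨B, hB'⟩ := exists_le_of_le_exp_logPot hf hV hf0 hK.le (Real.exp_nonneg _) hfM
  have hflim := tendsto_zero_of_le_exp_logPot hf hV hf0 hK (Real.exp_nonneg _) hfM hB'
  have hfd : fderiv ℝ (logPotential u) = fun x => c • fderiv ℝ (logPot f) x := by
    ext1 x
    rw [hlogPot]
    exact fderiv_const_mul ((contDiff_logPot hf hV).differentiable two_ne_zero x) c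
  have hfd2 : fderiv ℝ (fderiv ℝ (logPotential u)) =
      fun x => c • fderiv ℝ (fderiv ℝ (logPot f)) x := by
    ext1 x
    rw [hfd]
    exact fderiv_fun_const_smul ((hasFDerivAt_fderiv_logPot hf hV x).differentiableAt) c
  refine ⟨fun x => (integrable_mul_log_sub_log hf hV x).congr (logKernel_ae_eq x).symm,
    ⟨P, ?_, ?_, fun x => ?_⟩, ?_, ?_, ?_, ?_, ?_⟩
  · exact totalDegree_eq_zero_or_two hPdeg (by rw [hPp]; exact ⟨S, hS⟩)
  · rw [hPp]; exact ⟨S, hS⟩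
  · rw [congrFun hPp x, hlogPot]; simp [hp]
  -- Smoothness is inherited from `u` and `p`, with no further derivatives of the singular integral.
  · have : logPotential u = fun x => u x - p x := by rw [hlogPot]; ext x; simp [hp]
    rw [this]
    exact hu.smooth.sub hp_smooth
  · rw [tendsto_zero_iff_norm_tendsto_zero]
    simp_rw [norm_iteratedFDeriv_one, hfd]
    simpa using ((tendsto_fderiv_logPot hf hV hflim).const_smul c).norm
  · rw [tendsto_zero_iff_norm_tendsto_zero]
    simp_rw [norm_iteratedFDeriv_two, hfd2]
    simpa using ((tendsto_fderiv_fderiv_logPot hf hV hflim).const_smul c).norm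
  · exact div_pos hVpos (by positivity)
  · refine ((isLittleO_logPot_add hf hV hB' hf0').const_mul_left c).congr_left fun x => ?_
    rw [hlogPot, confVolume, hcdef]
    ring
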